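/- For $n\ge 1$ let $\Delta_G=\sum_{i=1}^n\frac{\partial^2}{\partial x_i^2}+|x|^2\frac{\partial^2}{\partial u^2}$ be the Grushin operator on $\mathbb R^n_x\times\mathbb R_u$. Let $-\Delta_G$ also denote the nonnegative self-adjoint operator on $L^2(\mathbb R^n\times\mathbb R,dx\,du)$ that extends it from its essentially self-adjoint domain $C_c^\infty$, and let $P=P^{(n)}$ be the Poisson kernel, i.e. the (unique) continuous integral kernel of $e^{-\sqrt{-\Delta_G}}$. For $g=(x,u)$, $g'=(x',u')$ put $$s=|u-u'|,\quad R^2=|x|^2+|x'|^2,\quad D_K=\big[R^4+(2s)^2\big]^{1/4},\quad d_K(g,g')=\Big(\sqrt{R^4+(2s)^2}-2\,x\cdot x'\Big)^{1/2},\quad Q=n+2,$$ and, when $D_K>0$, let $\phi\in[0,\frac{\pi}{2}]$ be determined by $e^{-i\phi}=D_K^{-2}\,[R^2-i(2s)]$. Write $B(\cdot,\cdot)$ for the Beta function, and read $\frac{\sin\phi}{\phi}$ as $1$ when $\phi=0$. **Proposition.** There are constants $U>0$, $C>0$ and $N\in\mathbb N$ such that for all $n\ge N$ the kernel $P$ exists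 and is unique, and for all $g,g'\in\mathbb R^n\times\mathbb R$ with $d_K(g,g')\ge U\sqrt n$, $$P(g,g')=\Big(\frac{\sin\phi}{\phi}\Big)^{\frac32}\,\frac{\Gamma(\frac n2+\frac32)}{\pi^{\frac n2+\frac32}}\;2\,\frac{1}{\sqrt2}\,\frac{d_K(g,g')}{D_K}\,B\Big(\frac n2+1,\frac12\Big)\,d_K(g,g')^{-Q-1}\,(1+\varepsilon_1)(1+\varepsilon_2)$$ for some real numbers $\varepsilon_1,\varepsilon_2$ (depending on $n,g,g'$) with $$|\varepsilon_1|\le C\,\frac{n}{d_K^2(g,g')},\qquad |\varepsilon_2|\le C\,n^{-1/2}.$$ -/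

import Mathlib

open MeasureTheory Filter Topology
open scoped ContDiff

/-- The space `ℝⁿ × ℝ` with points `g = (x, u)`. -/
abbrev GrushinSpace (n : ℕ) : Type := EuclideanSpace ℝ (Fin n) × ℝ

namespace Grushin

/-- `s = |u - u'|`. -/
noncomputable def sepS {n : ℕ} (g g' : GrushinSpace n) : ℝ := |g.2 - g'.2|

/-- `R² = |x|² + |x'|²`. -/
noncomputable def sqR {n : ℕ} (g g' : GrushinSpace n) : ℝ := ‖g.1‖ ^ 2 + ‖g'.1‖ ^ 2

/-- `D_K = (R⁴ + (2s)²)^{1/4}`. -/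
noncomputable def bigD {n : ℕ} (g g' : GrushinSpace n) : ℝ :=
  (sqR g g' ^ 2 + (2 * sepS g g') ^ 2) ^ (1 / 4 : ℝ)

/-- The pseudo-distance `d_K = (√(R⁴ + (2s)²) - 2 x · x')^{1/2}`. -/
noncomputable def dK {n : ℕ} (g g' : GrushinSpace n) : ℝ :=
  √(√(sqR g g' ^ 2 + (2 * sepS g g') ^ 2) - 2 * inner ℝ g.1 g'.1)

/-- The Grushin operator `Δ_G f = ∑ᵢ ∂²f/∂xᵢ² + |x|² ∂²f/∂u²`, for smooth `f`. -/
noncomputable def laplacian {n : ℕ} (f : GrushinSpace n → ℝ) (g : GrushinSpace n) : ℝ :=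
  (∑ i : Fin n, iteratedDeriv 2 (fun t : ℝ => f (g.1 + EuclideanSpace.single i t, g.2)) 0)
    + ‖g.1‖ ^ 2 * iteratedDeriv 2 (fun u => f (g.1, u)) g.2

/-- `φ ∈ C_c^∞(ℝⁿ × ℝ)`. -/
def IsTestFunction {n : ℕ} (φ : GrushinSpace n → ℝ) : Prop :=
  ContDiff ℝ ∞ φ ∧ HasCompactSupport φ

/-- The Hilbert space `L²(ℝⁿ × ℝ, dx du)`. -/
abbrev LTwo (n : ℕ) : Type := Lp ℝ 2 (volume : Measure (GrushinSpace n))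

/-- A strongly continuous semigroup `(T_t)_{t ≥ 0}` of self-adjoint contractions of a Hilbert space.
Such semigroups are exactly the families `T_t = e^{-tB}` with `B` a nonnegative self-adjoint
(in general unbounded) operator. The values `T t` for `t < 0` play no role. -/
structure IsSelfAdjointContractionSemigroup {H : Type*} [NormedAddCommGroup H]
    [InnerProductSpace ℝ H] [CompleteSpace H] (T : ℝ → H →L[ℝ] H) : Prop where
  zero : T 0 = 1
  add : ∀ s t : ℝ, 0 ≤ s → 0 ≤ t → T (s + t) = T s * T t
  selfAdjoint : ∀ t : ℝ, 0 ≤ t → IsSelfAdjoint (T t)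
  contraction : ∀ t : ℝ, 0 ≤ t → ‖T t‖ ≤ 1
  continuous_zero : ∀ f : H, Tendsto (fun t => T t f) (𝓝[>] 0) (𝓝 f)

/-- For `T_t = e^{-tB}`: the vector `f` is in the domain of `B`, and `B f = k`. -/
def GeneratorGraph {H : Type*} [NormedAddCommGroup H] [InnerProductSpace ℝ H]
    (T : ℝ → H →L[ℝ] H) (f k : H) : Prop :=
  Tendsto (fun t : ℝ => t⁻¹ • (f - T t f)) (𝓝[>] 0) (𝓝 k)

/-- `T_t = e^{-t √(-Δ_G)}` on `L²`: one has `T_t = e^{-tB}` with `B` nonnegative self-adjoint, and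
every `φ ∈ C_c^∞` is in the domain of `B²`, with `B² φ = -Δ_G φ`. As `-Δ_G` is essentially
self-adjoint on `C_c^∞`, this says that `B²` is the self-adjoint operator `-Δ_G`, and `B` is its
nonnegative square root. -/
structure IsPoissonSemigroup (n : ℕ) (T : ℝ → LTwo n →L[ℝ] LTwo n) : Prop where
  semigroup : IsSelfAdjointContractionSemigroup T
  generator_sq : ∀ φ : GrushinSpace n → ℝ, IsTestFunction φ →
    ∃ f k l : LTwo n, f =ᵐ[volume] φ ∧ l =ᵐ[volume] (fun g => -laplacian φ g) ∧
      GeneratorGraph T f k ∧ GeneratorGraph T k l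

/-- The continuous function `P` is the integral kernel of the bounded operator `S` of `L²`:
`(S φ)(g) = ∫ P(g, g') φ(g') dg'` for every `φ` in the dense subspace `C_c^∞`. -/
def IsIntegralKernel {n : ℕ} (S : LTwo n →L[ℝ] LTwo n)
    (P : GrushinSpace n → GrushinSpace n → ℝ) : Prop :=
  Continuous (Function.uncurry P) ∧
    ∀ φ : GrushinSpace n → ℝ, IsTestFunction φ → ∀ f : LTwo n, f =ᵐ[volume] φ →
      S f =ᵐ[volume] fun g => ∫ g', P g g' * φ g'

/-- `P` is the Poisson kernel `P_h`, the integral kernel of `e^{-h √(-Δ_G)}`. -/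
def IsPoissonKernel (n : ℕ) (h : ℝ) (P : GrushinSpace n → GrushinSpace n → ℝ) : Prop :=
  ∃ T : ℝ → LTwo n →L[ℝ] LTwo n, IsPoissonSemigroup n T ∧ IsIntegralKernel (T h) P

/-- The main term
`(sin φ / φ)^{3/2} Γ(n/2+3/2) / π^{n/2+3/2} · 2 (1/√2) (d_K/D_K) B(n/2+1, 1/2) d_K^{-Q-1}`,
with `Q = n + 2`; here `sin φ / φ` is `1` at `φ = 0`. -/
noncomputable def mainTerm {n : ℕ} (φ : ℝ) (g g' : GrushinSpace n) : ℝ :=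
  Real.sinc φ ^ (3 / 2 : ℝ)
    * (Real.Gamma (n / 2 + 3 / 2) / Real.pi ^ (n / 2 + 3 / 2 : ℝ))
    * (2 * (1 / √2)) * (dK g g' / bigD g g')
    * ProbabilityTheory.beta (n / 2 + 1) (1 / 2)
    * dK g g' ^ (-((n : ℝ) + 2) - 1)

end Grushin

/-! The proof rests on an exact formula (`poissonKernel`). With a = n/2 + 3/2, the kernel is Γ(a)
π^{-a} times the integral over real z of (sinh z / z)^{3/2} Ψ(z)^{-a}, where Ψ(z) = sinh z / z + R²
cosh z - 2 x·x' - 2is sinh z. Since R² - 2is = D_K² e^{-iφ}, the middle terms combine and Ψ(z) =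
sinh z / z + D_K² cosh(z - iφ) - 2 x·x'. On the shifted line z = w + iφ
(`integral_kernelIntegrand_shift`) the last two terms become the real function d_K² (1 + c²
sinh²(w/2)) with c = √2 D_K / d_K, so the oscillation of these terms is gone.

On that line Laplace's method applies (`exists_laplace_approximation`). Dropping sinh z / z from Ψ
costs a relative error O(n / d_K²), which is ε₁. The integrand is concentrated at |w| of order at
most n^{-1/2}, so freezing (sinh z / z)^{3/2} at its value (sin φ / φ)^{3/2} at w = 0 costs
O(n^{-1/2}), which is ε₂. The substitution v = c sinh(w/2) turns the rest into the integral of (1 +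
v²)^{-a}, that is B(n/2 + 1, 1/2).

The exact formula comes from a cosine transform in u, which turns -Δ_G into the oscillators -Δ_x +
l²|x|², from Mehler's formula for these, and from subordination of the Poisson semigroup to the heat
semigroup. The time integral is then a Gamma integral with complex rate (`integral_timeKernel`).

Existence of a Poisson semigroup is Friedrichs' extension followed by functional calculus of its
resolvent (`exists_isPoissonSemigroup`). Uniqueness does not go through essential self-adjointness:
the formula is proved for every semigroup T satisfying the definition
(`IsPoissonSemigroup.apply_one_ae_eq`). If f is a test function and w_s solves the heat equation of
Δ_G, then F(s,y) = ⟨T_y f, w_s⟩ satisfies ∂_s F + ∂_y² F = 0 for y > 0. Green's identity against the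
Dirichlet heat kernel of the half-line with pole 1 gives F(0,1) as the integral of F(s,0) against
the 1/2-stable density (`abs_sub_integral_subordinator_le`). The w_s used are Gaussians evolved
under the oscillator, times cos(l(u - u₀)), truncated at radius j; truncation costs O(j^{-1/2}).
Averaging over l with a Gaussian weight determines T_1 f against all Gaussian bumps, and these
separate functions (`ae_eq_zero_of_forall_integral_mul_bump`). -/

/-! ### Continuous functional calculus of an operator with spectrum in [0, 1]. -/

section FunctionalCalculus
open Polynomial

variable {H : Type*} [NormedAddCommGroup H] [InnerProductSpace ℝ H]

/-- In an orthonormal eigenbasis p(A) multiplies coordinates by the values of p at the eigenvalues;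
these are Rayleigh quotients, so they lie in [0, 1]. -/
theorem LinearMap.IsSymmetric.norm_aeval_le {K : Type*} [NormedAddCommGroup K]
    [InnerProductSpace ℝ K] [FiniteDimensional ℝ K] {A : K →ₗ[ℝ] K} (hA : A.IsSymmetric)
    (h0 : ∀ x, 0 ≤ inner ℝ (A x) x) (h1 : ∀ x, inner ℝ (A x) x ≤ ‖x‖ ^ 2)
    (p : ℝ[X]) (M : ℝ) (hM : ∀ x ∈ Set.Icc (0 : ℝ) 1, |p.eval x| ≤ M) (w : K) :
    ‖aeval A p w‖ ≤ M * ‖w‖ := by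
  have hM0 : 0 ≤ M := (abs_nonneg _).trans (hM 0 (by simp))
  set b := hA.eigenvectorBasis rfl
  have hev : ∀ i, hA.eigenvalues rfl i ∈ Set.Icc (0 : ℝ) 1 := by
    intro i
    have hb : ‖b i‖ = 1 := b.orthonormal.1 i
    have hi : inner ℝ (A (b i)) (b i) = hA.eigenvalues rfl i := by
      rw [hA.apply_eigenvectorBasis rfl i, inner_smul_left, real_inner_self_eq_norm_sq]
      change _ * ‖b i‖ ^ 2 = _
      simp [hb]
    have := h0 (b i)
    have := h1 (b i)
    rw [hi] at *
    simp [hb] at *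
    constructor <;> assumption
  have hp : ∀ i, aeval A p (b i) = p.eval (hA.eigenvalues rfl i) • b i := by
    intro i
    have hv : Module.End.HasEigenvector A (hA.eigenvalues rfl i) (b i) :=
      hA.hasEigenvector_eigenvectorBasis rfl i
    exact Module.End.aeval_apply_of_hasEigenvector hv
  have hw : aeval A p w = ∑ i, (p.eval (hA.eigenvalues rfl i) * inner ℝ (b i) w) • b i := by
    conv_lhs => rw [← b.sum_repr' w]
    rw [map_sum]
    refine Finset.sum_congr rfl fun i _ => ?_
    rw [map_smul, hp, smul_smul, mul_comm]
  refine le_of_sq_le_sq ?_ (by positivity)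
  rw [mul_pow, ← b.sum_sq_norm_inner_right w, ← b.sum_sq_norm_inner_right (aeval A p w),
    Finset.mul_sum]
  refine Finset.sum_le_sum fun i _ => ?_
  have : inner ℝ (b i) (aeval A p w) = p.eval (hA.eigenvalues rfl i) * inner ℝ (b i) w := by
    rw [hw, b.orthonormal.inner_right_fintype]
  rw [this, norm_mul, mul_pow]
  gcongr
  exact hM _ (hev i)

/-- Reduction to finite dimension: p(J)v only involves the Krylov space spanned by v, Jv, …, J^d v
with d = deg p, and the compression of J to it is symmetric with the same bounds on its quadratic
form. -/
theorem norm_aeval_apply_le {J : H →L[ℝ] H} (hJ : (J : H →ₗ[ℝ] H).IsSymmetric)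
    (h0 : ∀ x, 0 ≤ inner ℝ (J x) x) (h1 : ∀ x, inner ℝ (J x) x ≤ ‖x‖ ^ 2)
    (p : ℝ[X]) (M : ℝ) (hM : ∀ x ∈ Set.Icc (0 : ℝ) 1, |p.eval x| ≤ M) (v : H) :
    ‖aeval J p v‖ ≤ M * ‖v‖ := by
  set d := p.natDegree
  let K : Submodule ℝ H := Submodule.span ℝ (Set.range fun k : Fin (d + 1) => (J ^ (k : ℕ)) v)
  have : FiniteDimensional ℝ K := FiniteDimensional.span_of_finite ℝ (Set.finite_range _)
  have hmem : ∀ k ≤ d, (J ^ k) v ∈ K := fun k hk =>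
    Submodule.subset_span ⟨⟨k, by omega⟩, rfl⟩
  let A : K →ₗ[ℝ] K := (K.orthogonalProjectionOnto : H →ₗ[ℝ] K) ∘ₗ (J : H →ₗ[ℝ] H) ∘ₗ K.subtype
  have hin : ∀ x y : K, inner ℝ (A x) y = inner ℝ (J x) (y : H) := by
    intro x y
    simp [A]
  have hA : A.IsSymmetric := by
    intro x y
    rw [hin, real_inner_comm (A y) x, hin, real_inner_comm (x : H)]
    exact hJ x y
  let v' : K := ⟨v, by simpa using hmem 0 (Nat.zero_le _)⟩
  have hpow : ∀ k ≤ d, (((A ^ k) v' : K) : H) = (J ^ k) v := by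
    intro k
    induction k with
    | zero => intro _; simp [v']
    | succ k ih =>
      intro hk
      rw [pow_succ', pow_succ', Module.End.mul_apply, mul_apply_eq_comp,
        ← ih (by omega)]
      -- Below degree `d` the projection acts trivially, because J^(k+1) v is still one of the
      -- spanning vectors.
      have : J ((A ^ k) v' : K) ∈ K := by
        rw [ih (by omega), ← mul_apply_eq_comp, ← pow_succ']
        exact hmem _ hk
      change ((K.orthogonalProjectionOnto (J ((A ^ k) v' : K)) : K) : H) = _
      exact Submodule.starProjection_eq_self_iff.2 this
  have key : ((aeval A p v' : K) : H) = aeval J p v := by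
    rw [aeval_eq_sum_range, aeval_eq_sum_range]
    simp only [LinearMap.sum_apply, sum_apply, LinearMap.smul_apply,
      smul_apply, Submodule.coe_sum, Submodule.coe_smul]
    refine Finset.sum_congr rfl fun k hk => ?_
    rw [hpow k (by simpa [Nat.lt_succ_iff] using hk)]
  have := hA.norm_aeval_le (fun x => by rw [hin]; exact h0 x)
    (fun x => by rw [hin]; exact h1 x) p M hM v'
  rw [← key]
  simpa [v'] using this

/-- The polynomial calculus is contractive for the sup norm on [0, 1] and polynomials are dense
there (Weierstrass), so it extends; multiplicativity and self-adjointness pass to limits. -/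
theorem exists_functionalCalculus [CompleteSpace H] {J : H →L[ℝ] H} (hJ : IsSelfAdjoint J)
    (h0 : ∀ x, 0 ≤ inner ℝ (J x) x) (h1 : ∀ x, inner ℝ (J x) x ≤ ‖x‖ ^ 2) :
    ∃ Φ : C(Set.Icc (0 : ℝ) 1, ℝ) →L[ℝ] (H →L[ℝ] H),
      (∀ f, ‖Φ f‖ ≤ ‖f‖) ∧ Φ 1 = 1 ∧ (∀ f g, Φ (f * g) = Φ f * Φ g) ∧
      (∀ f, IsSelfAdjoint (Φ f)) ∧ Φ ⟨fun x => (x : ℝ), continuous_subtype_val⟩ = J := by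
  have hsym := hJ.isSymmetric
  let e : ℝ[X] →ₗ[ℝ] C(Set.Icc (0 : ℝ) 1, ℝ) :=
    (toContinuousMapOnAlgHom (Set.Icc (0 : ℝ) 1)).toLinearMap
  let F : ℝ[X] →ₗ[ℝ] (H →L[ℝ] H) := (aeval J).toLinearMap
  have hd : DenseRange e := by
    have := polynomialFunctions_closure_eq_top (0 : ℝ) 1
    rw [DenseRange, dense_iff_closure_eq]
    have h2 := congrArg (fun S : Subalgebra ℝ C(Set.Icc (0 : ℝ) 1, ℝ) =>
      (S : Set C(Set.Icc (0 : ℝ) 1, ℝ))) this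
    simp only [Subalgebra.topologicalClosure_coe, polynomialFunctions_coe, Algebra.coe_top] at h2
    exact h2
  have hn : ∀ p, ‖F p‖ ≤ 1 * ‖e p‖ := by
    intro p
    rw [one_mul]
    refine ContinuousLinearMap.opNorm_le_bound _ (norm_nonneg _) fun v => ?_
    refine norm_aeval_apply_le hsym h0 h1 p _ (fun x hx => ?_) v
    exact (e p).norm_coe_le_norm ⟨x, hx⟩
  set Φ := F.extendOfNorm e with hΦ
  have hΦe : ∀ p, Φ (e p) = F p := fun p => LinearMap.extendOfNorm_eq hd ⟨1, hn⟩ p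
  refine ⟨Φ, fun f => ?_, ?_, ?_, ?_, ?_⟩
  · simpa using LinearMap.norm_extendOfNorm_apply_le hd 1 hn f
  · have := hΦe 1
    have h1 : e 1 = 1 := by ext; simp [e]
    rw [h1] at this
    simpa [F] using this
  · intro f g
    refine hd.induction_on₂ (p := fun f g => Φ (f * g) = Φ f * Φ g) ?_ ?_ f g
    · exact isClosed_eq (by fun_prop) (by fun_prop)
    · intro p q
      have : e p * e q = e (p * q) := by ext; simp [e]
      rw [this, hΦe, hΦe, hΦe]
      simp [F]
  · intro f
    refine hd.induction_on (p := fun f => IsSelfAdjoint (Φ f)) f ?_ ?_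
    · exact isClosed_eq (by fun_prop) (by fun_prop)
    · intro p
      rw [hΦe]
      change IsSelfAdjoint (aeval J p)
      rw [aeval_eq_sum_range]
      refine isSelfAdjoint_sum _ fun k _ => ?_
      exact (IsSelfAdjoint.all _).smul (hJ.pow k)
  · have := hΦe X
    simp only [e, F, AlgHom.toLinearMap_apply, aeval_X] at this
    rw [← this]
    congr 1
    ext x
    simp

end FunctionalCalculus

/-! ### Friedrichs' extension, through its resolvent. -/

section Friedrichs

variable {H : Type*} [NormedAddCommGroup H] [InnerProductSpace ℝ H] [CompleteSpace H]

/-- Friedrichs' construction, in terms of the resolvent: `A` plays the role of `1 + L` for a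
nonnegative symmetric operator `L` with domain the image of `i`. -/
theorem exists_friedrichs_resolvent {𝒟 : Type*} [AddCommGroup 𝒟] [Module ℝ 𝒟]
    (i A : 𝒟 →ₗ[ℝ] H) (hsymm : ∀ f g, inner ℝ (A f) (i g) = inner ℝ (i f) (A g))
    (hpos : ∀ f, ‖i f‖ ^ 2 ≤ inner ℝ (A f) (i f)) :
    ∃ J : H →L[ℝ] H, IsSelfAdjoint J ∧ (∀ x, 0 ≤ inner ℝ (J x) x) ∧
      (∀ x, inner ℝ (J x) x ≤ ‖x‖ ^ 2) ∧ ∀ f, J (A f) = i f := by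
  let core : PreInnerProductSpace.Core ℝ 𝒟 :=
    { inner := fun f g => inner ℝ (A f) (i g)
      conj_inner_symm := fun f g => by
        simp only [conj_trivial]
        rw [hsymm, real_inner_comm]
      re_inner_nonneg := fun f => (sq_nonneg _).trans (hpos f)
      add_left := fun f g h => by simp only [map_add, inner_add_left]
      smul_left := fun f g r => by simp only [map_smul, inner_smul_left] }
  let : SeminormedAddCommGroup 𝒟 := InnerProductSpace.Core.toSeminormedAddCommGroup (c := core)
  let : InnerProductSpace ℝ 𝒟 := InnerProductSpace.ofCore core
  have hin : ∀ f g : 𝒟, inner ℝ f g = inner ℝ (A f) (i g) := fun f g => rfl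
  have hnorm : ∀ f : 𝒟, ‖i f‖ ≤ 1 * ‖f‖ := fun f => by
    rw [one_mul]
    refine le_of_sq_le_sq ?_ (norm_nonneg _)
    rw [← real_inner_self_eq_norm_sq f, hin]
    exact hpos f
  let V := UniformSpace.Completion 𝒟
  let e : 𝒟 →ₗ[ℝ] V := (UniformSpace.Completion.toComplL (𝕜 := ℝ) (E := 𝒟)).toLinearMap
  have hd : DenseRange e := UniformSpace.Completion.denseRange_coe
  have hn : ∀ f, ‖i f‖ ≤ 1 * ‖e f‖ := fun f => by
    have : ‖e f‖ = ‖f‖ := UniformSpace.Completion.norm_coe f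
    rw [this]; exact hnorm f
  -- `V` is the completion in the form norm, and the resolvent will be ι ι*.
  let ι : V →L[ℝ] H := i.extendOfNorm e
  have hι : ∀ f, ι (e f) = i f := fun f => LinearMap.extendOfNorm_eq hd ⟨1, hn⟩ f
  have hιn : ‖ι‖ ≤ 1 := LinearMap.opNorm_extendOfNorm_le hd zero_le_one hn
  have hJin : ∀ x y, inner ℝ ((ι ∘L ι.adjoint) x) y = inner ℝ (ι.adjoint x) (ι.adjoint y) := by
    intro x y
    rw [ContinuousLinearMap.comp_apply, ContinuousLinearMap.adjoint_inner_right]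
  refine ⟨ι ∘L ι.adjoint, ?_, ?_, ?_, ?_⟩
  · rw [ContinuousLinearMap.isSelfAdjoint_iff_isSymmetric]
    intro x y
    change inner ℝ ((ι ∘L ι.adjoint) x) y = inner ℝ x ((ι ∘L ι.adjoint) y)
    rw [real_inner_comm ((ι ∘L ι.adjoint) y), hJin, hJin, real_inner_comm]
  · intro x
    rw [hJin]
    exact real_inner_self_nonneg
  · intro x
    rw [hJin, real_inner_self_eq_norm_sq]
    gcongr
    refine (ι.adjoint.le_opNorm x).trans ?_
    rw [LinearIsometryEquiv.norm_map]
    exact mul_le_of_le_one_left (norm_nonneg _) hιn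
  · intro f
    rw [ContinuousLinearMap.comp_apply]
    -- Tested against the image of g, both sides are ⟨A f, i g⟩, which is the inner product of `V`
    -- by construction; density of these images concludes.
    have : ι.adjoint (A f) = e f := by
      refine ext_inner_right ℝ fun v => ?_
      refine hd.induction_on (p := fun v => inner ℝ (ι.adjoint (A f)) v = inner ℝ (e f) v) v
        (isClosed_eq (by fun_prop) (by fun_prop)) fun g => ?_
      rw [ContinuousLinearMap.adjoint_inner_left, hι]
      exact (UniformSpace.Completion.inner_coe f g).symm
    rw [this, hι]

end Friedrichs

/-! ### The semigroup generated by the square root, from the resolvent. -/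

section Semigroup

variable {H : Type*} [NormedAddCommGroup H] [InnerProductSpace ℝ H] [CompleteSpace H]

/-- `e^{-t √(1/x - 1)}` on `[0, 1]`, with its limits at `x = 0`. -/
noncomputable def rootExp (t x : ℝ) : ℝ :=
  if t = 0 then 1 else if x = 0 then 0 else Real.exp (-(t * √(x⁻¹ - 1)))

theorem rootExp_continuousOn {t : ℝ} (ht : 0 ≤ t) : ContinuousOn (rootExp t) (Set.Icc 0 1) := by
  rcases ht.eq_or_lt with rfl | ht
  · exact (continuousOn_const (c := (1 : ℝ))).congr fun x _ => by simp [rootExp]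
  intro x hx
  rcases hx.1.eq_or_lt with h | h
  · subst h
    have hlim : Tendsto (fun x : ℝ => Real.exp (-(t * √(x⁻¹ - 1)))) (𝓝[>] 0) (𝓝 0) := by
      refine Real.tendsto_exp_neg_atTop_nhds_zero.comp ?_
      refine Tendsto.const_mul_atTop ht ?_
      refine Real.tendsto_sqrt_atTop.comp ?_
      exact tendsto_atTop_add_const_right _ _ tendsto_inv_nhdsGT_zero
    have h0 : rootExp t 0 = 0 := by simp [rootExp, ht.ne']
    rw [ContinuousWithinAt, h0]
    have hsub : Set.Icc (0 : ℝ) 1 ⊆ insert 0 (Set.Ioi 0) := by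
      rintro y ⟨hy, -⟩
      rcases hy.eq_or_lt with h | h
      · exact Or.inl h.symm
      · exact Or.inr h
    refine Tendsto.mono_left ?_ (nhdsWithin_mono _ hsub)
    rw [nhdsWithin_insert, tendsto_sup]
    refine ⟨by simpa [h0] using tendsto_pure_nhds (rootExp t) 0, ?_⟩
    refine hlim.congr' ?_
    filter_upwards [self_mem_nhdsWithin] with y hy
    have hy' : y ≠ 0 := ne_of_gt hy
    simp [rootExp, ht.ne', hy']
  · have : ContinuousAt (fun x : ℝ => Real.exp (-(t * √(x⁻¹ - 1)))) x := by
      have := h.ne'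
      fun_prop (disch := assumption)
    refine ContinuousAt.continuousWithinAt (this.congr ?_)
    filter_upwards [lt_mem_nhds h] with y hy
    simp [rootExp, ht.ne', (ne_of_gt hy : y ≠ 0)]

theorem rootExp_zero (x : ℝ) : rootExp 0 x = 1 := by simp [rootExp]

theorem rootExp_of_pos {t x : ℝ} (hx : 0 < x) : rootExp t x = Real.exp (-(t * √(x⁻¹ - 1))) := by
  by_cases ht : t = 0 <;> simp [rootExp, ht, hx.ne']

theorem rootExp_add {s t : ℝ} (hs : 0 ≤ s) (ht : 0 ≤ t) (x : ℝ) :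
    rootExp (s + t) x = rootExp s x * rootExp t x := by
  rcases hs.eq_or_lt with rfl | hs
  · simp [rootExp_zero]
  rcases ht.eq_or_lt with rfl | ht
  · simp [rootExp_zero]
  by_cases hx : x = 0
  · simp [rootExp, hx, hs.ne', ht.ne', (add_pos hs ht).ne']
  · simp only [rootExp, hs.ne', ht.ne', (add_pos hs ht).ne', hx, if_false]
    rw [← Real.exp_add]; ring_nf

theorem rootExp_mem {t : ℝ} (ht : 0 ≤ t) (x : ℝ) : rootExp t x ∈ Set.Icc (0 : ℝ) 1 := by
  rw [rootExp]
  split_ifs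
  · simp
  · simp
  · exact ⟨(Real.exp_pos _).le, Real.exp_le_one_iff.2 (neg_nonpos.2 (by positivity))⟩

/-- The quadratic loss b² is affordable: for b = √(1/x - 1) a factor x absorbs it, since b² x = 1 -
x ≤ 1. -/
theorem abs_sub_exp_div_le {t b : ℝ} (ht : 0 < t) (hb : 0 ≤ b) :
    |t⁻¹ * (1 - Real.exp (-(t * b))) - b| ≤ t * b ^ 2 := by
  have h1 : Real.exp (-(t * b)) ≥ 1 - t * b := by linarith [Real.add_one_le_exp (-(t * b))]
  have h2 : Real.exp (-(t * b)) ≤ 1 - t * b + (t * b) ^ 2 := by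
    have h := Real.exp_pos (-(t * b))
    have h3 := Real.add_one_le_exp (t * b)
    have h4 : Real.exp (-(t * b)) * Real.exp (t * b) = 1 := by rw [← Real.exp_add]; simp
    have h5 : Real.exp (-(t * b)) * (t * b + 1) ≤ 1 :=
      (mul_le_mul_of_nonneg_left h3 h.le).trans_eq h4
    have : 0 ≤ t * b := by positivity
    have h6 : Real.exp (-(t * b)) ≤ 1 / (t * b + 1) := by rwa [le_div_iff₀ (by positivity)]
    refine h6.trans ?_
    rw [div_le_iff₀ (by positivity)]
    nlinarith [pow_nonneg this 3]
  have h7 : t⁻¹ * (1 - Real.exp (-(t * b))) - b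
      = t⁻¹ * (1 - t * b - Real.exp (-(t * b))) := by field_simp; ring
  rw [h7, abs_mul, abs_of_pos (inv_pos.2 ht), inv_mul_le_iff₀ ht, abs_le]
  constructor <;> nlinarith

/-- Think of J = (1 + B²)⁻¹ with spectral variable x. Then B is √(1/x - 1), so B J is the bounded
function `q` = √(x(1 - x)) and B² J is 1 - x. The semigroup is `rootExp t` applied to J. -/
theorem exists_root_semigroup {J : H →L[ℝ] H} (hJ : IsSelfAdjoint J)
    (h0 : ∀ x, 0 ≤ inner ℝ (J x) x) (h1 : ∀ x, inner ℝ (J x) x ≤ ‖x‖ ^ 2)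
    (hd : DenseRange J) :
    ∃ T : ℝ → H →L[ℝ] H, Grushin.IsSelfAdjointContractionSemigroup T ∧
      ∀ x, ∃ k, Grushin.GeneratorGraph T (J x) k ∧ Grushin.GeneratorGraph T k (x - J x) := by
  obtain ⟨Φ, hΦn, hΦ1, hΦm, hΦs, hΦJ⟩ := exists_functionalCalculus hJ h0 h1
  let f : ℝ → C(Set.Icc (0 : ℝ) 1, ℝ) := fun t =>
    ⟨fun x => rootExp (max t 0) x, (rootExp_continuousOn (le_max_right _ _)).domRestrict⟩
  have hf : ∀ t, 0 ≤ t → ∀ x, f t x = rootExp t x := fun t ht x => by simp [f, ht]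
  let X : C(Set.Icc (0 : ℝ) 1, ℝ) := ⟨fun x => (x : ℝ), continuous_subtype_val⟩
  let q : C(Set.Icc (0 : ℝ) 1, ℝ) := ⟨fun x => √(x * (1 - x)), by fun_prop⟩
  let T : ℝ → H →L[ℝ] H := fun t => Φ (f t)
  have hT1 : ∀ t, 0 ≤ t → ‖T t‖ ≤ 1 := by
    intro t ht
    refine (hΦn _).trans ?_
    rw [ContinuousMap.norm_le _ zero_le_one]
    intro x
    rw [hf t ht, Real.norm_eq_abs, abs_le]
    have := rootExp_mem ht x
    constructor <;> linarith [this.1, this.2]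
  have hb : ∀ x : Set.Icc (0 : ℝ) 1, 0 < (x : ℝ) →
      0 ≤ √((x : ℝ)⁻¹ - 1) ∧ (√((x : ℝ)⁻¹ - 1)) ^ 2 * x = 1 - x ∧
      √((x : ℝ)⁻¹ - 1) * x = √(x * (1 - x)) := by
    intro x hx
    have h : 0 ≤ (x : ℝ)⁻¹ - 1 := by
      rw [sub_nonneg]; exact (one_le_inv₀ hx).2 x.2.2
    refine ⟨Real.sqrt_nonneg _, ?_, ?_⟩
    · rw [Real.sq_sqrt h]; field_simp
    · have : (x : ℝ) * (1 - x) = ((x : ℝ)⁻¹ - 1) * x ^ 2 := by field_simp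
      rw [this, Real.sqrt_mul h, Real.sqrt_sq hx.le]
  have hgen1 : ∀ t, 0 < t → ‖t⁻¹ • ((1 - f t) * X) - q‖ ≤ t := by
    intro t ht
    rw [ContinuousMap.norm_le _ ht.le]
    intro x
    simp only [ContinuousMap.sub_apply, ContinuousMap.smul_apply, ContinuousMap.mul_apply,
      ContinuousMap.one_apply, hf t ht.le, X, q, ContinuousMap.coe_mk, smul_eq_mul, Real.norm_eq_abs]
    rcases x.2.1.eq_or_lt with hx | hx
    · simp [← hx, ht.le]
    · obtain ⟨hb0, hb1, hb2⟩ := hb x hx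
      rw [rootExp_of_pos hx, ← hb2, ← mul_assoc, ← sub_mul, abs_mul, abs_of_pos hx]
      calc _ ≤ (t * (√((x : ℝ)⁻¹ - 1)) ^ 2) * x := by
            gcongr; exact abs_sub_exp_div_le ht hb0
        _ = t * (1 - x) := by rw [mul_assoc, hb1]
        _ ≤ t := by nlinarith
  -- Without the factor `X` there is no uniform convergence: at x = 0 the quotient vanishes while 1
  -- - x = 1.
  have hgen2 : ∀ t, 0 < t → ‖(t⁻¹ • ((1 - f t) * q) - (1 - X)) * X‖ ≤ t := by
    intro t ht
    rw [ContinuousMap.norm_le _ ht.le]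
    intro x
    simp only [ContinuousMap.sub_apply, ContinuousMap.smul_apply, ContinuousMap.mul_apply,
      ContinuousMap.one_apply, hf t ht.le, X, q, ContinuousMap.coe_mk, smul_eq_mul, Real.norm_eq_abs]
    rcases x.2.1.eq_or_lt with hx | hx
    · simp [← hx, ht.le]
    · obtain ⟨hb0, hb1, hb2⟩ := hb x hx
      have hx1 := x.2.2
      set b := √((x : ℝ)⁻¹ - 1)
      rw [rootExp_of_pos hx, ← hb2, ← hb1]
      have e1 : (t⁻¹ * ((1 - Real.exp (-(t * b))) * (b * x)) - b ^ 2 * x) * (x : ℝ)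
          = (t⁻¹ * (1 - Real.exp (-(t * b))) - b) * (b * x ^ 2) := by ring
      rw [e1, abs_mul, abs_of_nonneg (a := b * (x : ℝ) ^ 2) (by positivity)]
      have hs : √((x : ℝ) * (1 - x)) ≤ 1 := Real.sqrt_le_one.2 (by nlinarith)
      calc _ ≤ (t * b ^ 2) * (b * (x : ℝ) ^ 2) := by
            gcongr; exact abs_sub_exp_div_le ht hb0
        _ = t * (b ^ 2 * x) * (b * x) := by ring
        _ = t * (1 - x) * √(x * (1 - x)) := by rw [hb1, hb2]
        _ ≤ t * 1 * 1 := by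
            gcongr
            nlinarith
        _ = t := by ring
  -- This uniform bound, with density of the range of J, later removes the extra factor `X`.
  have hgen3 : ∀ t, 0 < t → ‖t⁻¹ • ((1 - f t) * q)‖ ≤ 1 := by
    intro t ht
    rw [ContinuousMap.norm_le _ zero_le_one]
    intro x
    simp only [ContinuousMap.sub_apply, ContinuousMap.smul_apply, ContinuousMap.mul_apply,
      ContinuousMap.one_apply, hf t ht.le, q, ContinuousMap.coe_mk, smul_eq_mul, Real.norm_eq_abs]
    rcases x.2.1.eq_or_lt with hx | hx
    · simp [← hx]
    · obtain ⟨hb0, hb1, hb2⟩ := hb x hx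
      have hx1 := x.2.2
      set b := √((x : ℝ)⁻¹ - 1)
      rw [rootExp_of_pos hx, ← hb2]
      have h3 : Real.exp (-(t * b)) ≤ 1 := Real.exp_le_one_iff.2 (by
        have : 0 ≤ t * b := by positivity
        linarith)
      have h4 : 1 - Real.exp (-(t * b)) ≤ t * b := by linarith [Real.add_one_le_exp (-(t * b))]
      rw [abs_of_nonneg (by
        have : 0 ≤ 1 - Real.exp (-(t * b)) := by linarith
        positivity), inv_mul_le_iff₀ ht, mul_one]
      calc _ ≤ (t * b) * (b * (x : ℝ)) := by gcongr
        _ = t * (b ^ 2 * x) := by ring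
        _ ≤ t := by rw [hb1]; nlinarith
  have hXn : ∀ x, Φ X x = J x := fun x => by rw [hΦJ]
  have hpos : ∀ᶠ t : ℝ in 𝓝[>] 0, 0 < t := self_mem_nhdsWithin
  have hid : Tendsto (fun t : ℝ => t) (𝓝[>] 0) (𝓝 0) := tendsto_nhdsWithin_of_tendsto_nhds tendsto_id
  have hg : ∀ x, Grushin.GeneratorGraph T (J x) (Φ q x) := by
    intro x
    rw [Grushin.GeneratorGraph, tendsto_iff_norm_sub_tendsto_zero]
    refine squeeze_zero' (Eventually.of_forall fun _ => norm_nonneg _)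
      (g := fun t => t * ‖x‖) ?_ (by simpa using hid.mul_const ‖x‖)
    filter_upwards [hpos] with t ht
    have : t⁻¹ • (J x - T t (J x)) - Φ q x = Φ (t⁻¹ • ((1 - f t) * X) - q) x := by
      simp only [map_sub, map_smul, hΦm, sub_apply, smul_apply, mul_apply_eq_comp, sub_mul,
        one_mul, hXn, T]
    rw [this]
    exact (ContinuousLinearMap.le_opNorm _ _).trans
      (mul_le_mul_of_nonneg_right ((hΦn _).trans (hgen1 t ht)) (norm_nonneg _))
  refine ⟨T, ⟨?_, ?_, ?_, hT1, ?_⟩, fun x => ⟨Φ q x, hg x, ?_⟩⟩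
  · change Φ (f 0) = 1
    rw [← hΦ1]; congr 1; ext x; simp [hf, rootExp_zero]
  · intro s t hs ht
    change Φ _ = Φ _ * Φ _
    rw [← hΦm]; congr 1; ext x
    simp [hf, hs, ht, add_nonneg hs ht, rootExp_add hs ht]
  · intro t _
    exact hΦs _
  · intro x
    -- On the range of J strong continuity follows from differentiability; contractivity carries it
    -- to the closure.
    have hcl : ∀ y, Tendsto (fun t => T t (J y)) (𝓝[>] 0) (𝓝 (J y)) := by
      intro y
      have h := hid.smul (hg y)
      have h2 : Tendsto (fun t : ℝ => J y - t • (t⁻¹ • (J y - T t (J y)))) (𝓝[>] 0) (𝓝 (J y)) := by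
        simpa using h.const_sub (J y)
      refine h2.congr' ?_
      filter_upwards [hpos] with t ht
      rw [smul_smul, mul_inv_cancel₀ ht.ne', one_smul, sub_sub_cancel]
    rw [Metric.tendsto_nhds]
    intro ε hε
    obtain ⟨y, hy⟩ := hd.exists_dist_lt x (show 0 < ε / 3 by positivity)
    filter_upwards [hpos, Metric.tendsto_nhds.1 (hcl y) (ε / 3) (by positivity)] with t ht h
    have h5 : dist (T t x) (T t (J y)) ≤ dist x (J y) := by
      rw [dist_eq_norm, dist_eq_norm, ← map_sub]
      exact ((T t).le_opNorm _).trans (mul_le_of_le_one_left (norm_nonneg _) (hT1 t ht.le))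
    have h6 := dist_triangle4 (T t x) (T t (J y)) (J y) x
    rw [dist_comm (J y) x] at h6
    linarith
  · -- the difference quotients are uniformly bounded, and they converge on the range of `J`
    have hlim : ∀ y, Tendsto (fun t : ℝ => Φ (t⁻¹ • ((1 - f t) * q)) (J y)) (𝓝[>] 0)
        (𝓝 (J y - J (J y))) := by
      intro y
      rw [tendsto_iff_norm_sub_tendsto_zero]
      refine squeeze_zero' (Eventually.of_forall fun _ => norm_nonneg _)
        (g := fun t => t * ‖y‖) ?_ (by simpa using hid.mul_const ‖y‖)
      filter_upwards [hpos] with t ht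
      have : Φ (t⁻¹ • ((1 - f t) * q)) (J y) - (J y - J (J y))
          = Φ ((t⁻¹ • ((1 - f t) * q) - (1 - X)) * X) y := by
        rw [hΦm, mul_apply_eq_comp, hXn, map_sub, map_sub, hΦ1, sub_apply, sub_apply, hXn]
        simp
      rw [this]
      exact (ContinuousLinearMap.le_opNorm _ _).trans
        (mul_le_mul_of_nonneg_right ((hΦn _).trans (hgen2 t ht)) (norm_nonneg _))
    have hJn : ∀ x, ‖J x‖ ≤ ‖x‖ := fun x => by
      have hX : ‖X‖ ≤ 1 := by
        rw [ContinuousMap.norm_le _ zero_le_one]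
        intro x
        rw [Real.norm_eq_abs, abs_le]
        exact ⟨neg_one_lt_zero.le.trans x.2.1, x.2.2⟩
      rw [← hXn]
      exact ((Φ X).le_opNorm _).trans
        (mul_le_of_le_one_left (norm_nonneg _) ((hΦn _).trans hX))
    have heq : ∀ t : ℝ, t⁻¹ • (Φ q x - T t (Φ q x)) = Φ (t⁻¹ • ((1 - f t) * q)) x := by
      intro t
      simp only [map_smul, hΦm, map_sub, hΦ1, sub_apply, smul_apply, mul_apply_eq_comp, T]
      simp
    rw [Grushin.GeneratorGraph]
    simp_rw [heq]
    rw [Metric.tendsto_nhds]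
    intro ε hε
    obtain ⟨y, hy⟩ := hd.exists_dist_lt x (show 0 < ε / 4 by positivity)
    filter_upwards [hpos, Metric.tendsto_nhds.1 (hlim y) (ε / 4) (by positivity)] with t ht h
    have h5 : dist (Φ (t⁻¹ • ((1 - f t) * q)) x) (Φ (t⁻¹ • ((1 - f t) * q)) (J y)) ≤ dist x (J y) := by
      rw [dist_eq_norm, dist_eq_norm, ← map_sub]
      exact (ContinuousLinearMap.le_opNorm _ _).trans
        (mul_le_of_le_one_left (norm_nonneg _) ((hΦn _).trans (hgen3 t ht)))
    have h7 : dist (J y - J (J y)) (x - J x) ≤ 2 * dist x (J y) := by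
      rw [dist_eq_norm, dist_eq_norm]
      have : J y - J (J y) - (x - J x) = J (x - J y) - (x - J y) := by
        simp only [map_sub]; abel
      rw [this]
      linarith [norm_sub_le (J (x - J y)) (x - J y), hJn (x - J y)]
    have h6 := dist_triangle4 (Φ (t⁻¹ • ((1 - f t) * q)) x)
      (Φ (t⁻¹ • ((1 - f t) * q)) (J y)) (J y - J (J y)) (x - J x)
    linarith

end Semigroup

/-! ### Test functions, the energy form, and existence of a Poisson semigroup. -/

namespace Grushin

variable {n : ℕ}

/-- The derivative of `φ` in the direction `v`. -/
noncomputable def dirDeriv (v : GrushinSpace n) (φ : GrushinSpace n → ℝ) (g : GrushinSpace n) : ℝ :=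
  fderiv ℝ φ g v

/-- The `i`-th horizontal coordinate direction. -/
noncomputable def dirX (i : Fin n) : GrushinSpace n := (EuclideanSpace.single i 1, 0)

/-- The vertical direction. -/
def dirU : GrushinSpace n := (0, 1)

theorem IsTestFunction.dirDeriv {φ : GrushinSpace n → ℝ} (hφ : IsTestFunction φ)
    (v : GrushinSpace n) : IsTestFunction (dirDeriv v φ) := by
  refine ⟨?_, ?_⟩
  · exact (hφ.1.fderiv_right (m := ∞) (by simp)).clm_apply contDiff_const
  · exact (hφ.2.fderiv (𝕜 := ℝ)).comp_left (g := fun L : GrushinSpace n →L[ℝ] ℝ => L v) (by simp)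

theorem IsTestFunction.add {φ ψ : GrushinSpace n → ℝ} (hφ : IsTestFunction φ)
    (hψ : IsTestFunction ψ) : IsTestFunction (fun g => φ g + ψ g) :=
  ⟨hφ.1.add hψ.1, hφ.2.add hψ.2⟩

theorem IsTestFunction.mul_left {φ w : GrushinSpace n → ℝ} (hφ : IsTestFunction φ)
    (hw : ContDiff ℝ ∞ w) : IsTestFunction (fun g => w g * φ g) :=
  ⟨hw.mul hφ.1, hφ.2.mul_left⟩

theorem isTestFunction_zero : IsTestFunction (fun _ : GrushinSpace n => (0 : ℝ)) :=
  ⟨contDiff_const, HasCompactSupport.zero⟩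

theorem IsTestFunction.sum {ι : Type*} (s : Finset ι) {φ : ι → GrushinSpace n → ℝ}
    (hφ : ∀ i, IsTestFunction (φ i)) : IsTestFunction (fun g => ∑ i ∈ s, φ i g) := by
  classical
  induction s using Finset.induction_on with
  | empty => simpa using isTestFunction_zero
  | insert a s ha ih => simpa [Finset.sum_insert ha] using (hφ a).add ih

theorem iteratedDeriv_two_line {φ : GrushinSpace n → ℝ} (hφ : ContDiff ℝ ∞ φ)
    (g v : GrushinSpace n) (t : ℝ) :
    iteratedDeriv 2 (fun t : ℝ => φ (g + t • v)) t = dirDeriv v (dirDeriv v φ) (g + t • v) := by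
  have key : ∀ ψ : GrushinSpace n → ℝ, ContDiff ℝ ∞ ψ → ∀ t : ℝ,
      HasDerivAt (fun t : ℝ => ψ (g + t • v)) (dirDeriv v ψ (g + t • v)) t := by
    intro ψ hψ t
    have h1 : HasDerivAt (fun t : ℝ => g + t • v) v t := by
      simpa using ((hasDerivAt_id t).smul_const v).const_add g
    exact ((hψ.differentiable (by simp)) _).hasFDerivAt.comp_hasDerivAt t h1
  have hd : ContDiff ℝ ∞ (dirDeriv v φ) :=
    (hφ.fderiv_right (m := ∞) (by simp)).clm_apply contDiff_const
  rw [show (2 : ℕ) = 1 + 1 from rfl, iteratedDeriv_succ, iteratedDeriv_one]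
  have : deriv (fun t : ℝ => φ (g + t • v)) = fun t => dirDeriv v φ (g + t • v) := by
    ext s; exact (key φ hφ s).deriv
  rw [this]
  exact (key _ hd t).deriv

theorem laplacian_eq {φ : GrushinSpace n → ℝ} (hφ : ContDiff ℝ ∞ φ) (g : GrushinSpace n) :
    laplacian φ g = (∑ i, dirDeriv (dirX i) (dirDeriv (dirX i) φ) g)
      + ‖g.1‖ ^ 2 * dirDeriv dirU (dirDeriv dirU φ) g := by
  rw [laplacian]
  congr 1
  · refine Finset.sum_congr rfl fun i _ => ?_
    have h := iteratedDeriv_two_line hφ g (dirX i) 0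
    simp only [zero_smul, add_zero] at h
    rw [← h]
    congr 1
    ext t
    congr 1
    ext j
    · simp [dirX]
    · simp [dirX]
  · have h := iteratedDeriv_two_line hφ (g.1, 0) dirU g.2
    have e : ((g.1, 0) : GrushinSpace n) + g.2 • dirU = g := by ext <;> simp [dirU]
    rw [e] at h
    rw [← h]
    congr 2
    ext t
    congr 1
    ext <;> simp [dirU]

theorem contDiff_normSq_fst : ContDiff ℝ ∞ (fun g : GrushinSpace n => ‖g.1‖ ^ 2) :=
  contDiff_fst.norm_sq ℝ

theorem IsTestFunction.laplacian {φ : GrushinSpace n → ℝ} (hφ : IsTestFunction φ) :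
    IsTestFunction (laplacian φ) := by
  have : Grushin.laplacian φ = fun g => (∑ i, Grushin.dirDeriv (dirX i) (Grushin.dirDeriv (dirX i) φ) g)
      + ‖g.1‖ ^ 2 * Grushin.dirDeriv dirU (Grushin.dirDeriv dirU φ) g :=
    funext fun g => laplacian_eq hφ.1 g
  rw [this]
  exact (IsTestFunction.sum _ fun i => (hφ.dirDeriv _).dirDeriv _).add
    (((hφ.dirDeriv _).dirDeriv _).mul_left contDiff_normSq_fst)

theorem IsTestFunction.memLp {φ : GrushinSpace n → ℝ} (hφ : IsTestFunction φ) :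
    MemLp φ 2 (volume : Measure (GrushinSpace n)) :=
  hφ.1.continuous.memLp_of_hasCompactSupport hφ.2

theorem IsTestFunction.integrable {φ : GrushinSpace n → ℝ} (hφ : IsTestFunction φ) :
    Integrable φ (volume : Measure (GrushinSpace n)) :=
  hφ.1.continuous.integrable_of_hasCompactSupport hφ.2

theorem IsTestFunction.mul {φ ψ : GrushinSpace n → ℝ} (hφ : IsTestFunction φ)
    (hψ : IsTestFunction ψ) : IsTestFunction (fun g => φ g * ψ g) := hψ.mul_left hφ.1

instance : (volume : Measure (GrushinSpace n)).IsAddHaarMeasure := by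
  change (Measure.prod (volume : Measure (EuclideanSpace ℝ (Fin n))) volume).IsAddHaarMeasure
  infer_instance

theorem integral_mul_dirDeriv {φ ψ : GrushinSpace n → ℝ} (hφ : IsTestFunction φ)
    (hψ : IsTestFunction ψ) (v : GrushinSpace n) :
    ∫ g, φ g * dirDeriv v ψ g = -∫ g, dirDeriv v φ g * ψ g :=
  integral_mul_fderiv_eq_neg_fderiv_mul_of_integrable ((hφ.dirDeriv v).mul hψ).integrable
    (hφ.mul (hψ.dirDeriv v)).integrable (hφ.mul hψ).integrable
    (fun x _ => (hφ.1.differentiable (by simp)) x) (fun x _ => (hψ.1.differentiable (by simp)) x)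

/-- The weight |x|² does not depend on u; this is what makes |x|² ∂_u² formally symmetric. -/
theorem dirDeriv_dirU_normSq_mul {φ : GrushinSpace n → ℝ} (hφ : IsTestFunction φ)
    (g : GrushinSpace n) :
    dirDeriv dirU (fun g => ‖g.1‖ ^ 2 * φ g) g = ‖g.1‖ ^ 2 * dirDeriv dirU φ g := by
  have h1 : HasFDerivAt (fun g : GrushinSpace n => ‖g.1‖ ^ 2)
      (fderiv ℝ (fun g : GrushinSpace n => ‖g.1‖ ^ 2) g) g :=
    (contDiff_normSq_fst.differentiable (by simp) g).hasFDerivAt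
  have h2 : fderiv ℝ (fun g : GrushinSpace n => ‖g.1‖ ^ 2) g dirU = 0 := by
    have h3 : HasFDerivAt (fun g : GrushinSpace n => ‖g.1‖ ^ 2) _ g :=
      (HasFDerivAt.norm_sq (hasFDerivAt_fst (𝕜 := ℝ) (p := g)))
    rw [h3.fderiv]
    simp [dirU]
  have h4 := h1.mul (hφ.1.differentiable (by simp) g).hasFDerivAt
  have h5 : dirDeriv dirU (fun g => ‖g.1‖ ^ 2 * φ g) g
      = (‖g.1‖ ^ 2 • fderiv ℝ φ g + φ g • fderiv ℝ (fun g => ‖g.1‖ ^ 2) g) dirU :=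
    congrArg (fun L : GrushinSpace n →L[ℝ] ℝ => L dirU) h4.fderiv
  rw [h5]
  simp [h2, dirDeriv]

/-- The energy form of `-Δ_G`. -/
noncomputable def energy (φ ψ : GrushinSpace n → ℝ) : ℝ :=
  (∑ i, ∫ g, dirDeriv (dirX i) φ g * dirDeriv (dirX i) ψ g)
    + ∫ g, ‖g.1‖ ^ 2 * (dirDeriv dirU φ g * dirDeriv dirU ψ g)

theorem integral_neg_laplacian_mul {φ ψ : GrushinSpace n → ℝ} (hφ : IsTestFunction φ)
    (hψ : IsTestFunction ψ) : ∫ g, -laplacian φ g * ψ g = energy φ ψ := by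
  have e : ∀ g, -laplacian φ g * ψ g = -((∑ i, ψ g * dirDeriv (dirX i) (dirDeriv (dirX i) φ) g)
      + (‖g.1‖ ^ 2 * ψ g) * dirDeriv dirU (dirDeriv dirU φ) g) := by
    intro g
    rw [laplacian_eq hφ.1, ← Finset.mul_sum]; ring
  have hw := hψ.mul_left contDiff_normSq_fst
  have hi : ∀ i : Fin n, Integrable (fun g => ψ g * dirDeriv (dirX i) (dirDeriv (dirX i) φ) g) :=
    fun i => (hψ.mul ((hφ.dirDeriv (dirX i)).dirDeriv (dirX i))).integrable
  simp_rw [e]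
  rw [integral_neg, integral_add (integrable_finsetSum _ fun i _ => hi i)
    (hw.mul ((hφ.dirDeriv dirU).dirDeriv dirU)).integrable, integral_finsetSum _ fun i _ => hi i,
    integral_mul_dirDeriv hw (hφ.dirDeriv _), neg_add, neg_neg, energy, ← Finset.sum_neg_distrib]
  congr 1
  · refine Finset.sum_congr rfl fun i _ => ?_
    rw [integral_mul_dirDeriv hψ (hφ.dirDeriv _), neg_neg]
    simp_rw [mul_comm]
  · refine integral_congr_ae (Eventually.of_forall fun g => ?_)
    simp only [dirDeriv_dirU_normSq_mul hψ]; ring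

theorem energy_comm (φ ψ : GrushinSpace n → ℝ) : energy φ ψ = energy ψ φ := by
  simp only [energy, mul_comm (dirDeriv _ φ _)]

theorem energy_self_nonneg (φ : GrushinSpace n → ℝ) : 0 ≤ energy φ φ :=
  add_nonneg (Finset.sum_nonneg fun _ _ => integral_nonneg fun _ => mul_self_nonneg _)
    (integral_nonneg fun _ => mul_nonneg (sq_nonneg _) (mul_self_nonneg _))

/-- The space of test functions. -/
def testSpace (n : ℕ) : Submodule ℝ (GrushinSpace n → ℝ) where
  carrier := {φ | IsTestFunction φ}
  add_mem' h1 h2 := h1.add h2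
  zero_mem' := isTestFunction_zero
  smul_mem' c φ h := by
    have := IsTestFunction.mul_left h (contDiff_const (c := c))
    exact this

/-- The class in `L²` of a test function. -/
noncomputable def testClass (n : ℕ) : testSpace n →ₗ[ℝ] LTwo n where
  toFun φ := (IsTestFunction.memLp φ.2).toLp φ.1
  map_add' φ ψ := MemLp.toLp_add (IsTestFunction.memLp φ.2) (IsTestFunction.memLp ψ.2)
  map_smul' c φ := MemLp.toLp_const_smul c (IsTestFunction.memLp φ.2)

/-- `1 - Δ_G` on test functions. -/
noncomputable def oneSubLaplacian (n : ℕ) : testSpace n →ₗ[ℝ] testSpace n where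
  toFun φ := ⟨fun g => φ.1 g + -1 * laplacian φ.1 g,
    IsTestFunction.add φ.2 (IsTestFunction.mul_left (IsTestFunction.laplacian φ.2) contDiff_const)⟩
  map_add' φ ψ := by
    ext g
    have h : ∀ v : GrushinSpace n, dirDeriv v (φ.1 + ψ.1) = dirDeriv v φ.1 + dirDeriv v ψ.1 := by
      intro v; ext g
      have h1 := (φ.2.1.differentiable (by simp) g)
      have h2 := (ψ.2.1.differentiable (by simp) g)
      simp only [dirDeriv, Pi.add_apply]
      rw [fderiv_add h1 h2]; rfl
    have h' : ∀ v : GrushinSpace n, dirDeriv v (dirDeriv v φ.1 + dirDeriv v ψ.1)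
        = dirDeriv v (dirDeriv v φ.1) + dirDeriv v (dirDeriv v ψ.1) := by
      intro v; ext g
      have h1 := ((IsTestFunction.dirDeriv φ.2 v).1.differentiable (by simp) g)
      have h2 := ((IsTestFunction.dirDeriv ψ.2 v).1.differentiable (by simp) g)
      simp only [Pi.add_apply]
      rw [dirDeriv, fderiv_add h1 h2]; rfl
    simp only [Submodule.coe_add, Pi.add_apply]
    have h3 := laplacian_eq (show ContDiff ℝ ∞ (φ.1 + ψ.1) from φ.2.1.add ψ.2.1) g
    rw [laplacian_eq φ.2.1, laplacian_eq ψ.2.1, h3]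
    change φ.1 g + ψ.1 g + -1 * (∑ i, dirDeriv (dirX i) (dirDeriv (dirX i) (φ.1 + ψ.1)) g
      + ‖g.1‖ ^ 2 * dirDeriv dirU (dirDeriv dirU (φ.1 + ψ.1)) g) = _
    simp only [h, h', Pi.add_apply, Finset.sum_add_distrib]
    ring
  map_smul' c φ := by
    ext g
    have h : ∀ v : GrushinSpace n, ∀ ψ : GrushinSpace n → ℝ,
        dirDeriv v (c • ψ) = c • dirDeriv v ψ := by
      intro v ψ; ext g
      simp only [dirDeriv, Pi.smul_apply]
      rw [fderiv_const_smul_field]; rfl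
    simp only [Submodule.coe_smul, RingHom.id_apply]
    have h3 := laplacian_eq (show ContDiff ℝ ∞ (c • φ.1) from φ.2.1.const_smul c) g
    rw [h3]
    change (c • φ.1) g + -1 * (∑ i, dirDeriv (dirX i) (dirDeriv (dirX i) (c • φ.1)) g
      + ‖g.1‖ ^ 2 * dirDeriv dirU (dirDeriv dirU (c • φ.1)) g) = _
    simp only [h, Pi.smul_apply, smul_eq_mul, ← Finset.mul_sum, laplacian_eq φ.2.1]
    ring

theorem inner_testClass (φ ψ : testSpace n) :
    inner ℝ (testClass n φ) (testClass n ψ) = ∫ g, φ.1 g * ψ.1 g := by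
  rw [L2.inner_def]
  refine integral_congr_ae ?_
  filter_upwards [(IsTestFunction.memLp φ.2).coeFn_toLp, (IsTestFunction.memLp ψ.2).coeFn_toLp]
    with g h1 h2
  simp [testClass, h1, h2, mul_comm]

theorem inner_oneSubLaplacian (φ ψ : testSpace n) :
    inner ℝ (testClass n (oneSubLaplacian n φ)) (testClass n ψ)
      = inner ℝ (testClass n φ) (testClass n ψ) + energy φ.1 ψ.1 := by
  rw [inner_testClass, inner_testClass, ← integral_neg_laplacian_mul φ.2 ψ.2, ← integral_add
    (IsTestFunction.mul φ.2 ψ.2).integrable]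
  · refine integral_congr_ae (Eventually.of_forall fun g => ?_)
    simp only [oneSubLaplacian, LinearMap.coe_mk, AddHom.coe_mk]; ring
  · have := (IsTestFunction.mul (IsTestFunction.laplacian φ.2) ψ.2).integrable.neg
    refine this.congr (Eventually.of_forall fun g => ?_)
    simp

/-- A vector orthogonal to all test functions is locally integrable with vanishing integral against
each of them, hence zero. -/
theorem dense_range_testClass (n : ℕ) : DenseRange (testClass n) := by
  rw [DenseRange, ← LinearMap.coe_range, Submodule.dense_iff_topologicalClosure_eq_top,
    Submodule.topologicalClosure_eq_top_iff, Submodule.eq_bot_iff]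
  intro f hf
  rw [Submodule.mem_orthogonal] at hf
  have hloc : LocallyIntegrable f (volume : Measure (GrushinSpace n)) :=
    (Lp.memLp f).locallyIntegrable (by norm_num)
  rw [Lp.eq_zero_iff_ae_eq_zero]
  refine ae_eq_zero_of_integral_contDiff_smul_eq_zero hloc fun φ h1 h2 => ?_
  have h := hf (testClass n ⟨φ, h1, h2⟩) ⟨_, rfl⟩
  rw [L2.inner_def] at h
  rw [← h]
  refine integral_congr_ae ?_
  filter_upwards [(IsTestFunction.memLp ⟨h1, h2⟩).coeFn_toLp] with g hg
  simp [testClass, hg, mul_comm]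

/-- Friedrichs' construction for A = 1 - Δ_G on test functions gives J(Aφ) = φ, so the range of J is
dense and B² φ = Aφ - φ = -Δ_G φ. Only existence is claimed here; that the resulting kernel does not
depend on the extension is seen later. -/
theorem exists_isPoissonSemigroup (n : ℕ) : ∃ T, IsPoissonSemigroup n T := by
  obtain ⟨J, hJ, h0, h1, hJA⟩ := exists_friedrichs_resolvent (testClass n)
    (testClass n ∘ₗ oneSubLaplacian n)
    (fun φ ψ => by
      rw [LinearMap.comp_apply, LinearMap.comp_apply, inner_oneSubLaplacian,
        real_inner_comm (testClass n (oneSubLaplacian n ψ)), inner_oneSubLaplacian, energy_comm,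
        real_inner_comm])
    (fun φ => by
      rw [LinearMap.comp_apply, inner_oneSubLaplacian, real_inner_self_eq_norm_sq]
      linarith [energy_self_nonneg φ.1])
  have hd : DenseRange J := by
    refine (dense_range_testClass n).mono ?_
    rintro _ ⟨φ, rfl⟩
    exact ⟨_, hJA φ⟩
  obtain ⟨T, hT, hgen⟩ := exists_root_semigroup hJ h0 h1 hd
  refine ⟨T, hT, fun φ hφ => ?_⟩
  obtain ⟨k, hk1, hk2⟩ := hgen (testClass n (oneSubLaplacian n ⟨φ, hφ⟩))
  have hJφ := hJA ⟨φ, hφ⟩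
  rw [LinearMap.comp_apply] at hJφ
  rw [hJφ] at hk1 hk2
  refine ⟨_, k, _, hφ.memLp.coeFn_toLp, ?_, hk1, hk2⟩
  have h3 := (IsTestFunction.memLp (oneSubLaplacian n ⟨φ, hφ⟩).2).coeFn_toLp
  filter_upwards [Lp.coeFn_sub (testClass n (oneSubLaplacian n ⟨φ, hφ⟩)) (testClass n ⟨φ, hφ⟩), h3,
    hφ.memLp.coeFn_toLp] with g e1 e2 e3
  rw [e1, Pi.sub_apply]
  simp only [testClass, LinearMap.coe_mk, AddHom.coe_mk]
  rw [e2, e3]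
  simp [oneSubLaplacian]

end Grushin

/-! ### Calculus along a self-adjoint contraction semigroup. -/

namespace Grushin

section GeneratorGraph

variable {H : Type*} [NormedAddCommGroup H] [InnerProductSpace ℝ H] [CompleteSpace H]
  {T : ℝ → H →L[ℝ] H}

theorem IsSelfAdjointContractionSemigroup.inner_comm (hT : IsSelfAdjointContractionSemigroup T)
    {t : ℝ} (ht : 0 ≤ t) (f g : H) : inner ℝ (T t f) g = inner ℝ f (T t g) :=
  (hT.selfAdjoint t ht).isSymmetric f g

theorem IsSelfAdjointContractionSemigroup.norm_le (hT : IsSelfAdjointContractionSemigroup T)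
    {t : ℝ} (ht : 0 ≤ t) (f : H) : ‖T t f‖ ≤ ‖f‖ :=
  ((T t).le_opNorm f).trans (mul_le_of_le_one_left (norm_nonneg _) (hT.contraction t ht))

theorem IsSelfAdjointContractionSemigroup.apply_add (hT : IsSelfAdjointContractionSemigroup T)
    {s t : ℝ} (hs : 0 ≤ s) (ht : 0 ≤ t) (f : H) : T (s + t) f = T s (T t f) := by
  rw [hT.add s t hs ht, mul_apply_eq_comp]

theorem GeneratorGraph.symm_inner (hT : IsSelfAdjointContractionSemigroup T) {f k f' k' : H}
    (h : GeneratorGraph T f k) (h' : GeneratorGraph T f' k') : inner ℝ k f' = inner ℝ f k' := by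
  have h1 := h.inner (𝕜 := ℝ) (tendsto_const_nhds (x := f'))
  have h2 := (tendsto_const_nhds (x := f)).inner h' (𝕜 := ℝ)
  refine tendsto_nhds_unique h1 (h2.congr' ?_)
  filter_upwards [self_mem_nhdsWithin] with t ht
  rw [inner_smul_left, inner_smul_right, inner_sub_left, inner_sub_right,
    hT.inner_comm (le_of_lt ht)]
  simp

theorem GeneratorGraph.apply (hT : IsSelfAdjointContractionSemigroup T) {f k : H}
    (h : GeneratorGraph T f k) {τ : ℝ} (hτ : 0 ≤ τ) : GeneratorGraph T (T τ f) (T τ k) := by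
  have h1 := ((T τ).continuous.tendsto k).comp h
  refine h1.congr' ?_
  filter_upwards [self_mem_nhdsWithin] with t ht
  have ht' : (0 : ℝ) ≤ t := le_of_lt ht
  simp only [Function.comp, map_smul, map_sub]
  rw [← hT.apply_add hτ ht', ← hT.apply_add ht' hτ, add_comm]

/-- By contractivity and the semigroup law, ‖T_a f - T_b f‖ ≤ ‖T_{|a-b|} f - f‖, so continuity at 0
suffices. -/
theorem IsSelfAdjointContractionSemigroup.continuousOn (hT : IsSelfAdjointContractionSemigroup T)
    (f : H) : ContinuousOn (fun τ => T τ f) (Set.Ici 0) := by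
  have hmod : ∀ a b : ℝ, 0 ≤ a → 0 ≤ b → dist (T a f) (T b f) ≤ dist (T |a - b| f) f := by
    have key : ∀ a b : ℝ, 0 ≤ a → a ≤ b → dist (T a f) (T b f) ≤ dist (T |a - b| f) f := by
      intro a b ha hab
      have : b = a + |a - b| := by rw [abs_of_nonpos (by linarith)]; ring
      conv_lhs => rw [this]
      rw [hT.apply_add ha (abs_nonneg _), dist_eq_norm, dist_eq_norm, ← map_sub, ← norm_neg,
        ← map_neg, neg_sub]
      exact hT.norm_le ha _
    intro a b ha hb
    rcases le_total a b with h | h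
    · exact key a b ha h
    · rw [dist_comm, abs_sub_comm]; exact key b a hb h
  intro τ hτ
  rw [ContinuousWithinAt, Metric.tendsto_nhds]
  intro ε hε
  have h0 : Tendsto (fun t => T t f) (𝓝[≥] 0) (𝓝 f) := by
    have : Set.Ici (0 : ℝ) = insert 0 (Set.Ioi 0) := by
      ext x; simp [le_iff_eq_or_lt, eq_comm]
    rw [this, nhdsWithin_insert, tendsto_sup]
    refine ⟨?_, hT.continuous_zero f⟩
    have h1 : T 0 f = f := by rw [hT.zero]; rfl
    simpa [h1] using tendsto_pure_nhds (fun t => T t f) 0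
  have h2 : Tendsto (fun a : ℝ => |a - τ|) (𝓝[Set.Ici 0] τ) (𝓝[≥] 0) := by
    rw [tendsto_nhdsWithin_iff]
    refine ⟨?_, Eventually.of_forall fun a => Set.mem_Ici.2 (abs_nonneg _)⟩
    have : Tendsto (fun a : ℝ => |a - τ|) (𝓝 τ) (𝓝 |τ - τ|) := Continuous.tendsto (by fun_prop) τ
    simp only [sub_self, abs_zero] at this
    exact tendsto_nhdsWithin_of_tendsto_nhds this
  filter_upwards [Metric.tendsto_nhds.1 (h0.comp h2) ε hε, self_mem_nhdsWithin] with a ha ha0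
  exact (hmod a τ ha0 hτ).trans_lt ha

/-- `GeneratorGraph` only provides right derivatives. These are continuous in time, so the orbit is
a primitive of its right derivative and is therefore differentiable from both sides. -/
theorem GeneratorGraph.hasDerivAt (hT : IsSelfAdjointContractionSemigroup T) {f k : H}
    (h : GeneratorGraph T f k) {τ : ℝ} (hτ : 0 < τ) :
    HasDerivAt (fun τ => T τ f) (-T τ k) τ := by
  let K : ℝ → H := fun σ => T (max σ 0) k
  have hK : Continuous K := by
    have := (hT.continuousOn k).comp_continuous (f := fun σ : ℝ => max σ 0) (by fun_prop)
      (fun σ => Set.mem_Ici.2 (le_max_right _ _))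
    exact this
  have hright : ∀ a : ℝ, 0 ≤ a → HasDerivWithinAt (fun τ => T τ f) (-K a) (Set.Ioi a) a := by
    intro a ha
    rw [hasDerivWithinAt_iff_tendsto_slope' (by simp)]
    have h1 := (h.apply hT ha).neg
    have h2 : Tendsto (fun b : ℝ => b - a) (𝓝[>] a) (𝓝[>] 0) := by
      rw [tendsto_nhdsWithin_iff]
      constructor
      · have : Tendsto (fun b : ℝ => b - a) (𝓝 a) (𝓝 (a - a)) := Continuous.tendsto (by fun_prop) a
        rw [sub_self] at this
        exact tendsto_nhdsWithin_of_tendsto_nhds this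
      · filter_upwards [self_mem_nhdsWithin] with b hb
        simpa using hb
    have hKa : K a = T a k := by simp [K, ha]
    rw [hKa]
    refine (h1.comp h2).congr' ?_
    filter_upwards [self_mem_nhdsWithin] with b hb
    have hb' : 0 ≤ b - a := sub_nonneg.2 (le_of_lt hb)
    simp only [Function.comp, slope, vsub_eq_sub]
    rw [← hT.apply_add hb' ha, sub_add_cancel, ← smul_neg, neg_sub]
  have hint : ∀ b : ℝ, 0 ≤ b → ∫ σ in (0 : ℝ)..b, -K σ = T b f - T 0 f := by
    intro b hb
    refine intervalIntegral.integral_eq_sub_of_hasDeriv_right (f := fun τ => T τ f) ?_ ?_ ?_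
    · refine (hT.continuousOn f).mono ?_
      rw [Set.uIcc_of_le hb]; exact fun x hx => hx.1
    · intro x hx
      rw [min_eq_left hb] at hx
      exact hright x hx.1.le
    · exact hK.neg.intervalIntegrable _ _
  have hd : HasDerivAt (fun b => T 0 f + ∫ σ in (0 : ℝ)..b, -K σ) (-K τ) τ :=
    (intervalIntegral.integral_hasDerivAt_right (hK.neg.intervalIntegrable _ _)
      (hK.neg.stronglyMeasurableAtFilter _ _) hK.neg.continuousAt).const_add _
  have hKτ : K τ = T τ k := by simp [K, hτ.le]
  rw [← hKτ]
  refine hd.congr_of_eventuallyEq ?_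
  filter_upwards [lt_mem_nhds hτ] with b hb
  rw [hint b hb.le]; abel

end GeneratorGraph

end Grushin

/-! ### Heat kernels of the line and of the half-line. -/

section Dirichlet

/-- The heat kernel of the line. -/
noncomputable def lineHeat (r y : ℝ) : ℝ := (√(4 * Real.pi * r))⁻¹ * Real.exp (-(y ^ 2 / (4 * r)))

/-- The density of the `1/2`-stable subordinator. -/
noncomputable def subordinator (r : ℝ) : ℝ := lineHeat r 1 / r

/-- The Dirichlet heat kernel of the half-line, with one argument equal to `1`. -/
noncomputable def halfLineHeat (r y : ℝ) : ℝ := lineHeat r (y - 1) - lineHeat r (y + 1)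

theorem lineHeat_nonneg (r y : ℝ) : 0 ≤ lineHeat r y := by unfold lineHeat; positivity

theorem integrable_lineHeat {r : ℝ} (hr : 0 < r) : Integrable (lineHeat r) := by
  have h := (integrable_exp_neg_mul_sq (b := 1 / (4 * r)) (by positivity)).const_mul
    ((√(4 * Real.pi * r))⁻¹)
  refine h.congr (Eventually.of_forall fun y => ?_)
  simp only [lineHeat]; congr 2; ring

theorem integral_lineHeat {r : ℝ} (hr : 0 < r) : ∫ y, lineHeat r y = 1 := by
  have h := integral_gaussian (1 / (4 * r))
  have e : ∀ y, lineHeat r y = (√(4 * Real.pi * r))⁻¹ * Real.exp (-(1 / (4 * r)) * y ^ 2) := by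
    intro y; simp only [lineHeat]; congr 2; ring
  simp_rw [e]
  rw [integral_const_mul, h, show Real.pi / (1 / (4 * r)) = 4 * Real.pi * r by field_simp]
  exact inv_mul_cancel₀ (by positivity)

theorem hasDerivAt_lineHeat_right (r y : ℝ) :
    HasDerivAt (lineHeat r) (-(y / (2 * r)) * lineHeat r y) y := by
  have h : HasDerivAt (fun y : ℝ => -(y ^ 2 / (4 * r))) (-(y / (2 * r))) y := by
    have := ((hasDerivAt_pow 2 y).div_const (4 * r)).neg
    refine this.congr_deriv ?_
    by_cases hr : r = 0
    · simp [hr]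
    · field_simp; norm_num; ring
  refine (h.exp.const_mul _).congr_deriv ?_
  simp only [lineHeat]; ring

theorem hasDerivAt_lineHeat_right_two (r y : ℝ) :
    HasDerivAt (fun y => -(y / (2 * r)) * lineHeat r y)
      ((y ^ 2 / (4 * r ^ 2) - 1 / (2 * r)) * lineHeat r y) y := by
  have h := (((hasDerivAt_id y).div_const (2 * r)).neg).mul (hasDerivAt_lineHeat_right r y)
  refine h.congr_deriv ?_
  by_cases hr : r = 0
  · simp [hr]
  · simp only [id, Pi.neg_apply]; field_simp; ring

theorem hasDerivAt_lineHeat_left {r : ℝ} (hr : 0 < r) (y : ℝ) :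
    HasDerivAt (fun r => lineHeat r y)
      ((y ^ 2 / (4 * r ^ 2) - 1 / (2 * r)) * lineHeat r y) r := by
  have hp : 0 < 4 * Real.pi * r := by positivity
  have h1 : HasDerivAt (fun r : ℝ => √(4 * Real.pi * r)) (4 * Real.pi / (2 * √(4 * Real.pi * r))) r := by
    refine HasDerivAt.sqrt ?_ hp.ne'
    simpa using (hasDerivAt_id r).const_mul (4 * Real.pi)
  have h2 := h1.inv (Real.sqrt_ne_zero'.2 hp)
  have h3 : HasDerivAt (fun r : ℝ => -(y ^ 2 / (4 * r))) (y ^ 2 / (4 * r ^ 2)) r := by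
    have := (((hasDerivAt_id r).const_mul 4).inv (by simpa using hr.ne')).const_mul (y ^ 2)
    refine this.neg.congr_deriv ?_
    simp only [id]; field_simp
  refine (h2.mul h3.exp).congr_deriv ?_
  have hs : √(4 * Real.pi * r) ^ 2 = 4 * Real.pi * r := Real.sq_sqrt hp.le
  have hs0 : √(4 * Real.pi * r) ≠ 0 := Real.sqrt_ne_zero'.2 hp
  simp only [lineHeat, Pi.inv_apply]
  generalize √(4 * Real.pi * r) = q at *
  generalize Real.exp (-(y ^ 2 / (4 * r))) = e
  rw [hs]
  field_simp
  ring

/-- Local domination in time, so that a single integrable majorant serves when differentiating under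
the integral at `r₀`. -/
theorem lineHeat_le {r r₀ : ℝ} (hr0 : 0 < r₀) (hr : r₀ / 2 ≤ r) (hr' : r ≤ 2 * r₀) (y : ℝ) :
    lineHeat r y ≤ 4 * lineHeat (2 * r₀) y := by
  have hrp : 0 < r := by linarith
  unfold lineHeat
  rw [← mul_assoc]
  have h1 : (√(4 * Real.pi * r))⁻¹ ≤ 4 * (√(4 * Real.pi * (2 * r₀)))⁻¹ := by
    have : √(4 * Real.pi * (2 * r₀)) ≤ 4 * √(4 * Real.pi * r) := by
      rw [show (4 : ℝ) * √(4 * Real.pi * r) = √(4 ^ 2 * (4 * Real.pi * r)) by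
        rw [Real.sqrt_mul (by norm_num : (0 : ℝ) ≤ 4 ^ 2), Real.sqrt_sq (by norm_num)]]
      refine Real.sqrt_le_sqrt ?_
      nlinarith [Real.pi_pos]
    rw [inv_le_iff_one_le_mul₀ (by positivity), ← div_eq_mul_inv, div_mul_eq_mul_div,
      le_div_iff₀ (by positivity)]
    linarith
  gcongr

theorem integrable_sq_mul_lineHeat {r : ℝ} (hr : 0 < r) :
    Integrable (fun y => y ^ 2 * lineHeat r y) := by
  have h := (integrable_rpow_mul_exp_neg_mul_sq (b := 1 / (4 * r)) (by positivity) (s := 2)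
    (by norm_num)).const_mul ((√(4 * Real.pi * r))⁻¹)
  refine h.congr (Eventually.of_forall fun y => ?_)
  simp only [lineHeat, Real.rpow_two]
  rw [mul_left_comm]; congr 3; ring

theorem tendsto_lineHeat_mul_exp_zero {r : ℝ} (hr : 0 < r) (c : ℝ) :
    Tendsto (fun y => (1 + |y|) * lineHeat r (y + c)) atTop (𝓝 0) := by
  have h0 : Tendsto (fun y : ℝ => lineHeat r y) atTop (𝓝 0) := by
    have : Tendsto (fun y : ℝ => y ^ 2 / (4 * r)) atTop atTop :=
      (tendsto_pow_atTop (by norm_num)).atTop_div_const (by positivity)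
    simpa [lineHeat] using (Real.tendsto_exp_neg_atTop_nhds_zero.comp this).const_mul
      ((√(4 * Real.pi * r))⁻¹)
  have h1 : Tendsto (fun y : ℝ => y * lineHeat r y) atTop (𝓝 0) := by
    have hb : Tendsto (fun y : ℝ => (4 * r * (√(4 * Real.pi * r))⁻¹) * y⁻¹) atTop (𝓝 0) := by
      simpa using tendsto_inv_atTop_zero.const_mul (4 * r * (√(4 * Real.pi * r))⁻¹)
    refine squeeze_zero' ?_ ?_ hb
    · filter_upwards [eventually_ge_atTop 0] with y hy using mul_nonneg hy (lineHeat_nonneg _ _)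
    · filter_upwards [eventually_gt_atTop 0] with y hy
      have h2 : Real.exp (-(y ^ 2 / (4 * r))) ≤ 4 * r / y ^ 2 := by
        rw [Real.exp_neg, inv_le_comm₀ (Real.exp_pos _) (by positivity), inv_div]
        linarith [Real.add_one_le_exp (y ^ 2 / (4 * r))]
      calc y * lineHeat r y = (√(4 * Real.pi * r))⁻¹ * y * Real.exp (-(y ^ 2 / (4 * r))) := by
            unfold lineHeat; ring
        _ ≤ (√(4 * Real.pi * r))⁻¹ * y * (4 * r / y ^ 2) := by gcongr
        _ = _ := by field_simp
  have h2 : Tendsto (fun y : ℝ => (1 - c) * lineHeat r y + y * lineHeat r y) atTop (𝓝 0) := by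
    simpa using (h0.const_mul (1 - c)).add h1
  have h3 := h2.comp (tendsto_atTop_add_const_right atTop c tendsto_id)
  refine h3.congr' ?_
  filter_upwards [eventually_ge_atTop 0] with y hy
  simp only [Function.comp, id, abs_of_nonneg hy]; ring

theorem lineHeat_sub_one_ge {r y : ℝ} (hr : 0 < r) (hy : 0 ≤ y) :
    lineHeat r (y + 1) ≤ lineHeat r (y - 1) := by
  unfold lineHeat
  gcongr 1
  rw [Real.exp_le_exp]
  gcongr 2
  nlinarith

theorem halfLineHeat_nonneg {r y : ℝ} (hr : 0 < r) (hy : 0 ≤ y) : 0 ≤ halfLineHeat r y :=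
  sub_nonneg.2 (lineHeat_sub_one_ge hr hy)

theorem halfLineHeat_le (r y : ℝ) : halfLineHeat r y ≤ lineHeat r (y - 1) :=
  sub_le_self _ (lineHeat_nonneg _ _)

theorem integrable_halfLineHeat {r : ℝ} (hr : 0 < r) : Integrable (halfLineHeat r) :=
  ((integrable_lineHeat hr).comp_sub_right 1).sub ((integrable_lineHeat hr).comp_add_right 1)

theorem integral_halfLineHeat_le {r : ℝ} (hr : 0 < r) :
    ∫ y in Set.Ioi 0, halfLineHeat r y ≤ 1 := by
  calc ∫ y in Set.Ioi 0, halfLineHeat r y ≤ ∫ y in Set.Ioi 0, lineHeat r (y - 1) :=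
        integral_mono (integrable_halfLineHeat hr).integrableOn
          ((integrable_lineHeat hr).comp_sub_right 1).integrableOn fun y => halfLineHeat_le r y
    _ ≤ ∫ y, lineHeat r (y - 1) :=
        setIntegral_le_integral ((integrable_lineHeat hr).comp_sub_right 1)
          (Eventually.of_forall fun y => lineHeat_nonneg _ _)
    _ = 1 := by rw [integral_sub_right_eq_self (lineHeat r), integral_lineHeat hr]

/-- The half-line kernel is nonnegative with mass at most 1, so averaging against it preserves sup
bounds. -/
theorem abs_setIntegral_halfLineHeat_mul_le {r m : ℝ} (hr : 0 < r) {f : ℝ → ℝ}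
    (hf : ∀ y, 0 < y → |f y| ≤ m) (hm : 0 ≤ m) :
    |∫ y in Set.Ioi 0, halfLineHeat r y * f y| ≤ m := by
  have h1 : ∀ᵐ y ∂(volume.restrict (Set.Ioi (0 : ℝ))), ‖halfLineHeat r y * f y‖
      ≤ m * halfLineHeat r y := by
    filter_upwards [ae_restrict_mem measurableSet_Ioi] with y hy
    rw [norm_mul, Real.norm_of_nonneg (halfLineHeat_nonneg hr (le_of_lt hy)), mul_comm]
    exact mul_le_mul_of_nonneg_right (hf y hy) (halfLineHeat_nonneg hr (le_of_lt hy))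
  calc _ ≤ ∫ y in Set.Ioi 0, m * halfLineHeat r y :=
        norm_integral_le_of_norm_le ((integrable_halfLineHeat hr).integrableOn.const_mul m) h1
    _ ≤ m * 1 := by
        rw [integral_const_mul]; gcongr; exact integral_halfLineHeat_le hr
    _ = m := mul_one m

/-- Heat kernels are an approximate identity. -/
theorem tendsto_integral_lineHeat_mul {f : ℝ → ℝ → ℝ} {c₀ c M : ℝ}
    (hm : ∀ r, 0 < r → AEStronglyMeasurable (f r)) (hb : ∀ r, 0 < r → ∀ y, |f r y| ≤ M)
    (hc : Tendsto (fun p : ℝ × ℝ => f p.1 p.2) (𝓝[>] 0 ×ˢ 𝓝 c₀) (𝓝 c)) :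
    Tendsto (fun r => ∫ y, lineHeat r (y - c₀) * f r y) (𝓝[>] 0) (𝓝 c) := by
  have hpos : ∀ᶠ r : ℝ in 𝓝[>] 0, 0 < r := self_mem_nhdsWithin
  -- The substitution y = c₀ + √r z replaces the varying kernel by the fixed kernel at time 1.
  have hscale : ∀ r : ℝ, 0 < r → ∫ y, lineHeat r (y - c₀) * f r y
      = ∫ z, lineHeat 1 z * f r (c₀ + √r * z) := by
    intro r hr
    have hq : 0 < √r := Real.sqrt_pos.2 hr
    have h1 := integral_add_right_eq_self (μ := volume) (fun y => lineHeat r (y - c₀) * f r y) c₀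
    rw [← h1]
    have h2 := Measure.integral_comp_mul_left (fun y => lineHeat r (y + c₀ - c₀) * f r (y + c₀)) (√r)
    rw [abs_of_pos (inv_pos.2 hq), smul_eq_mul, eq_comm, inv_mul_eq_iff_eq_mul₀ hq.ne',
      ← integral_const_mul] at h2
    rw [h2]
    refine integral_congr_ae (Eventually.of_forall fun z => ?_)
    simp only [add_sub_cancel_right, add_comm c₀, ← mul_assoc]
    congr 1
    unfold lineHeat
    rw [mul_pow, Real.sq_sqrt hr.le, mul_one, Real.sqrt_mul (by positivity) r]
    rw [show r * z ^ 2 / (4 * r) = z ^ 2 / (4 * 1) by field_simp]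
    field_simp
  have hlim : Tendsto (fun r => ∫ z, lineHeat 1 z * f r (c₀ + √r * z)) (𝓝[>] 0)
      (𝓝 (∫ z, lineHeat 1 z * c)) := by
    refine tendsto_integral_filter_of_dominated_convergence (fun z => lineHeat 1 z * M) ?_ ?_
      ((integrable_lineHeat one_pos).mul_const M) ?_
    · filter_upwards [hpos] with r hr
      have hq : 0 < √r := Real.sqrt_pos.2 hr
      refine (integrable_lineHeat one_pos).aestronglyMeasurable.mul ?_
      have hqm : Measure.QuasiMeasurePreserving (fun z : ℝ => c₀ + √r * z) volume volume := by
        refine (measurePreserving_add_left volume c₀).quasiMeasurePreserving.comp ⟨by fun_prop, ?_⟩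
        rw [Real.map_volume_mul_left hq.ne']
        exact Measure.smul_absolutelyContinuous
      exact (hm r hr).comp_quasiMeasurePreserving hqm
    · filter_upwards [hpos] with r hr
      refine Eventually.of_forall fun z => ?_
      rw [norm_mul, Real.norm_of_nonneg (lineHeat_nonneg _ _)]
      exact mul_le_mul_of_nonneg_left (hb r hr _) (lineHeat_nonneg _ _)
    · refine Eventually.of_forall fun z => ?_
      refine Tendsto.const_mul _ ?_
      refine hc.comp (tendsto_id.prodMk ?_)
      have : Tendsto (fun r : ℝ => c₀ + √r * z) (𝓝 0) (𝓝 (c₀ + √0 * z)) :=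
        Continuous.tendsto (by fun_prop) 0
      simp only [Real.sqrt_zero, zero_mul, add_zero] at this
      exact tendsto_nhdsWithin_of_tendsto_nhds this
  rw [integral_mul_const, integral_lineHeat one_pos, one_mul] at hlim
  refine hlim.congr' ?_
  filter_upwards [hpos] with r hr using (hscale r hr).symm

end Dirichlet

/-! ### Green's representation on the half-line. -/

section Dirichlet

/-- The first space derivative of `halfLineHeat`. -/
noncomputable def halfLineHeat₁ (r y : ℝ) : ℝ :=
  -((y - 1) / (2 * r)) * lineHeat r (y - 1) - -((y + 1) / (2 * r)) * lineHeat r (y + 1)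

/-- The second space derivative of `halfLineHeat`. -/
noncomputable def halfLineHeat₂ (r y : ℝ) : ℝ :=
  ((y - 1) ^ 2 / (4 * r ^ 2) - 1 / (2 * r)) * lineHeat r (y - 1)
    - ((y + 1) ^ 2 / (4 * r ^ 2) - 1 / (2 * r)) * lineHeat r (y + 1)

theorem hasDerivAt_halfLineHeat (r y : ℝ) :
    HasDerivAt (halfLineHeat r) (halfLineHeat₁ r y) y :=
  ((hasDerivAt_lineHeat_right r (y - 1)).comp_sub_const y 1).sub
    ((hasDerivAt_lineHeat_right r (y + 1)).comp_add_const y 1)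

theorem hasDerivAt_halfLineHeat₁ (r y : ℝ) :
    HasDerivAt (halfLineHeat₁ r) (halfLineHeat₂ r y) y :=
  ((hasDerivAt_lineHeat_right_two r (y - 1)).comp_sub_const y 1).sub
    ((hasDerivAt_lineHeat_right_two r (y + 1)).comp_add_const y 1)

theorem hasDerivAt_halfLineHeat_left {r : ℝ} (hr : 0 < r) (y : ℝ) :
    HasDerivAt (fun r => halfLineHeat r y) (halfLineHeat₂ r y) r :=
  (hasDerivAt_lineHeat_left hr (y - 1)).sub (hasDerivAt_lineHeat_left hr (y + 1))

theorem halfLineHeat_zero (r : ℝ) : halfLineHeat r 0 = 0 := by simp [halfLineHeat, lineHeat]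

/-- The normal derivative of the Dirichlet kernel at the boundary is the density of the hitting time
of 0 from 1. This is how the subordinator enters. -/
theorem halfLineHeat₁_zero (r : ℝ) : halfLineHeat₁ r 0 = subordinator r := by
  by_cases hr : r = 0
  · simp [halfLineHeat₁, subordinator, hr]
  · simp only [halfLineHeat₁, subordinator, lineHeat]
    norm_num
    field_simp
    norm_num

/-- A common bound for `halfLineHeat` and its derivatives, for `r` near `r₀`. -/
noncomputable def halfLineBound (r₀ y : ℝ) : ℝ :=
  ((y - 1) ^ 2 * (2 / r₀ ^ 2) + (2 / r₀ + 1)) * (4 * lineHeat (2 * r₀) (y - 1))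
    + ((y + 1) ^ 2 * (2 / r₀ ^ 2) + (2 / r₀ + 1)) * (4 * lineHeat (2 * r₀) (y + 1))

theorem integrable_halfLineBound {r₀ : ℝ} (h : 0 < r₀) : Integrable (halfLineBound r₀) := by
  have h2 : 0 < 2 * r₀ := by linarith
  have key : Integrable fun y =>
      (y ^ 2 * (2 / r₀ ^ 2) + (2 / r₀ + 1)) * (4 * lineHeat (2 * r₀) y) := by
    have := ((integrable_sq_mul_lineHeat h2).mul_const (8 / r₀ ^ 2)).add
      ((integrable_lineHeat h2).mul_const ((2 / r₀ + 1) * 4))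
    refine this.congr (Eventually.of_forall fun y => ?_)
    simp only [Pi.add_apply]; ring
  exact (key.comp_sub_right 1).add (key.comp_add_right 1)

theorem abs_halfLineHeat_le {r r₀ : ℝ} (h : 0 < r₀) (hr : r₀ / 2 ≤ r) (hr' : r ≤ 2 * r₀) (y : ℝ) :
    |halfLineHeat r y| ≤ halfLineBound r₀ y ∧ |halfLineHeat₁ r y| ≤ halfLineBound r₀ y ∧
      |halfLineHeat₂ r y| + |halfLineHeat r y| ≤ halfLineBound r₀ y := by
  have hrp : 0 < r := by linarith
  have i1 : 1 / (2 * r) ≤ 1 / r₀ := one_div_le_one_div_of_le h (by linarith)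
  have i0 : 0 < 1 / (2 * r) := by positivity
  have key : ∀ v : ℝ, |lineHeat r v| ≤ 4 * lineHeat (2 * r₀) v ∧
      |-(v / (2 * r)) * lineHeat r v|
        ≤ (v ^ 2 * (2 / r₀ ^ 2) + (2 / r₀ + 1)) * (4 * lineHeat (2 * r₀) v) ∧
      |(v ^ 2 / (4 * r ^ 2) - 1 / (2 * r)) * lineHeat r v| + |lineHeat r v|
        ≤ (v ^ 2 * (2 / r₀ ^ 2) + (2 / r₀ + 1)) * (4 * lineHeat (2 * r₀) v) := by
    intro v
    have hl := lineHeat_le h hr hr' v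
    have hn := lineHeat_nonneg r v
    have hsq : 1 / r₀ ^ 2 = (1 / r₀) ^ 2 := by field_simp
    have hsq2 : v ^ 2 / (4 * r ^ 2) = v ^ 2 * (1 / (2 * r)) ^ 2 := by field_simp; norm_num
    have e2 : (2 : ℝ) / r₀ ^ 2 = 2 * (1 / r₀) ^ 2 := by field_simp
    have e3 : (2 : ℝ) / r₀ = 2 * (1 / r₀) := by field_simp
    have e4 : v / (2 * r) = v * (1 / (2 * r)) := by field_simp
    rw [hsq2, e2, e3, e4]
    set a := 1 / (2 * r)
    set b := 1 / r₀
    have hb : 0 < b := by positivity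
    have hab : a ^ 2 ≤ b ^ 2 := by gcongr
    have hv := mul_le_mul_of_nonneg_left hab (sq_nonneg v)
    refine ⟨by rwa [abs_of_nonneg hn], ?_, ?_⟩
    · rw [abs_mul, abs_of_nonneg hn]
      refine mul_le_mul ?_ hl hn (by positivity)
      rw [abs_neg, abs_le]
      constructor <;> nlinarith [sq_nonneg (v * a - 1), sq_nonneg (v * a + 1), sq_nonneg (v * b)]
    · rw [abs_mul, abs_of_nonneg hn, ← add_one_mul]
      refine mul_le_mul ?_ hl hn (by positivity)
      have : |v ^ 2 * a ^ 2 - a| ≤ v ^ 2 * b ^ 2 + b := by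
        rw [abs_le]
        constructor <;> nlinarith [sq_nonneg (v * a), sq_nonneg (v * b)]
      nlinarith [sq_nonneg (v * b)]
  obtain ⟨a0, a1, a2⟩ := key (y - 1)
  obtain ⟨b0, b1, b2⟩ := key (y + 1)
  have hA := abs_sub (lineHeat r (y - 1)) (lineHeat r (y + 1))
  unfold halfLineBound
  refine ⟨?_, ?_, ?_⟩
  · unfold halfLineHeat
    have := abs_nonneg (((y - 1) ^ 2 / (4 * r ^ 2) - 1 / (2 * r)) * lineHeat r (y - 1))
    have := abs_nonneg (((y + 1) ^ 2 / (4 * r ^ 2) - 1 / (2 * r)) * lineHeat r (y + 1))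
    linarith
  · exact (abs_sub _ _).trans (add_le_add a1 b1)
  · have := abs_sub (((y - 1) ^ 2 / (4 * r ^ 2) - 1 / (2 * r)) * lineHeat r (y - 1))
      (((y + 1) ^ 2 / (4 * r ^ 2) - 1 / (2 * r)) * lineHeat r (y + 1))
    unfold halfLineHeat halfLineHeat₂
    linarith

theorem tendsto_halfLineHeat_atTop {r : ℝ} (hr : 0 < r) :
    Tendsto (halfLineHeat r) atTop (𝓝 0) ∧ Tendsto (halfLineHeat₁ r) atTop (𝓝 0) := by
  have h1 := tendsto_lineHeat_mul_exp_zero hr (-1)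
  have h2 := tendsto_lineHeat_mul_exp_zero hr 1
  have h3 := h1.add h2
  rw [add_zero] at h3
  have e : ∀ y, lineHeat r (y + -1) = lineHeat r (y - 1) := fun y => by rw [sub_eq_add_neg]
  simp only [e] at h3
  have p1 := lineHeat_nonneg r
  constructor
  · refine squeeze_zero_norm' ?_ h3
    refine Eventually.of_forall fun y => ?_
    have := abs_sub (lineHeat r (y - 1)) (lineHeat r (y + 1))
    rw [abs_of_nonneg (p1 _), abs_of_nonneg (p1 _)] at this
    rw [Real.norm_eq_abs, halfLineHeat]
    nlinarith [abs_nonneg y, p1 (y - 1), p1 (y + 1)]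
  · have h4 := h3.const_mul (1 / r)
    rw [mul_zero] at h4
    refine squeeze_zero_norm' ?_ h4
    filter_upwards with y
    have hb : ∀ v, |v| ≤ 2 * (1 + |y|) → |-(v / (2 * r)) * lineHeat r v|
        ≤ 1 / r * ((1 + |y|) * lineHeat r v) := by
      intro v hv
      rw [abs_mul, abs_neg, abs_of_nonneg (p1 _), ← mul_assoc]
      gcongr
      · exact p1 _
      · rw [abs_div, abs_of_pos (show 0 < 2 * r by positivity), div_le_iff₀ (by positivity)]
        calc |v| ≤ 2 * (1 + |y|) := hv
          _ = _ := by field_simp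
    have b1 := hb (y - 1) ((abs_sub _ _).trans (by rw [abs_one]; linarith [abs_nonneg y]))
    have b2 := hb (y + 1) ((abs_add_le _ _).trans (by rw [abs_one]; linarith [abs_nonneg y]))
    rw [Real.norm_eq_abs, halfLineHeat₁]
    refine (abs_sub _ _).trans ?_
    rw [mul_add]
    exact add_le_add b1 b2

/-- Green's representation on the half-line, for an approximate solution of the backward heat
equation `∂ₛ F + ∂ᵧ² F = 0`. -/
theorem abs_sub_integral_subordinator_le {F F₁ F₂ Fs : ℝ → ℝ → ℝ} {ε m : ℝ → ℝ} {c M : ℝ}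
    (h1 : ∀ s, 0 < s → ∀ y, 0 < y → HasDerivAt (F s) (F₁ s y) y)
    (h2 : ∀ s, 0 < s → ∀ y, 0 < y → HasDerivAt (F₁ s) (F₂ s y) y)
    (hs : ∀ s, 0 < s → ∀ y, 0 < y → HasDerivAt (fun s => F s y) (Fs s y) s)
    (hF₂ : ∀ s, 0 < s → ContinuousOn (F₂ s) (Set.Ioi 0))
    (hFs : ∀ s, 0 < s → ContinuousOn (Fs s) (Set.Ioi 0))
    (he : ∀ s, 0 < s → ∀ y, 0 < y → |Fs s y + F₂ s y| ≤ ε s)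
    (hb : ∀ s₀, 0 < s₀ → ∃ B, ∀ s, s₀ / 2 ≤ s → s ≤ 2 * s₀ → ∀ y, 0 < y →
      |F s y| ≤ B ∧ |F₁ s y| ≤ B ∧ |F₂ s y| ≤ B ∧ |Fs s y| ≤ B)
    (h0 : ∀ s, 0 < s → Tendsto (F s) (𝓝[>] 0) (𝓝 (F s 0)))
    (hm : ∀ s, 0 < s → ∀ y, 0 < y → |F s y| ≤ m s) (hm0 : Tendsto m atTop (𝓝 0))
    (hM : ∀ s, 0 < s → m s ≤ M)
    (hlim : Tendsto (fun p : ℝ × ℝ => F p.1 p.2) (𝓝[>] 0 ×ˢ 𝓝 1) (𝓝 c))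
    (hε : IntegrableOn ε (Set.Ioi 0))
    (hi : IntegrableOn (fun s => subordinator s * F s 0) (Set.Ioi 0)) :
    |c - ∫ s in Set.Ioi 0, subordinator s * F s 0| ≤ ∫ s in Set.Ioi 0, ε s := by
  let I : ℝ → ℝ := fun s => ∫ y in Set.Ioi 0, halfLineHeat s y * F s y
  let E : ℝ → ℝ := fun s => ∫ y in Set.Ioi 0, halfLineHeat s y * (Fs s y + F₂ s y)
  have hFm : ∀ s, 0 < s → ContinuousOn (F s) (Set.Ioi 0) := fun s hs' y hy =>
    (h1 s hs' y hy).continuousAt.continuousWithinAt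
  have hF₁m : ∀ s, 0 < s → ContinuousOn (F₁ s) (Set.Ioi 0) := fun s hs' y hy =>
    (h2 s hs' y hy).continuousAt.continuousWithinAt
  have hGc : ∀ s, Continuous (halfLineHeat s) := fun s =>
    continuous_iff_continuousAt.2 fun y => (hasDerivAt_halfLineHeat s y).continuousAt
  have hG₁c : ∀ s, Continuous (halfLineHeat₁ s) := fun s =>
    continuous_iff_continuousAt.2 fun y => (hasDerivAt_halfLineHeat₁ s y).continuousAt
  have hG₂c : ∀ s, Continuous (halfLineHeat₂ s) := fun s => by
    unfold halfLineHeat₂ lineHeat; fun_prop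
  have hint : ∀ (s₀ : ℝ), 0 < s₀ → ∀ (G f : ℝ → ℝ) (B : ℝ), Continuous G →
      ContinuousOn f (Set.Ioi 0) → (∀ y, |G y| ≤ halfLineBound s₀ y) → (∀ y, 0 < y → |f y| ≤ B) →
      IntegrableOn (fun y => G y * f y) (Set.Ioi 0) := by
    intro s₀ h₀ G f B hG hf hGb hfb
    refine ((integrable_halfLineBound h₀).integrableOn.mul_const B).mono'
      ((hG.continuousOn.mul hf).aestronglyMeasurable measurableSet_Ioi) ?_
    filter_upwards [ae_restrict_mem measurableSet_Ioi] with y hy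
    rw [norm_mul]
    exact mul_le_mul (hGb y) (hfb y hy) (norm_nonneg _) ((abs_nonneg _).trans (hGb y))
  -- Differentiation under the integral produces G'' F + G ∂_s F, and two integrations by parts move
  -- the second derivative onto F. At the boundary G vanishes and G' is the subordinator, whence the
  -- term with `F s 0`.
  have hI : ∀ s, 0 < s → HasDerivAt I (-(subordinator s * F s 0) + E s) s := by
    intro s₀ h₀
    obtain ⟨B, hB⟩ := hb s₀ h₀
    have hB0 := hB s₀ (by linarith) (by linarith)
    have hGb := fun y => abs_halfLineHeat_le h₀ (by linarith : s₀ / 2 ≤ s₀) (by linarith) y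
    have hGb₂ : ∀ y, |halfLineHeat₂ s₀ y| ≤ halfLineBound s₀ y := fun y => by
      linarith [(hGb y).2.2, abs_nonneg (halfLineHeat s₀ y)]
    have iGF := hint s₀ h₀ _ _ B (hGc s₀) (hFm s₀ h₀) (fun y => (hGb y).1) (fun y hy => (hB0 y hy).1)
    have iG₂F := hint s₀ h₀ _ _ B (hG₂c s₀) (hFm s₀ h₀) hGb₂ (fun y hy => (hB0 y hy).1)
    have iG₁F₁ := hint s₀ h₀ _ _ B (hG₁c s₀) (hF₁m s₀ h₀) (fun y => (hGb y).2.1)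
      (fun y hy => (hB0 y hy).2.1)
    have iGF₂ := hint s₀ h₀ _ _ B (hGc s₀) (hF₂ s₀ h₀) (fun y => (hGb y).1)
      (fun y hy => (hB0 y hy).2.2.1)
    have iGFs := hint s₀ h₀ _ _ B (hGc s₀) (hFs s₀ h₀) (fun y => (hGb y).1)
      (fun y hy => (hB0 y hy).2.2.2)
    have hder := (hasDerivAt_integral_of_dominated_loc_of_deriv_le
      (μ := volume.restrict (Set.Ioi (0 : ℝ))) (x₀ := s₀) (s := Metric.ball s₀ (s₀ / 2))
      (F := fun s y => halfLineHeat s y * F s y)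
      (F' := fun s y => halfLineHeat₂ s y * F s y + halfLineHeat s y * Fs s y)
      (bound := fun y => halfLineBound s₀ y * B)
      (Metric.ball_mem_nhds _ (by positivity)) ?_ iGF ?_ ?_
      ((integrable_halfLineBound h₀).integrableOn.mul_const B) ?_).2
    · have e1 : ∫ y in Set.Ioi 0, (halfLineHeat₂ s₀ y * F s₀ y + halfLineHeat s₀ y * Fs s₀ y)
          = -(subordinator s₀ * F s₀ 0) + E s₀ := by
        have p1 := integral_Ioi_mul_deriv_eq_deriv_mul (a := (0 : ℝ)) (u := F s₀) (u' := F₁ s₀)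
          (v := halfLineHeat₁ s₀) (v' := halfLineHeat₂ s₀) (a' := F s₀ 0 * subordinator s₀) (b' := 0)
          (fun y hy => h1 s₀ h₀ y hy) (fun y _ => hasDerivAt_halfLineHeat₁ s₀ y)
          (Integrable.congr iG₂F (Eventually.of_forall fun y => mul_comm _ _)) (Integrable.congr iG₁F₁ (Eventually.of_forall fun y => mul_comm _ _))
          (by
            have := (hG₁c s₀).tendsto 0
            rw [halfLineHeat₁_zero] at this
            exact (h0 s₀ h₀).mul (tendsto_nhdsWithin_of_tendsto_nhds this))
          (by
            have t := (tendsto_halfLineHeat_atTop h₀).2.abs.const_mul B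
            rw [abs_zero, mul_zero] at t
            refine squeeze_zero_norm' ?_ t
            filter_upwards [eventually_gt_atTop 0] with y hy
            rw [Pi.mul_apply, norm_mul]
            exact mul_le_mul_of_nonneg_right (hB0 y hy).1 (abs_nonneg _))
        have p2 := integral_Ioi_mul_deriv_eq_deriv_mul (a := (0 : ℝ)) (u := F₁ s₀) (u' := F₂ s₀)
          (v := halfLineHeat s₀) (v' := halfLineHeat₁ s₀) (a' := 0) (b' := 0)
          (fun y hy => h2 s₀ h₀ y hy) (fun y _ => hasDerivAt_halfLineHeat s₀ y)
          (Integrable.congr iG₁F₁ (Eventually.of_forall fun y => mul_comm _ _)) (Integrable.congr iGF₂ (Eventually.of_forall fun y => mul_comm _ _))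
          (by
            have t := ((hGc s₀).tendsto 0).abs.const_mul B
            rw [halfLineHeat_zero, abs_zero, mul_zero] at t
            refine squeeze_zero_norm' ?_ (tendsto_nhdsWithin_of_tendsto_nhds t)
            filter_upwards [self_mem_nhdsWithin] with y hy
            rw [Pi.mul_apply, norm_mul]
            exact mul_le_mul_of_nonneg_right (hB0 y hy).2.1 (abs_nonneg _))
          (by
            have t := (tendsto_halfLineHeat_atTop h₀).1.abs.const_mul B
            rw [abs_zero, mul_zero] at t
            refine squeeze_zero_norm' ?_ t
            filter_upwards [eventually_gt_atTop 0] with y hy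
            rw [Pi.mul_apply, norm_mul]
            exact mul_le_mul_of_nonneg_right (hB0 y hy).2.1 (abs_nonneg _))
        rw [integral_add iG₂F iGFs]
        simp only [E, mul_add]
        rw [integral_add iGFs iGF₂]
        simp only [mul_comm (F s₀ _), mul_comm (F₁ s₀ _), mul_comm (F₂ s₀ _)] at p1 p2
        rw [p1, p2]; ring
      rw [← e1]
      exact hder
    · filter_upwards [lt_mem_nhds h₀] with s hs'
      exact ((hGc s).continuousOn.mul (hFm s hs')).aestronglyMeasurable measurableSet_Ioi
    · exact (((hG₂c s₀).continuousOn.mul (hFm s₀ h₀)).add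
        ((hGc s₀).continuousOn.mul (hFs s₀ h₀))).aestronglyMeasurable measurableSet_Ioi
    · filter_upwards [ae_restrict_mem measurableSet_Ioi] with y hy s hs'
      rw [Metric.mem_ball, Real.dist_eq, abs_lt] at hs'
      obtain ⟨c1, -, -, c4⟩ := hB s (by linarith [hs'.1]) (by linarith [hs'.2]) y hy
      have c5 := (abs_halfLineHeat_le h₀ (by linarith [hs'.1] : s₀ / 2 ≤ s)
        (by linarith [hs'.2]) y).2.2
      have hBnn : 0 ≤ B := (abs_nonneg _).trans c1
      calc _ ≤ |halfLineHeat₂ s y * F s y| + |halfLineHeat s y * Fs s y| := abs_add_le _ _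
        _ ≤ |halfLineHeat₂ s y| * B + |halfLineHeat s y| * B := by
            rw [abs_mul, abs_mul]; gcongr
        _ ≤ _ := by rw [← add_mul]; gcongr
    · filter_upwards [ae_restrict_mem measurableSet_Ioi] with y hy s hs'
      rw [Metric.mem_ball, Real.dist_eq, abs_lt] at hs'
      have hs0 : 0 < s := by linarith [hs'.1]
      exact (hasDerivAt_halfLineHeat_left hs0 y).mul (hs s hs0 y hy)
  have hE : ∀ s, 0 < s → |E s| ≤ ε s := fun s hs' =>
    abs_setIntegral_halfLineHeat_mul_le hs' (he s hs')
      ((abs_nonneg _).trans (he s hs' 1 one_pos))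
  -- Measurability of `E` is obtained by writing it as the derivative of `I` plus the boundary term.
  have hEi : IntegrableOn E (Set.Ioi 0) := by
    have hmeas : AEStronglyMeasurable (fun s => deriv I s + subordinator s * F s 0)
        (volume.restrict (Set.Ioi 0)) :=
      (measurable_deriv I).aestronglyMeasurable.add hi.aestronglyMeasurable
    refine hε.mono' (hmeas.congr ?_) ?_
    · filter_upwards [ae_restrict_mem measurableSet_Ioi] with s hs'
      rw [(hI s hs').deriv]; ring
    · filter_upwards [ae_restrict_mem measurableSet_Ioi] with s hs' using hE s hs'
  have htop : Tendsto I atTop (𝓝 0) := by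
    refine squeeze_zero_norm' ?_ hm0
    filter_upwards [eventually_gt_atTop 0] with s hs'
    exact abs_setIntegral_halfLineHeat_mul_le hs' (hm s hs') ((abs_nonneg _).trans (hm s hs' 1 one_pos))
  -- As s → 0 the reflected kernel is an approximate identity at 1 minus one at -1; extending `F s`
  -- by zero, the latter contributes nothing.
  have hzero : Tendsto I (𝓝[>] 0) (𝓝 c) := by
    let f : ℝ → ℝ → ℝ := fun s => (Set.Ioi 0).indicator (F s)
    have hfm : ∀ s, 0 < s → AEStronglyMeasurable (f s) := fun s hs' =>
      (aestronglyMeasurable_indicator_iff measurableSet_Ioi).2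
        ((hFm s hs').aestronglyMeasurable measurableSet_Ioi)
    have hfb : ∀ s, 0 < s → ∀ y, |f s y| ≤ M := by
      intro s hs' y
      have hM0 : 0 ≤ M := (abs_nonneg _).trans ((hm s hs' 1 one_pos).trans (hM s hs'))
      by_cases hy : y ∈ Set.Ioi (0 : ℝ)
      · simp only [f, Set.indicator_of_mem hy]; exact (hm s hs' y hy).trans (hM s hs')
      · simp only [f, Set.indicator_of_notMem hy, abs_zero]; exact hM0
    have t1 := tendsto_integral_lineHeat_mul (c₀ := 1) (c := c) hfm hfb (by
      refine hlim.congr' ?_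
      have : ∀ᶠ p : ℝ × ℝ in 𝓝[>] 0 ×ˢ 𝓝 1, 0 < p.2 :=
        (lt_mem_nhds (show (0 : ℝ) < 1 from one_pos)).prod_inr _
      filter_upwards [this] with p hp
      simp [f, hp])
    have t2 := tendsto_integral_lineHeat_mul (c₀ := -1) (c := 0) hfm hfb (by
      refine tendsto_const_nhds.congr' ?_
      have : ∀ᶠ p : ℝ × ℝ in 𝓝[>] 0 ×ˢ 𝓝 (-1), p.2 < 0 :=
        (gt_mem_nhds (show (-1 : ℝ) < 0 by norm_num)).prod_inr _
      filter_upwards [this] with p hp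
      simp [f, hp.le])
    have t3 := t1.sub t2
    rw [sub_zero] at t3
    refine t3.congr' ?_
    filter_upwards [self_mem_nhdsWithin] with s hs'
    have hs0 : (0 : ℝ) < s := hs'
    have bi : ∀ c₀ : ℝ, Integrable fun y => lineHeat s (y - c₀) * f s y := fun c₀ =>
      ((integrable_lineHeat hs0).comp_sub_right c₀).mul_bdd (hfm s hs0)
        (Eventually.of_forall (hfb s hs0))
    change _ = ∫ y in Set.Ioi 0, halfLineHeat s y * F s y
    rw [← integral_sub (bi 1) (bi (-1)), ← integral_indicator measurableSet_Ioi]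
    refine integral_congr_ae (Eventually.of_forall fun y => ?_)
    by_cases hy : y ∈ Set.Ioi (0 : ℝ)
    · simp only [f, Set.indicator_of_mem hy, halfLineHeat, sub_neg_eq_add]; ring
    · simp only [f, Set.indicator_of_notMem hy]; ring
  have hn : IntegrableOn (fun s => -(subordinator s * F s 0)) (Set.Ioi 0) := hi.neg
  -- The updated value at 0 makes `I` continuous from the right there, as the fundamental theorem of
  -- calculus requires.
  have hfin := integral_Ioi_of_hasDerivAt_of_tendsto (f := Function.update I 0 c)
    (f' := fun s => -(subordinator s * F s 0) + E s) (a := 0) (m := 0) ?_ ?_ ?_ ?_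
  · rw [Function.update_self, integral_add hn hEi, integral_neg] at hfin
    have : c - ∫ s in Set.Ioi 0, subordinator s * F s 0 = -∫ s in Set.Ioi 0, E s := by linarith
    rw [this, abs_neg]
    refine (Real.norm_eq_abs _).symm.le.trans (norm_integral_le_of_norm_le hε ?_)
    filter_upwards [ae_restrict_mem measurableSet_Ioi] with s hs' using hE s hs'
  · rw [ContinuousWithinAt, Function.update_self]
    have : Set.Ici (0 : ℝ) = insert 0 (Set.Ioi 0) := by
      ext x; simp [le_iff_eq_or_lt, eq_comm]
    rw [this, nhdsWithin_insert, tendsto_sup]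
    refine ⟨by simpa using tendsto_pure_nhds (Function.update I 0 c) 0, hzero.congr' ?_⟩
    filter_upwards [self_mem_nhdsWithin] with s hs'
    rw [Function.update_of_ne (ne_of_gt hs')]
  · intro s hs'
    refine (hI s hs').congr_of_eventuallyEq ?_
    filter_upwards [lt_mem_nhds hs'] with t ht
    rw [Function.update_of_ne (ne_of_gt ht)]
  · exact hn.add hEi
  · refine htop.congr' ?_
    filter_upwards [eventually_gt_atTop 0] with s hs'
    rw [Function.update_of_ne (ne_of_gt hs')]

end Dirichlet

/-! ### A smooth cutoff. -/

section Cutoff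

/-- A smooth function equal to `1` on `(-∞, 1]` and to `0` on `[2, ∞)`. -/
noncomputable def cutoff (y : ℝ) : ℝ := Real.smoothTransition (2 - y)

theorem contDiff_cutoff : ContDiff ℝ ∞ cutoff :=
  Real.smoothTransition.contDiff.comp (contDiff_const.sub contDiff_id)

theorem cutoff_of_le {y : ℝ} (h : y ≤ 1) : cutoff y = 1 :=
  Real.smoothTransition.one_of_one_le (by linarith)

theorem cutoff_of_ge {y : ℝ} (h : 2 ≤ y) : cutoff y = 0 :=
  Real.smoothTransition.zero_of_nonpos (by linarith)

theorem cutoff_nonneg (y : ℝ) : 0 ≤ cutoff y := Real.smoothTransition.nonneg _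

theorem cutoff_le_one (y : ℝ) : cutoff y ≤ 1 := Real.smoothTransition.le_one _

theorem contDiff_deriv_cutoff : ContDiff ℝ ∞ (deriv cutoff) :=
  (contDiff_infty_iff_deriv.1 contDiff_cutoff).2

theorem hasDerivAt_cutoff (y : ℝ) : HasDerivAt cutoff (deriv cutoff y) y :=
  (contDiff_cutoff.differentiable (by simp) y).hasDerivAt

theorem hasDerivAt_deriv_cutoff (y : ℝ) : HasDerivAt (deriv cutoff) (deriv (deriv cutoff) y) y :=
  (contDiff_deriv_cutoff.differentiable (by simp) y).hasDerivAt

theorem deriv_cutoff_of_gt {y : ℝ} (h : 2 < y) : deriv cutoff y = 0 := by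
  have : cutoff =ᶠ[𝓝 y] fun _ => 0 := by
    filter_upwards [lt_mem_nhds h] with z hz using cutoff_of_ge hz.le
  rw [this.deriv_eq]; simp

theorem deriv_cutoff_of_lt {y : ℝ} (h : y < 1) : deriv cutoff y = 0 := by
  have : cutoff =ᶠ[𝓝 y] fun _ => 1 := by
    filter_upwards [gt_mem_nhds h] with z hz using cutoff_of_le hz.le
  rw [this.deriv_eq]; simp

theorem deriv_deriv_cutoff_of_gt {y : ℝ} (h : 2 < y) : deriv (deriv cutoff) y = 0 := by
  have : deriv cutoff =ᶠ[𝓝 y] fun _ => 0 := by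
    filter_upwards [lt_mem_nhds h] with z hz using deriv_cutoff_of_gt hz
  rw [this.deriv_eq]; simp

theorem exists_bound_deriv_cutoff :
    ∃ M, 0 ≤ M ∧ ∀ y, |deriv cutoff y| ≤ M ∧ |deriv (deriv cutoff) y| ≤ M := by
  have hs : HasCompactSupport (deriv cutoff) := by
    refine HasCompactSupport.intro (isCompact_Icc (a := (1 : ℝ)) (b := 2)) fun y hy => ?_
    rw [Set.mem_Icc, not_and_or, not_le, not_le] at hy
    exact hy.elim deriv_cutoff_of_lt deriv_cutoff_of_gt
  obtain ⟨M₁, h1⟩ := hs.exists_bound_of_continuous contDiff_deriv_cutoff.continuous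
  obtain ⟨M₂, h2⟩ := hs.deriv.exists_bound_of_continuous
    (contDiff_infty_iff_deriv.1 contDiff_deriv_cutoff).2.continuous
  exact ⟨max M₁ M₂, (norm_nonneg _).trans ((h1 0).trans (le_max_left _ _)), fun y =>
    ⟨(h1 y).trans (le_max_left _ _), (h2 y).trans (le_max_right _ _)⟩⟩

end Cutoff

/-! ### A Gaussian evolved under the harmonic oscillator. -/

section Mehler

/-- `sinh (2 l s) / (2 l)` -/
noncomputable def mS (l s : ℝ) : ℝ := Real.sinh (2 * l * s) / (2 * l)

/-- `cosh (2 l s)` -/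
noncomputable def mC (l s : ℝ) : ℝ := Real.cosh (2 * l * s)

/-- The variance factor of a unit Gaussian evolved under the harmonic oscillator. -/
noncomputable def mD (l s : ℝ) : ℝ := mC l s + 2 * mS l s

/-- The derivative of `mD l`. -/
noncomputable def mD' (l s : ℝ) : ℝ := 4 * l ^ 2 * mS l s + 2 * mC l s

/-- `mS` is even in `l`, so positive frequencies suffice. At `l = 0` division by zero makes `mS`
vanish, and the bound fails for `s > 0`; frequency 0 is a null set in every integral over `l` below.
-/
theorem self_le_sinh_div {l s : ℝ} (hl : l ≠ 0) (hs : 0 ≤ s) : s ≤ mS l s := by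
  have key : ∀ l : ℝ, 0 < l → s ≤ mS l s := by
    intro l hl
    rw [mS, le_div_iff₀ (by positivity)]
    have := Real.self_le_sinh_iff.2 (show 0 ≤ 2 * l * s by positivity)
    linarith
  rcases lt_or_gt_of_ne hl with h | h
  · have := key (-l) (by linarith)
    have e : mS (-l) s = mS l s := by
      unfold mS
      rw [show 2 * -l * s = -(2 * l * s) by ring, Real.sinh_neg, show 2 * -l = -(2 * l) by ring,
        neg_div_neg_eq]
    rwa [e] at this
  · exact key l h

theorem one_le_mC (l s : ℝ) : 1 ≤ mC l s := Real.one_le_cosh _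

theorem mC_sq (l s : ℝ) (hl : l ≠ 0) : mC l s ^ 2 - 4 * l ^ 2 * mS l s ^ 2 = 1 := by
  have := Real.cosh_sq (2 * l * s)
  unfold mC mS
  field_simp
  linarith

theorem one_add_le_mD {l s : ℝ} (hl : l ≠ 0) (hs : 0 ≤ s) : 1 + 2 * s ≤ mD l s := by
  unfold mD
  linarith [one_le_mC l s, self_le_sinh_div hl hs]

theorem mD_pos {l s : ℝ} (hl : l ≠ 0) (hs : 0 ≤ s) : 0 < mD l s := by
  linarith [one_add_le_mD hl hs]

theorem hasDerivAt_mS {l : ℝ} (hl : l ≠ 0) (s : ℝ) : HasDerivAt (mS l) (mC l s) s := by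
  have h1 : HasDerivAt (fun s : ℝ => 2 * l * s) (2 * l) s := by
    simpa using (hasDerivAt_id s).const_mul (2 * l)
  refine (h1.sinh.div_const (2 * l)).congr_deriv ?_
  unfold mC; field_simp

theorem hasDerivAt_mC {l : ℝ} (hl : l ≠ 0) (s : ℝ) :
    HasDerivAt (mC l) (4 * l ^ 2 * mS l s) s := by
  have h1 : HasDerivAt (fun s : ℝ => 2 * l * s) (2 * l) s := by
    simpa using (hasDerivAt_id s).const_mul (2 * l)
  refine h1.cosh.congr_deriv ?_
  unfold mS; field_simp; norm_num; ring

theorem hasDerivAt_mD {l : ℝ} (hl : l ≠ 0) (s : ℝ) : HasDerivAt (mD l) (mD' l s) s := by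
  refine ((hasDerivAt_mC hl s).add ((hasDerivAt_mS hl s).const_mul 2)).congr_deriv ?_
  unfold mD'; ring

theorem hasDerivAt_mD' {l : ℝ} (hl : l ≠ 0) (s : ℝ) :
    HasDerivAt (mD' l) (4 * l ^ 2 * mD l s) s := by
  refine (((hasDerivAt_mS hl s).const_mul (4 * l ^ 2)).add
    ((hasDerivAt_mC hl s).const_mul 2)).congr_deriv ?_
  unfold mD; ring

theorem mD'_div_le {l s : ℝ} (hl : l ≠ 0) (hs : 0 ≤ s) :
    0 ≤ mD' l s / mD l s ∧ mD' l s / mD l s ≤ 2 * (1 + l ^ 2) := by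
  have h1 := one_le_mC l s
  have h2 := hs.trans (self_le_sinh_div hl hs)
  have h3 := mD_pos hl hs
  constructor
  · refine div_nonneg ?_ h3.le
    unfold mD'; nlinarith [mul_nonneg (sq_nonneg l) h2]
  · rw [div_le_iff₀ h3]
    unfold mD' mD
    nlinarith [mul_nonneg (sq_nonneg l) h2, mul_nonneg (sq_nonneg l) (zero_le_one.trans h1)]

/-- The exponential quadratic form of the evolved Gaussian, as a function of `|x|²`, `x · x₀` and
`|x₀|²`. -/
noncomputable def mExp (l s P Q X : ℝ) : ℝ :=
  Real.exp (-((mD' l s * P - 4 * Q + 2 * mC l s * X) / (4 * mD l s)))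

/-- The logarithmic `s`-derivative of the evolved Gaussian. -/
noncomputable def mLog (n : ℕ) (l s P Q X : ℝ) : ℝ :=
  (mD' l s ^ 2 * P - 4 * mD' l s * Q + 4 * X) / (4 * mD l s ^ 2) - n * mD' l s / (2 * mD l s)
    - l ^ 2 * P

/-- `mLog` is written in the form that (Δ_x - l²|x|²)w / w takes for the evolved Gaussian w, so this
is the heat equation of the oscillator. The only relation beyond algebra is cosh² - sinh² = 1. -/
theorem hasDerivAt_mehler (n : ℕ) {l s : ℝ} (hl : l ≠ 0) (hs : 0 ≤ s) (P Q X : ℝ) :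
    HasDerivAt (fun s => mD l s ^ (-(n : ℝ) / 2) * mExp l s P Q X)
      (mD l s ^ (-(n : ℝ) / 2) * mExp l s P Q X * mLog n l s P Q X) s := by
  have hD := mD_pos hl hs
  have h1 := (hasDerivAt_mD hl s).rpow_const (p := -(n : ℝ) / 2) (Or.inl hD.ne')
  have h2 : HasDerivAt (fun s => -((mD' l s * P - 4 * Q + 2 * mC l s * X) / (4 * mD l s)))
      (-(((4 * l ^ 2 * mD l s * P + 2 * (4 * l ^ 2 * mS l s) * X) * (4 * mD l s)
        - (mD' l s * P - 4 * Q + 2 * mC l s * X) * (4 * mD' l s)) / (4 * mD l s) ^ 2)) s :=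
      (((((hasDerivAt_mD' hl s).mul_const P).sub_const (4 * Q)).add
        (((hasDerivAt_mC hl s).const_mul 2).mul_const X)).div ((hasDerivAt_mD hl s).const_mul 4)
        (by positivity)).neg
  refine (h1.mul h2.exp).congr_deriv ?_
  have e1 : mD l s ^ (-(n : ℝ) / 2 - 1) = mD l s ^ (-(n : ℝ) / 2) / mD l s := by
    rw [Real.rpow_sub_one hD.ne']
  rw [e1]
  have h3 := mC_sq l s hl
  have e2 : mD' l s = 4 * l ^ 2 * mS l s + 2 * mC l s := rfl
  have e3 : mS l s = (mD l s - mC l s) / 2 := by unfold mD; ring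
  unfold mLog
  change _ = mD l s ^ (-(n : ℝ) / 2) * Real.exp _ * _
  generalize mD l s ^ (-(n : ℝ) / 2) = A
  generalize Real.exp _ = e
  rw [e3] at e2 h3 ⊢
  generalize mD' l s = D' at *
  generalize mD l s = D at *
  generalize mC l s = C at *
  subst e2
  field_simp
  linear_combination (16 * A * e * X) * h3

end Mehler

theorem iteratedDeriv_two_of_hasDerivAt {f f₁ : ℝ → ℝ} {c t₀ : ℝ}
    (h : ∀ t, HasDerivAt f (f₁ t) t) (h' : HasDerivAt f₁ c t₀) : iteratedDeriv 2 f t₀ = c := by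
  rw [show (2 : ℕ) = 1 + 1 from rfl, iteratedDeriv_succ, iteratedDeriv_one,
    funext fun t => (h t).deriv]
  exact h'.deriv

/-- Along a coordinate line |x|² becomes P + 2pt + t² and x·x₀ becomes Q + qt, which makes the
truncated Gaussian a function of one real variable. -/
theorem iteratedDeriv_two_cutoff_mul_mExp (l s : ℝ) (hD : mD l s ≠ 0) (P p Q q X J A : ℝ) :
    iteratedDeriv 2 (fun t : ℝ => A * (cutoff ((P + 2 * p * t + t ^ 2) / J)
        * mExp l s (P + 2 * p * t + t ^ 2) (Q + q * t) X)) 0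
      = A * mExp l s P Q X * (deriv (deriv cutoff) (P / J) * (2 * p / J) ^ 2
        + deriv cutoff (P / J) * (2 / J)
        - 2 * deriv cutoff (P / J) * (2 * p / J) * ((mD' l s * p - 2 * q) / (2 * mD l s))
        + cutoff (P / J) * (((mD' l s * p - 2 * q) / (2 * mD l s)) ^ 2
          - mD' l s / (2 * mD l s))) := by
  have hp : ∀ t : ℝ, HasDerivAt (fun t : ℝ => P + 2 * p * t + t ^ 2) (2 * p + 2 * t) t := by
    intro t
    have := (((hasDerivAt_id t).const_mul (2 * p)).const_add P).add (hasDerivAt_pow 2 t)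
    refine this.congr_deriv ?_
    norm_num
  have hq : ∀ t : ℝ, HasDerivAt (fun t : ℝ => Q + q * t) q t := by
    intro t
    simpa using ((hasDerivAt_id t).const_mul q).const_add Q
  let ℓ : ℝ → ℝ := fun t => -((mD' l s * (2 * p + 2 * t) - 4 * q) / (4 * mD l s))
  have hℓ : ∀ t, HasDerivAt ℓ (-(mD' l s * 2 / (4 * mD l s))) t := by
    intro t
    have := (((((hasDerivAt_id t).const_mul 2).const_add (2 * p)).const_mul (mD' l s)).sub_const
      (4 * q)).div_const (4 * mD l s)
    exact this.neg.congr_deriv (by simp)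
  have hE : ∀ t, HasDerivAt (fun t : ℝ => mExp l s (P + 2 * p * t + t ^ 2) (Q + q * t) X)
      (mExp l s (P + 2 * p * t + t ^ 2) (Q + q * t) X * ℓ t) t := by
    intro t
    exact (((((hp t).const_mul (mD' l s)).sub ((hq t).const_mul 4)).add_const
      (2 * mC l s * X)).div_const (4 * mD l s)).neg.exp
  have hc : ∀ t, HasDerivAt (fun t : ℝ => cutoff ((P + 2 * p * t + t ^ 2) / J))
      (deriv cutoff ((P + 2 * p * t + t ^ 2) / J) * ((2 * p + 2 * t) / J)) t := fun t =>
    (hasDerivAt_cutoff _).comp t ((hp t).div_const J)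
  have hc' : ∀ t, HasDerivAt (fun t : ℝ => deriv cutoff ((P + 2 * p * t + t ^ 2) / J))
      (deriv (deriv cutoff) ((P + 2 * p * t + t ^ 2) / J) * ((2 * p + 2 * t) / J)) t := fun t =>
    (hasDerivAt_deriv_cutoff _).comp t ((hp t).div_const J)
  have hlin : HasDerivAt (fun t : ℝ => (2 * p + 2 * t) / J) (2 / J) 0 := by
    simpa using (((hasDerivAt_id (0 : ℝ)).const_mul 2).const_add (2 * p)).div_const J
  refine (iteratedDeriv_two_of_hasDerivAt (fun t => ((hc t).mul (hE t)).const_mul A)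
    (((((hc' 0).mul hlin).mul (hE 0)).add ((hc 0).mul ((hE 0).mul (hℓ 0)))).const_mul A)).trans ?_
  simp only [ℓ, mul_zero, add_zero, Pi.mul_apply, ne_eq, OfNat.ofNat_ne_zero, not_false_eq_true,
    zero_pow]
  have e1 : -((mD' l s * (2 * p) - 4 * q) / (4 * mD l s)) = -((mD' l s * p - 2 * q) / (2 * mD l s)) := by
    field_simp; ring
  have e2 : -(mD' l s * 2 / (4 * mD l s)) = -(mD' l s / (2 * mD l s)) := by
    field_simp; norm_num
  rw [e1, e2]
  ring

/-- The vertical profile of the truncated waves. -/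
noncomputable def vWave (l u₀ J u : ℝ) : ℝ := cutoff (u ^ 2 / J) * Real.cos (l * (u - u₀))

/-- `vWave'' + l² vWave` -/
noncomputable def vErr (l u₀ J u : ℝ) : ℝ :=
  (deriv (deriv cutoff) (u ^ 2 / J) * (2 * u / J) ^ 2 + deriv cutoff (u ^ 2 / J) * (2 / J))
      * Real.cos (l * (u - u₀))
    - 2 * (deriv cutoff (u ^ 2 / J) * (2 * u / J)) * (l * Real.sin (l * (u - u₀)))

theorem iteratedDeriv_two_vWave (l u₀ J u A : ℝ) :
    iteratedDeriv 2 (fun u => A * vWave l u₀ J u) u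
      = A * (vErr l u₀ J u - l ^ 2 * vWave l u₀ J u) := by
  have hp : ∀ u : ℝ, HasDerivAt (fun u : ℝ => u ^ 2 / J) (2 * u / J) u := by
    intro u
    simpa using (hasDerivAt_pow 2 u).div_const J
  have hlin : ∀ u : ℝ, HasDerivAt (fun u : ℝ => 2 * u / J) (2 / J) u := by
    intro u
    simpa using ((hasDerivAt_id u).const_mul 2).div_const J
  have hq : ∀ u : ℝ, HasDerivAt (fun u : ℝ => l * (u - u₀)) l u := by
    intro u
    simpa using ((hasDerivAt_id u).sub_const u₀).const_mul l
  have hc : ∀ u, HasDerivAt (fun u : ℝ => cutoff (u ^ 2 / J))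
      (deriv cutoff (u ^ 2 / J) * (2 * u / J)) u := fun u =>
    (hasDerivAt_cutoff _).comp u (hp u)
  have hc' : ∀ u, HasDerivAt (fun u : ℝ => deriv cutoff (u ^ 2 / J))
      (deriv (deriv cutoff) (u ^ 2 / J) * (2 * u / J)) u := fun u =>
    (hasDerivAt_deriv_cutoff _).comp u (hp u)
  refine (iteratedDeriv_two_of_hasDerivAt (fun t => ((hc t).mul (hq t).cos).const_mul A)
    (((((hc' u).mul (hlin u)).mul (hq u).cos).add
      ((hc u).mul ((hq u).sin.neg.mul_const l))).const_mul A)).trans ?_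
  simp only [Pi.mul_apply, Pi.neg_apply, vErr, vWave]
  ring

/-! ### Truncated waves and their defect in the heat equation. -/

namespace Grushin

variable {n : ℕ}

/-- The horizontal profile of the truncated waves. -/
noncomputable def hWave (l s : ℝ) (x₀ : EuclideanSpace ℝ (Fin n)) (x : EuclideanSpace ℝ (Fin n)) :
    ℝ :=
  mD l s ^ (-(n : ℝ) / 2) * mExp l s (‖x‖ ^ 2) (inner ℝ x x₀) (‖x₀‖ ^ 2)

/-- Truncated solutions of the heat equation, oscillating in the vertical direction. -/
noncomputable def wave (l s J : ℝ) (g₀ g : GrushinSpace n) : ℝ :=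
  cutoff (‖g.1‖ ^ 2 / J) * hWave l s g₀.1 g.1 * vWave l g₀.2 J g.2

/-- The time derivative of `wave`. -/
noncomputable def waveDot (l s J : ℝ) (g₀ g : GrushinSpace n) : ℝ :=
  wave l s J g₀ g * mLog n l s (‖g.1‖ ^ 2) (inner ℝ g.1 g₀.1) (‖g₀.1‖ ^ 2)

/-- The defect of `wave` in the heat equation. -/
noncomputable def waveErr (l s J : ℝ) (g₀ g : GrushinSpace n) : ℝ :=
  -(hWave l s g₀.1 g.1 * (vWave l g₀.2 J g.2 *
    (deriv (deriv cutoff) (‖g.1‖ ^ 2 / J) * (4 * ‖g.1‖ ^ 2 / J ^ 2)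
      + deriv cutoff (‖g.1‖ ^ 2 / J) * (2 * n / J)
      - deriv cutoff (‖g.1‖ ^ 2 / J) * (2 / J)
        * (mD' l s / mD l s * ‖g.1‖ ^ 2 - 2 * inner ℝ g.1 g₀.1 / mD l s))
    + ‖g.1‖ ^ 2 * cutoff (‖g.1‖ ^ 2 / J) * vErr l g₀.2 J g.2))

/-- Each summand is a quadratic polynomial in the i-th coordinates, so only |x|², x·x₀, |x₀|² and
the dimension survive summation. -/
theorem sum_wave_identity (x x₀ : EuclideanSpace ℝ (Fin n)) (a b c d D J : ℝ) :
    ∑ i, (a * (2 * x i / J) ^ 2 + b * (2 / J)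
        - 2 * b * (2 * x i / J) * ((d * x i - 2 * x₀ i) / (2 * D))
        + c * (((d * x i - 2 * x₀ i) / (2 * D)) ^ 2 - d / (2 * D)))
      = a * (4 * ‖x‖ ^ 2 / J ^ 2) + b * (2 * n / J)
        - b * (2 / J) * (d / D * ‖x‖ ^ 2 - 2 * inner ℝ x x₀ / D)
        + c * ((d ^ 2 * ‖x‖ ^ 2 - 4 * d * inner ℝ x x₀ + 4 * ‖x₀‖ ^ 2) / (4 * D ^ 2)
          - n * d / (2 * D)) := by
  have hPs : ∑ i, x i ^ 2 = ‖x‖ ^ 2 := by rw [EuclideanSpace.norm_sq_eq]; simp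
  have hXs : ∑ i, x₀ i ^ 2 = ‖x₀‖ ^ 2 := by rw [EuclideanSpace.norm_sq_eq]; simp
  have hQs : ∑ i, x i * x₀ i = inner ℝ x x₀ := by rw [PiLp.inner_apply]; simp [mul_comm]
  have e : ∀ i, (a * (2 * x i / J) ^ 2 + b * (2 / J)
        - 2 * b * (2 * x i / J) * ((d * x i - 2 * x₀ i) / (2 * D))
        + c * (((d * x i - 2 * x₀ i) / (2 * D)) ^ 2 - d / (2 * D)))
      = (a * (4 / J ^ 2) - b * (2 / J) * (d / D) + c * (d ^ 2 / (4 * D ^ 2))) * x i ^ 2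
        + (b * (2 / J) * (2 / D) - c * (4 * d / (4 * D ^ 2))) * (x i * x₀ i)
        + c * (4 / (4 * D ^ 2)) * x₀ i ^ 2
        + (b * (2 / J) - c * (d / (2 * D))) := by
    intro i
    ring
  simp_rw [e]
  rw [Finset.sum_add_distrib, Finset.sum_add_distrib, Finset.sum_add_distrib, ← Finset.mul_sum,
    ← Finset.mul_sum, ← Finset.mul_sum, hPs, hQs, hXs]
  simp only [Finset.sum_const, Finset.card_univ, Fintype.card_fin, nsmul_eq_mul]
  ring

theorem iteratedDeriv_two_wave_line (l s J : ℝ) (hD : mD l s ≠ 0) (g₀ g : GrushinSpace n)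
    (i : Fin n) :
    iteratedDeriv 2 (fun t : ℝ => wave l s J g₀ (g.1 + EuclideanSpace.single i t, g.2)) 0
      = (mD l s ^ (-(n : ℝ) / 2) * vWave l g₀.2 J g.2)
        * mExp l s (‖g.1‖ ^ 2) (inner ℝ g.1 g₀.1) (‖g₀.1‖ ^ 2) *
        (deriv (deriv cutoff) (‖g.1‖ ^ 2 / J) * (2 * g.1 i / J) ^ 2
        + deriv cutoff (‖g.1‖ ^ 2 / J) * (2 / J)
        - 2 * deriv cutoff (‖g.1‖ ^ 2 / J) * (2 * g.1 i / J)
          * ((mD' l s * g.1 i - 2 * g₀.1 i) / (2 * mD l s))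
        + cutoff (‖g.1‖ ^ 2 / J) * (((mD' l s * g.1 i - 2 * g₀.1 i) / (2 * mD l s)) ^ 2
          - mD' l s / (2 * mD l s))) := by
  rw [← iteratedDeriv_two_cutoff_mul_mExp l s hD]
  congr 1
  ext t
  have e1 : ‖g.1 + EuclideanSpace.single i t‖ ^ 2 = ‖g.1‖ ^ 2 + 2 * g.1 i * t + t ^ 2 := by
    rw [norm_add_sq_real, EuclideanSpace.inner_single_right]
    simp only [conj_trivial, PiLp.norm_single, Real.norm_eq_abs, sq_abs]
    ring
  have e2 : inner ℝ (g.1 + EuclideanSpace.single i t) g₀.1 = inner ℝ g.1 g₀.1 + g₀.1 i * t := by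
    rw [inner_add_left, EuclideanSpace.inner_single_left]
    simp [mul_comm]
  simp only [wave, hWave, e1, e2]
  ring

theorem iteratedDeriv_two_wave_vert (l s J : ℝ) (g₀ g : GrushinSpace n) :
    iteratedDeriv 2 (fun u => wave l s J g₀ (g.1, u)) g.2
      = cutoff (‖g.1‖ ^ 2 / J) * hWave l s g₀.1 g.1
        * (vErr l g₀.2 J g.2 - l ^ 2 * vWave l g₀.2 J g.2) :=
  iteratedDeriv_two_vWave l g₀.2 J g.2 (cutoff (‖g.1‖ ^ 2 / J) * hWave l s g₀.1 g.1)

/-- The cosine turns |x|² ∂_u² into the potential -l²|x|², so the untruncated wave solves the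
equation exactly; only terms containing a derivative of a cutoff remain. -/
theorem waveDot_sub_laplacian (l s J : ℝ) (hD : mD l s ≠ 0) (g₀ g : GrushinSpace n) :
    waveDot l s J g₀ g - laplacian (wave l s J g₀) g = waveErr l s J g₀ g := by
  rw [laplacian, iteratedDeriv_two_wave_vert,
    Finset.sum_congr rfl fun i _ => iteratedDeriv_two_wave_line l s J hD g₀ g i,
    ← Finset.mul_sum, sum_wave_identity]
  simp only [waveDot, waveErr, wave, hWave, mLog]
  generalize ‖g.1‖ ^ 2 = P
  generalize ‖g₀.1‖ ^ 2 = X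
  generalize inner ℝ g.1 g₀.1 = Q
  generalize mExp l s P Q X = e
  generalize mD l s ^ (-(n : ℝ) / 2) = A
  ring

end Grushin

/-! ### Pointwise bounds for the waves and their defect. -/

namespace Grushin

variable {n : ℕ}

theorem hWave_nonneg {l s : ℝ} (hl : l ≠ 0) (hs : 0 ≤ s) (x₀ x : EuclideanSpace ℝ (Fin n)) :
    0 ≤ hWave l s x₀ x :=
  mul_nonneg (Real.rpow_nonneg (mD_pos hl hs).le _) (Real.exp_pos _).le

/-- As `mD'` ≥ 2 `mC` ≥ 2, the quadratic form in the exponent dominates 2|x - x₀|². -/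
theorem hWave_le {l s : ℝ} (hl : l ≠ 0) (hs : 0 ≤ s) (x₀ x : EuclideanSpace ℝ (Fin n)) :
    hWave l s x₀ x ≤ mD l s ^ (-(n : ℝ) / 2) * Real.exp (-(‖x - x₀‖ ^ 2 / (2 * mD l s))) := by
  have hD := mD_pos hl hs
  have hS := hs.trans (self_le_sinh_div hl hs)
  have hC := one_le_mC l s
  unfold hWave mExp
  gcongr 3
  rw [div_le_div_iff₀ (by positivity) (by positivity), norm_sub_sq_real]
  have h1 : 2 * mC l s ≤ mD' l s := by
    unfold mD'; nlinarith [mul_nonneg (sq_nonneg l) hS]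
  have h2 : 2 * (‖x‖ ^ 2 - 2 * inner ℝ x x₀ + ‖x₀‖ ^ 2)
      ≤ mD' l s * ‖x‖ ^ 2 - 4 * inner ℝ x x₀ + 2 * mC l s * ‖x₀‖ ^ 2 := by
    nlinarith [sq_nonneg ‖x‖, sq_nonneg ‖x₀‖]
  nlinarith

theorem hWave_le_one {l s : ℝ} (hl : l ≠ 0) (hs : 0 ≤ s) (x₀ x : EuclideanSpace ℝ (Fin n)) :
    hWave l s x₀ x ≤ 1 := by
  refine (hWave_le hl hs x₀ x).trans ?_
  have hD := one_add_le_mD hl hs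
  refine mul_le_one₀ ?_ (Real.exp_pos _).le ?_
  · refine Real.rpow_le_one_of_one_le_of_nonpos (by linarith) ?_
    have : (0 : ℝ) ≤ n := Nat.cast_nonneg n
    linarith
  · rw [Real.exp_le_one_iff, neg_nonpos]
    have := mD_pos hl hs
    positivity

theorem continuous_hWave (l s : ℝ) (x₀ : EuclideanSpace ℝ (Fin n)) : Continuous (hWave l s x₀) := by
  unfold hWave mExp; fun_prop

theorem contDiff_hWave (l s : ℝ) (x₀ : EuclideanSpace ℝ (Fin n)) :
    ContDiff ℝ ∞ (hWave l s x₀) := by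
  unfold hWave mExp
  have h1 : ContDiff ℝ ∞ fun x : EuclideanSpace ℝ (Fin n) => ‖x‖ ^ 2 := contDiff_id.norm_sq ℝ
  have h2 : ContDiff ℝ ∞ fun x : EuclideanSpace ℝ (Fin n) => (inner ℝ x x₀ : ℝ) :=
    contDiff_id.inner ℝ contDiff_const
  exact contDiff_const.mul ((((contDiff_const.mul h1).sub (contDiff_const.mul h2)).add
    contDiff_const).div_const _).neg.exp

theorem contDiff_vWave (l u₀ J : ℝ) : ContDiff ℝ ∞ (vWave l u₀ J) :=
  (contDiff_cutoff.comp ((contDiff_id.pow 2).div_const J)).mul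
    (Real.contDiff_cos.comp (contDiff_const.mul (contDiff_id.sub contDiff_const)))

theorem sq_le_of_vWave_ne_zero {l u₀ j u : ℝ} (hj : 0 < j) (h : vWave l u₀ (j ^ 2) u ≠ 0) :
    |u| ≤ 2 * j := by
  by_contra! hu
  refine h ?_
  rw [vWave, cutoff_of_ge, zero_mul]
  rw [le_div_iff₀ (by positivity), ← sq_abs u]
  nlinarith

theorem isTestFunction_wave (l s : ℝ) {j : ℝ} (hj : 0 < j) (g₀ : GrushinSpace n) :
    IsTestFunction (wave l s (j ^ 2) g₀) := by
  constructor
  · unfold wave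
    exact ((contDiff_cutoff.comp (contDiff_normSq_fst.div_const _)).mul
      ((contDiff_hWave l s g₀.1).comp contDiff_fst)).mul ((contDiff_vWave l g₀.2 _).comp contDiff_snd)
  · refine HasCompactSupport.intro ((isCompact_closedBall (0 : EuclideanSpace ℝ (Fin n)) (2 * j)).prod
      (isCompact_Icc (a := -(2 * j)) (b := 2 * j))) fun g hg => ?_
    rw [Set.mem_prod, not_and_or] at hg
    unfold wave
    rcases hg with h | h
    · rw [cutoff_of_ge]
      · simp
      rw [mem_closedBall_zero_iff, not_le] at h
      rw [le_div_iff₀ (by positivity)]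
      nlinarith
    · by_contra! h'
      refine h ?_
      have := sq_le_of_vWave_ne_zero hj (right_ne_zero_of_mul h')
      rwa [abs_le] at this

theorem contDiff_mLog (l s : ℝ) (g₀ : GrushinSpace n) : ContDiff ℝ ∞
    (fun g : GrushinSpace n => mLog n l s (‖g.1‖ ^ 2) (inner ℝ g.1 g₀.1) (‖g₀.1‖ ^ 2)) := by
  have h2 : ContDiff ℝ ∞ fun g : GrushinSpace n => (inner ℝ g.1 g₀.1 : ℝ) :=
    contDiff_fst.inner ℝ contDiff_const
  unfold mLog
  exact (((((contDiff_const.mul contDiff_normSq_fst).sub (contDiff_const.mul h2)).add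
    contDiff_const).div_const _).sub contDiff_const).sub (contDiff_const.mul contDiff_normSq_fst)

theorem isTestFunction_waveDot (l s : ℝ) {j : ℝ} (hj : 0 < j) (g₀ : GrushinSpace n) :
    IsTestFunction (waveDot l s (j ^ 2) g₀) := by
  have := (isTestFunction_wave l s hj g₀).mul_left (contDiff_mLog l s g₀)
  unfold waveDot
  simpa only [mul_comm] using this

theorem abs_vWave_le_one (l u₀ J u : ℝ) : |vWave l u₀ J u| ≤ 1 := by
  rw [vWave, abs_mul, abs_of_nonneg (cutoff_nonneg _)]
  exact mul_le_one₀ (cutoff_le_one _) (abs_nonneg _) (Real.abs_cos_le_one _)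

/-- The factor 1 + |x|² is not needed for the wave itself; it gives the bound the same shape as the
one for the defect, so that one L² estimate covers both. -/
theorem abs_wave_le {l s j : ℝ} (hl : l ≠ 0) (hs : 0 ≤ s) (hj : 0 < j) (g₀ g : GrushinSpace n) :
    |wave l s (j ^ 2) g₀ g| ≤ (1 + ‖g.1‖ ^ 2) * hWave l s g₀.1 g.1
      * (Set.Icc (-(2 * j)) (2 * j)).indicator 1 g.2 := by
  have hW := hWave_nonneg hl hs g₀.1 g.1
  by_cases hu : g.2 ∈ Set.Icc (-(2 * j)) (2 * j)
  · rw [Set.indicator_of_mem hu, Pi.one_apply, mul_one, wave, abs_mul, abs_mul, abs_of_nonneg hW,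
      abs_of_nonneg (cutoff_nonneg _)]
    calc _ ≤ 1 * hWave l s g₀.1 g.1 * 1 := by
          gcongr
          · exact cutoff_le_one _
          · exact abs_vWave_le_one _ _ _ _
      _ ≤ _ := by nlinarith [sq_nonneg ‖g.1‖]
  · rw [Set.indicator_of_notMem hu, mul_zero, abs_nonpos_iff, wave]
    by_contra! h
    refine hu ?_
    have := sq_le_of_vWave_ne_zero hj (right_ne_zero_of_mul h)
    rwa [abs_le] at this

theorem exists_abs_vErr_le : ∃ M, 0 ≤ M ∧ ∀ l u₀ j u : ℝ, 1 ≤ j →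
    |vErr l u₀ (j ^ 2) u| ≤ M * (1 + l ^ 2) / j * (Set.Icc (-(2 * j)) (2 * j)).indicator 1 u := by
  obtain ⟨M, hM0, hM⟩ := exists_bound_deriv_cutoff
  refine ⟨30 * M, by positivity, fun l u₀ j u hj => ?_⟩
  have hj0 : 0 < j := by linarith
  by_cases hu : u ∈ Set.Icc (-(2 * j)) (2 * j)
  · rw [Set.indicator_of_mem hu, Pi.one_apply, mul_one]
    have hua : |u| ≤ 2 * j := abs_le.2 hu
    have h1 := (hM (u ^ 2 / j ^ 2)).1
    have h2 := (hM (u ^ 2 / j ^ 2)).2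
    have hr : |2 * u / j ^ 2| ≤ 4 / j := by
      rw [abs_div, abs_mul, abs_two, abs_of_pos (show 0 < j ^ 2 by positivity),
        div_le_div_iff₀ (by positivity) hj0]
      nlinarith
    have hj1 : 1 / j ≤ 1 := by rw [div_le_one hj0]; exact hj
    have hr2 : (2 * u / j ^ 2) ^ 2 ≤ 16 / j := by
      rw [← sq_abs]
      calc |2 * u / j ^ 2| ^ 2 ≤ (4 / j) ^ 2 := by gcongr
        _ = 16 / j * (1 / j) := by field_simp; norm_num
        _ ≤ 16 / j * 1 := by gcongr
        _ = 16 / j := mul_one _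
    have hr3 : 2 / j ^ 2 ≤ 2 / j := by
      calc 2 / j ^ 2 = 2 / j * (1 / j) := by field_simp
        _ ≤ 2 / j * 1 := by gcongr
        _ = 2 / j := mul_one _
    have hl : |l| ≤ 1 + l ^ 2 := by
      rw [abs_le]; constructor <;> nlinarith [sq_nonneg (l - 1), sq_nonneg (l + 1)]
    unfold vErr
    calc _ ≤ |(deriv (deriv cutoff) (u ^ 2 / j ^ 2) * (2 * u / j ^ 2) ^ 2
              + deriv cutoff (u ^ 2 / j ^ 2) * (2 / j ^ 2)) * Real.cos (l * (u - u₀))|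
            + |2 * (deriv cutoff (u ^ 2 / j ^ 2) * (2 * u / j ^ 2)) * (l * Real.sin (l * (u - u₀)))| :=
          abs_sub _ _
      _ ≤ (M * (16 / j) + M * (2 / j)) * 1 + 2 * (M * (4 / j)) * ((1 + l ^ 2) * 1) := by
          gcongr
          · rw [abs_mul]
            refine mul_le_mul ((abs_add_le _ _).trans (add_le_add ?_ ?_)) (Real.abs_cos_le_one _)
              (abs_nonneg _) (by positivity)
            · have e : |(2 * u / j ^ 2) ^ 2| = (2 * u / j ^ 2) ^ 2 := abs_of_nonneg (sq_nonneg _)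
              rw [abs_mul, e]
              exact mul_le_mul h2 hr2 (sq_nonneg _) hM0
            · rw [abs_mul, abs_of_nonneg (show 0 ≤ 2 / j ^ 2 by positivity)]
              exact mul_le_mul h1 hr3 (by positivity) hM0
          · rw [abs_mul, abs_mul, abs_mul, abs_mul, abs_two]
            gcongr
            exact Real.abs_sin_le_one _
      _ = M / j * (18 + 8 * (1 + l ^ 2)) := by ring
      _ ≤ M / j * (30 * (1 + l ^ 2)) := by
          gcongr
          nlinarith [sq_nonneg l]
      _ = _ := by ring
  · have hlt : 2 < u ^ 2 / j ^ 2 := by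
      rw [Set.mem_Icc, ← abs_le, not_le] at hu
      rw [lt_div_iff₀ (by positivity), ← sq_abs u]
      nlinarith
    rw [Set.indicator_of_notMem hu, vErr, deriv_cutoff_of_gt hlt, deriv_deriv_cutoff_of_gt hlt]
    simp

/-- Differentiating a cutoff at scale j gains at least a factor 1/j, while the coefficients it
multiplies grow at most like 1 + |x|². The constant must be uniform in l, s and j. -/
theorem exists_abs_waveErr_le (g₀ : GrushinSpace n) : ∃ K, 0 ≤ K ∧ ∀ l s j : ℝ, l ≠ 0 → 0 ≤ s →
    1 ≤ j → ∀ g : GrushinSpace n, |waveErr l s (j ^ 2) g₀ g| ≤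
      K * (1 + l ^ 2) / j * ((1 + ‖g.1‖ ^ 2) * hWave l s g₀.1 g.1
        * (Set.Icc (-(2 * j)) (2 * j)).indicator 1 g.2) := by
  obtain ⟨M, hM0, hM⟩ := exists_bound_deriv_cutoff
  obtain ⟨M', hM'0, hM'⟩ := exists_abs_vErr_le
  set X := ‖g₀.1‖ ^ 2 with hX
  refine ⟨M * (10 + 2 * n + 2 * X) + M', by positivity, fun l s j hl hs hj g => ?_⟩
  have hj0 : 0 < j := by linarith
  have hW := hWave_nonneg hl hs g₀.1 g.1
  set P := ‖g.1‖ ^ 2 with hP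
  have hP0 : 0 ≤ P := sq_nonneg _
  have hX0 : 0 ≤ X := sq_nonneg _
  set I : ℝ := (Set.Icc (-(2 * j)) (2 * j)).indicator 1 g.2 with hI
  have hI0 : 0 ≤ I := Set.indicator_nonneg (fun _ _ => zero_le_one) _
  have hv : |vWave l g₀.2 (j ^ 2) g.2| ≤ I := by
    by_cases hu : g.2 ∈ Set.Icc (-(2 * j)) (2 * j)
    · rw [hI, Set.indicator_of_mem hu]; exact abs_vWave_le_one _ _ _ _
    · rw [hI, Set.indicator_of_notMem hu, abs_nonpos_iff]
      by_contra! h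
      have := sq_le_of_vWave_ne_zero hj0 h
      exact hu (abs_le.1 this)
  obtain ⟨hd0, hd1⟩ := mD'_div_le hl hs
  have hD := one_add_le_mD hl hs
  have hDp := mD_pos hl hs
  have hQ : |2 * inner ℝ g.1 g₀.1 / mD l s| ≤ P + X := by
    rw [abs_div, abs_of_pos hDp, abs_mul, abs_two, div_le_iff₀ hDp]
    have := abs_real_inner_le_norm g.1 g₀.1
    have h2 : 2 * |inner ℝ g.1 g₀.1| ≤ P + X := by
      nlinarith [sq_nonneg (‖g.1‖ - ‖g₀.1‖)]
    nlinarith [add_nonneg hP0 hX0]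
  have hj1 : 1 / j ≤ 1 := by rw [div_le_one hj0]; exact hj
  have hj2 : ∀ c : ℝ, 0 ≤ c → c / j ^ 2 ≤ c / j := fun c hc => by
    calc c / j ^ 2 = c / j * (1 / j) := by field_simp
      _ ≤ c / j * 1 := by gcongr
      _ = c / j := mul_one _
  have hB : |deriv (deriv cutoff) (P / j ^ 2) * (4 * P / (j ^ 2) ^ 2)
      + deriv cutoff (P / j ^ 2) * (2 * n / j ^ 2)
      - deriv cutoff (P / j ^ 2) * (2 / j ^ 2)
        * (mD' l s / mD l s * P - 2 * inner ℝ g.1 g₀.1 / mD l s)|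
      ≤ M * (10 + 2 * n + 2 * X) * (1 + l ^ 2) / j * (1 + P) := by
    have t1 : |deriv (deriv cutoff) (P / j ^ 2) * (4 * P / (j ^ 2) ^ 2)| ≤ M * (4 * P / j) := by
      rw [abs_mul]
      refine mul_le_mul (hM _).2 ?_ (abs_nonneg _) hM0
      rw [abs_of_nonneg (by positivity)]
      have : 4 * P / (j ^ 2) ^ 2 ≤ 4 * P / j ^ 2 :=
        div_le_div_of_nonneg_left (by positivity) (by positivity)
          (le_self_pow₀ (one_le_pow₀ hj) two_ne_zero)
      exact this.trans (hj2 _ (by positivity))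
    have t2 : |deriv cutoff (P / j ^ 2) * (2 * n / j ^ 2)| ≤ M * (2 * n / j) := by
      rw [abs_mul]
      refine mul_le_mul (hM _).1 ?_ (abs_nonneg _) hM0
      rw [abs_of_nonneg (by positivity)]
      exact hj2 _ (by positivity)
    have t3 : |deriv cutoff (P / j ^ 2) * (2 / j ^ 2)
        * (mD' l s / mD l s * P - 2 * inner ℝ g.1 g₀.1 / mD l s)|
        ≤ M * (2 / j) * (2 * (1 + l ^ 2) * P + (P + X)) := by
      rw [abs_mul, abs_mul]
      refine mul_le_mul (mul_le_mul (hM _).1 ?_ (abs_nonneg _) hM0) ?_ (abs_nonneg _) (by positivity)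
      · rw [abs_of_nonneg (by positivity)]
        exact hj2 _ (by positivity)
      · refine (abs_sub _ _).trans (add_le_add ?_ hQ)
        rw [abs_mul, abs_of_nonneg hd0, abs_of_nonneg hP0]
        gcongr
    calc _ ≤ M * (4 * P / j) + M * (2 * n / j) + M * (2 / j) * (2 * (1 + l ^ 2) * P + (P + X)) :=
          (abs_sub _ _).trans (add_le_add ((abs_add_le _ _).trans (add_le_add t1 t2)) t3)
      _ = M / j * (4 * P + 2 * n + 2 * (2 * (1 + l ^ 2) * P + (P + X))) := by ring
      _ ≤ M / j * ((10 + 2 * n + 2 * X) * (1 + l ^ 2) * (1 + P)) := by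
          have hn : (0 : ℝ) ≤ n := Nat.cast_nonneg n
          have hl2 := sq_nonneg l
          gcongr
          have a1 := mul_nonneg hn hl2
          have a2 := mul_nonneg hn hP0
          have a3 := mul_nonneg hX0 hl2
          have a4 := mul_nonneg hX0 hP0
          have a5 := mul_nonneg hl2 hP0
          have a6 := mul_nonneg a1 hP0
          have a7 := mul_nonneg a3 hP0
          nlinarith
      _ = _ := by ring
  have hcut : |P * cutoff (P / j ^ 2) * vErr l g₀.2 (j ^ 2) g.2|
      ≤ (1 + P) * (M' * (1 + l ^ 2) / j * I) := by
    rw [abs_mul, abs_mul, abs_of_nonneg hP0, abs_of_nonneg (cutoff_nonneg _)]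
    have := hM' l g₀.2 j g.2 hj
    refine mul_le_mul ?_ this (abs_nonneg _) (by positivity)
    nlinarith [cutoff_le_one (P / j ^ 2), cutoff_nonneg (P / j ^ 2)]
  unfold waveErr
  rw [abs_neg, abs_mul, abs_of_nonneg hW]
  calc _ ≤ hWave l s g₀.1 g.1 * (I * (M * (10 + 2 * n + 2 * X) * (1 + l ^ 2) / j * (1 + P))
        + (1 + P) * (M' * (1 + l ^ 2) / j * I)) := by
        gcongr
        refine (abs_add_le _ _).trans (add_le_add ?_ hcut)
        rw [abs_mul]
        exact mul_le_mul hv hB (abs_nonneg _) hI0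
    _ = _ := by ring

end Grushin

/-! ### Integrability of the subordinator and L² bounds for the waves. -/

/-- The Gamma integral in the variable `1 / r`. -/
theorem integrableOn_rpow_mul_exp_neg_div {a b : ℝ} (ha : 0 < a) (hb : 0 < b) :
    IntegrableOn (fun r : ℝ => r ^ (-a - 1) * Real.exp (-(b / r))) (Set.Ioi 0) := by
  have h := integrableOn_rpow_mul_exp_neg_mul_rpow (p := 1) (s := a - 1) (by linarith) one_pos hb
  rw [← integrableOn_Ioi_comp_rpow_iff' _ (show (-1 : ℝ) ≠ 0 by norm_num)] at h
  refine h.congr_fun (fun r hr => ?_) measurableSet_Ioi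
  have hr0 : (0 : ℝ) < r := hr
  simp only [smul_eq_mul, Real.rpow_one]
  rw [← Real.rpow_mul hr0.le, ← mul_assoc, ← Real.rpow_add hr0, Real.rpow_neg_one]
  congr 2
  · ring
  · rw [div_eq_mul_inv]; ring

theorem subordinator_eq {r : ℝ} (hr : 0 < r) :
    subordinator r = (√(4 * Real.pi))⁻¹ * (r ^ (-(1 / 2 : ℝ) - 1) * Real.exp (-((1 / 4) / r))) := by
  have h1 : r ^ (-(1 / 2 : ℝ) - 1) = (√r)⁻¹ / r := by
    rw [Real.rpow_sub_one hr.ne', Real.rpow_neg hr.le, Real.sqrt_eq_rpow]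
  rw [h1, subordinator, lineHeat, Real.sqrt_mul (by positivity), mul_inv]
  rw [show (1 : ℝ) ^ 2 / (4 * r) = 1 / 4 / r by field_simp]
  ring

theorem integrableOn_subordinator : IntegrableOn subordinator (Set.Ioi 0) :=
  IntegrableOn.congr_fun (Integrable.const_mul (integrableOn_rpow_mul_exp_neg_div (a := 1 / 2)
    (b := 1 / 4) (by norm_num) (by norm_num)) _) (fun _ hr => (subordinator_eq hr).symm)
    measurableSet_Ioi

theorem subordinator_nonneg {r : ℝ} (hr : 0 ≤ r) : 0 ≤ subordinator r :=
  div_nonneg (lineHeat_nonneg _ _) hr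

namespace Grushin

variable {n : ℕ}

theorem integrable_exp_neg_normSq (x₀ : EuclideanSpace ℝ (Fin n)) {b : ℝ} (hb : 0 < b) :
    Integrable (fun x : EuclideanSpace ℝ (Fin n) => Real.exp (-b * ‖x - x₀‖ ^ 2)) ∧
      ∫ x : EuclideanSpace ℝ (Fin n), Real.exp (-b * ‖x - x₀‖ ^ 2) = (Real.pi / b) ^ ((n : ℝ) / 2) := by
  have h := GaussianFourier.integral_rexp_neg_mul_sq_norm (V := EuclideanSpace ℝ (Fin n)) hb
  rw [finrank_euclideanSpace_fin] at h
  have hi : Integrable (fun x : EuclideanSpace ℝ (Fin n) => Real.exp (-b * ‖x‖ ^ 2)) := by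
    -- A non-integrable function has integral 0 by convention, whereas the known value is positive.
    by_contra hc
    rw [integral_undef hc] at h
    exact (Real.rpow_pos_of_pos (div_pos Real.pi_pos hb) _).ne h
  refine ⟨hi.comp_sub_right x₀, ?_⟩
  rw [← h]
  exact integral_sub_right_eq_self (fun x : EuclideanSpace ℝ (Fin n) => Real.exp (-b * ‖x‖ ^ 2)) x₀

/-- With v = |x - x₀|² and D = `mD l s` ≥ 1, the weight satisfies 1 + |x|² ≤ 2(1 + |x₀|²) D (1 +
v/D), and half of the Gaussian absorbs (1 + v/D)². -/
theorem sq_one_add_mul_hWave_le {l s : ℝ} (hl : l ≠ 0) (hs : 0 ≤ s)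
    (x₀ x : EuclideanSpace ℝ (Fin n)) :
    ((1 + ‖x‖ ^ 2) * hWave l s x₀ x) ^ 2 ≤ 64 * (1 + ‖x₀‖ ^ 2) ^ 2 * mD l s ^ (2 - (n : ℝ))
      * Real.exp (-(1 / (2 * mD l s)) * ‖x - x₀‖ ^ 2) := by
  have hD := one_add_le_mD hl hs
  have hDp := mD_pos hl hs
  have hW := hWave_nonneg hl hs x₀ x
  set D := mD l s
  set v := ‖x - x₀‖ ^ 2 with hv
  set X := ‖x₀‖ ^ 2 with hX
  have hv0 : 0 ≤ v := sq_nonneg _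
  have hX0 : 0 ≤ X := sq_nonneg _
  have h1 : 1 + ‖x‖ ^ 2 ≤ 2 * (1 + X) * (D * (1 + v / D)) := by
    have e : D * (1 + v / D) = D + v := by field_simp
    rw [e]
    have : ‖x‖ ≤ ‖x - x₀‖ + ‖x₀‖ := by simpa using norm_add_le (x - x₀) x₀
    have : ‖x‖ ^ 2 ≤ 2 * v + 2 * X := by
      have := pow_le_pow_left₀ (norm_nonneg x) this 2
      nlinarith [sq_nonneg (‖x - x₀‖ - ‖x₀‖)]
    nlinarith [mul_nonneg hX0 hv0]
  have h2 : (1 + v / D) ^ 2 ≤ 16 * Real.exp (v / (2 * D)) := by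
    have a1 : 0 ≤ v / D := by positivity
    have a2 : (1 + v / D) / 4 ≤ Real.exp (v / (4 * D)) := by
      have := Real.add_one_le_exp (v / (4 * D))
      have e : v / (4 * D) = v / D / 4 := by field_simp
      rw [e] at this ⊢
      linarith
    have a3 : Real.exp (v / (2 * D)) = Real.exp (v / (4 * D)) ^ 2 := by
      rw [← Real.exp_nat_mul]; congr 1; push_cast; field_simp; ring
    rw [a3]
    have := pow_le_pow_left₀ (by positivity) a2 2
    nlinarith
  have h3 : hWave l s x₀ x ^ 2 ≤ D ^ (-(n : ℝ)) * Real.exp (-(v / D)) := by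
    refine (pow_le_pow_left₀ hW (hWave_le hl hs x₀ x) 2).trans_eq ?_
    rw [mul_pow, ← Real.exp_nat_mul, ← Real.rpow_natCast (D ^ _), ← Real.rpow_mul hDp.le]
    congr 2
    · push_cast; ring
    · change (((2 : ℕ) : ℝ)) * -(v / (2 * D)) = _
      push_cast; field_simp
  calc ((1 + ‖x‖ ^ 2) * hWave l s x₀ x) ^ 2
      = (1 + ‖x‖ ^ 2) ^ 2 * hWave l s x₀ x ^ 2 := mul_pow _ _ _
    _ ≤ (2 * (1 + X) * (D * (1 + v / D))) ^ 2 * (D ^ (-(n : ℝ)) * Real.exp (-(v / D))) := by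
        gcongr
    _ = (4 * (1 + X) ^ 2 * (D ^ 2 * D ^ (-(n : ℝ))) * Real.exp (-(v / D))) * (1 + v / D) ^ 2 := by
        ring
    _ ≤ (4 * (1 + X) ^ 2 * (D ^ 2 * D ^ (-(n : ℝ))) * Real.exp (-(v / D)))
          * (16 * Real.exp (v / (2 * D))) := by gcongr
    _ = 64 * (1 + X) ^ 2 * D ^ (2 - (n : ℝ)) * (Real.exp (-(v / D)) * Real.exp (v / (2 * D))) := by
        have : D ^ (2 - (n : ℝ)) = D ^ 2 * D ^ (-(n : ℝ)) := by
          rw [sub_eq_add_neg, Real.rpow_add hDp, Real.rpow_two]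
        rw [this]; ring
    _ = _ := by
        rw [← Real.exp_add]
        congr 2
        field_simp
        ring

/-- The Gaussian integral contributes D^{n/2}, so the total power is D^{2 - n/2}. Since D ≥ 1 + 2s,
the condition n ≥ 12 gives decay of order -4, hence L² norms of order (1 + s)^{-2}, integrable in
time. -/
theorem exists_integral_sq_le (hn : 12 ≤ n) (x₀ : EuclideanSpace ℝ (Fin n)) :
    ∃ K, 0 ≤ K ∧ ∀ l s : ℝ, l ≠ 0 → 0 ≤ s →
      Integrable (fun x : EuclideanSpace ℝ (Fin n) => ((1 + ‖x‖ ^ 2) * hWave l s x₀ x) ^ 2) ∧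
      ∫ x : EuclideanSpace ℝ (Fin n), ((1 + ‖x‖ ^ 2) * hWave l s x₀ x) ^ 2
        ≤ K * (1 + s) ^ (-4 : ℝ) := by
  refine ⟨64 * (1 + ‖x₀‖ ^ 2) ^ 2 * (2 * Real.pi) ^ ((n : ℝ) / 2), by positivity,
    fun l s hl hs => ?_⟩
  have hD := one_add_le_mD hl hs
  have hDp := mD_pos hl hs
  obtain ⟨hi, he⟩ := integrable_exp_neg_normSq x₀ (b := 1 / (2 * mD l s)) (by positivity)
  have hI := hi.const_mul (64 * (1 + ‖x₀‖ ^ 2) ^ 2 * mD l s ^ (2 - (n : ℝ)))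
  have hint : Integrable (fun x : EuclideanSpace ℝ (Fin n) =>
      ((1 + ‖x‖ ^ 2) * hWave l s x₀ x) ^ 2) := by
    refine hI.mono' ?_ (Eventually.of_forall fun x => ?_)
    · have := continuous_hWave l s x₀
      exact Continuous.aestronglyMeasurable (by fun_prop)
    · rw [Real.norm_of_nonneg (sq_nonneg _)]
      exact sq_one_add_mul_hWave_le hl hs x₀ x
  refine ⟨hint, ?_⟩
  calc _ ≤ ∫ x : EuclideanSpace ℝ (Fin n), 64 * (1 + ‖x₀‖ ^ 2) ^ 2 * mD l s ^ (2 - (n : ℝ))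
        * Real.exp (-(1 / (2 * mD l s)) * ‖x - x₀‖ ^ 2) :=
        integral_mono hint hI fun x => sq_one_add_mul_hWave_le hl hs x₀ x
    _ = 64 * (1 + ‖x₀‖ ^ 2) ^ 2 * (2 * Real.pi) ^ ((n : ℝ) / 2)
        * mD l s ^ (2 - (n : ℝ) / 2) := by
        rw [integral_const_mul, he, show Real.pi / (1 / (2 * mD l s)) = 2 * Real.pi * mD l s by
          field_simp, Real.mul_rpow (by positivity) hDp.le]
        have : mD l s ^ (2 - (n : ℝ) / 2) = mD l s ^ (2 - (n : ℝ)) * mD l s ^ ((n : ℝ) / 2) := by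
          rw [← Real.rpow_add hDp]; congr 1; ring
        rw [this]; ring
    _ ≤ _ := by
        gcongr
        have h12 : (12 : ℝ) ≤ n := by exact_mod_cast hn
        calc mD l s ^ (2 - (n : ℝ) / 2) ≤ mD l s ^ (-4 : ℝ) :=
              Real.rpow_le_rpow_of_exponent_le (by linarith) (by linarith)
          _ ≤ (1 + s) ^ (-4 : ℝ) :=
              Real.rpow_le_rpow_of_nonpos (by linarith) (by linarith) (by norm_num)

/-- `L²` bounds from pointwise bounds by Gaussians, in a vertical slab. -/
theorem exists_norm_testClass_le (hn : 12 ≤ n) (x₀ : EuclideanSpace ℝ (Fin n)) :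
    ∃ K, 0 ≤ K ∧ ∀ l s j κ : ℝ, l ≠ 0 → 0 ≤ s → 0 < j → 0 ≤ κ → ∀ h : testSpace n,
      (∀ g, |h.1 g| ≤ κ * ((1 + ‖g.1‖ ^ 2) * hWave l s x₀ g.1
        * (Set.Icc (-(2 * j)) (2 * j)).indicator 1 g.2)) →
      ‖testClass n h‖ ≤ κ * √j * K * (1 + s) ^ (-2 : ℝ) := by
  obtain ⟨K, hK0, hK⟩ := exists_integral_sq_le hn x₀
  refine ⟨√(4 * K), by positivity, fun l s j κ hl hs hj hκ h hh => ?_⟩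
  obtain ⟨hi, hle⟩ := hK l s hl hs
  have hI : Integrable ((Set.Icc (-(2 * j)) (2 * j)).indicator (1 : ℝ → ℝ)) :=
    (integrable_indicator_iff measurableSet_Icc).2 (integrableOn_const (by simp))
  have hI2 : ∫ u, (Set.Icc (-(2 * j)) (2 * j)).indicator (1 : ℝ → ℝ) u = 4 * j := by
    rw [integral_indicator measurableSet_Icc]
    simp only [Pi.one_apply, integral_const, smul_eq_mul, mul_one, measureReal_restrict_apply_univ]
    rw [Measure.real, Real.volume_Icc, ENNReal.toReal_ofReal (by linarith)]
    ring
  have hp := hi.mul_prod hI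
  have hp2 := integral_prod_mul (μ := (volume : Measure (EuclideanSpace ℝ (Fin n))))
    (ν := (volume : Measure ℝ)) (fun x => ((1 + ‖x‖ ^ 2) * hWave l s x₀ x) ^ 2)
    ((Set.Icc (-(2 * j)) (2 * j)).indicator (1 : ℝ → ℝ))
  refine le_of_sq_le_sq ?_ (by positivity)
  rw [← real_inner_self_eq_norm_sq, inner_testClass]
  calc ∫ g, h.1 g * h.1 g ≤ ∫ g : GrushinSpace n, κ ^ 2 * (((1 + ‖g.1‖ ^ 2) * hWave l s x₀ g.1) ^ 2
        * (Set.Icc (-(2 * j)) (2 * j)).indicator 1 g.2) := by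
        refine integral_mono (IsTestFunction.mul h.2 h.2).integrable (hp.const_mul _) fun g => ?_
        have h1 := pow_le_pow_left₀ (abs_nonneg _) (hh g) 2
        rw [sq_abs] at h1
        refine (sq (h.1 g)).symm.le.trans (h1.trans_eq ?_)
        by_cases hu : g.2 ∈ Set.Icc (-(2 * j)) (2 * j)
        · simp only [Set.indicator_of_mem hu, Pi.one_apply]; ring
        · simp only [Set.indicator_of_notMem hu]; ring
    _ = κ ^ 2 * ((∫ x, ((1 + ‖x‖ ^ 2) * hWave l s x₀ x) ^ 2) * (4 * j)) := by
        rw [integral_const_mul, ← hI2]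
        exact congrArg _ hp2
    _ ≤ κ ^ 2 * ((K * (1 + s) ^ (-4 : ℝ)) * (4 * j)) := by gcongr
    _ = _ := by
        rw [mul_pow, mul_pow, mul_pow, Real.sq_sqrt hj.le, Real.sq_sqrt (by positivity),
          ← Real.rpow_natCast ((1 + s) ^ (-2 : ℝ)), ← Real.rpow_mul (by linarith)]
        norm_num
        ring

end Grushin

/-! ### Subordination, tested against truncated waves. -/

namespace Grushin

variable {n : ℕ} {T : ℝ → LTwo n →L[ℝ] LTwo n}

theorem inner_testClass_right (h : LTwo n) (ψ : testSpace n) :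
    inner ℝ h (testClass n ψ) = ∫ g, h g * ψ.1 g := by
  rw [L2.inner_def]
  refine integral_congr_ae ?_
  filter_upwards [(IsTestFunction.memLp ψ.2).coeFn_toLp] with g h1
  simp [testClass, h1, mul_comm]

/-- `-Δ_G φ` as a test function. -/
noncomputable def negLaplacian (φ : testSpace n) : testSpace n :=
  ⟨fun g => -laplacian φ.1 g, by
    change IsTestFunction _
    simpa using (IsTestFunction.laplacian φ.2).mul_left (contDiff_const (c := (-1 : ℝ)))⟩

theorem eq_testClass_of_ae_eq {f : LTwo n} (φ : testSpace n) (h : f =ᵐ[volume] φ.1) :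
    f = testClass n φ :=
  Lp.ext (h.trans (IsTestFunction.memLp φ.2).coeFn_toLp.symm)

theorem IsPoissonSemigroup.exists_generator (hT : IsPoissonSemigroup n T) (φ : testSpace n) :
    ∃ k, GeneratorGraph T (testClass n φ) k ∧
      GeneratorGraph T k (testClass n (negLaplacian φ)) := by
  obtain ⟨f, k, l, hf, hl, h1, h2⟩ := hT.generator_sq φ.1 φ.2
  rw [eq_testClass_of_ae_eq φ hf] at h1
  rw [eq_testClass_of_ae_eq (negLaplacian φ) hl] at h2
  exact ⟨k, h1, h2⟩

/-- The generator commutes with the semigroup and is symmetric; its square is moved across the inner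
product one factor at a time. -/
theorem IsPoissonSemigroup.inner_negLaplacian (hT : IsPoissonSemigroup n T) (φ ψ : testSpace n)
    {τ : ℝ} (hτ : 0 ≤ τ) :
    inner ℝ (T τ (testClass n (negLaplacian φ))) (testClass n ψ)
      = inner ℝ (T τ (testClass n φ)) (testClass n (negLaplacian ψ)) := by
  obtain ⟨k, hk1, hk2⟩ := hT.exists_generator φ
  obtain ⟨m, hm1, hm2⟩ := hT.exists_generator ψ
  rw [(hk2.apply hT.semigroup hτ).symm_inner hT.semigroup hm1,
    (hk1.apply hT.semigroup hτ).symm_inner hT.semigroup hm2]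

/-- `wave` as an element of the space of test functions. -/
noncomputable def waveTest (l s : ℝ) {j : ℝ} (hj : 0 < j) (g₀ : GrushinSpace n) : testSpace n :=
  ⟨wave l s (j ^ 2) g₀, isTestFunction_wave l s hj g₀⟩

/-- `waveDot` as an element of the space of test functions. -/
noncomputable def waveDotTest (l s : ℝ) {j : ℝ} (hj : 0 < j) (g₀ : GrushinSpace n) : testSpace n :=
  ⟨waveDot l s (j ^ 2) g₀, isTestFunction_waveDot l s hj g₀⟩

theorem wave_eq_zero {l s j : ℝ} (hj : 0 < j) {g₀ g : GrushinSpace n}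
    (hg : g ∉ Metric.closedBall (0 : EuclideanSpace ℝ (Fin n)) (2 * j) ×ˢ Set.Icc (-(2 * j)) (2 * j)) :
    wave l s (j ^ 2) g₀ g = 0 := by
  rw [Set.mem_prod, not_and_or] at hg
  unfold wave
  rcases hg with h | h
  · rw [cutoff_of_ge]
    · simp
    rw [mem_closedBall_zero_iff, not_le] at h
    rw [le_div_iff₀ (by positivity)]
    nlinarith
  · by_contra! h'
    refine h ?_
    have := sq_le_of_vWave_ne_zero hj (right_ne_zero_of_mul h')
    rwa [abs_le] at this

theorem abs_wave_le_indicator {l s j : ℝ} (hl : l ≠ 0) (hs : 0 ≤ s) (hj : 0 < j)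
    (g₀ g : GrushinSpace n) : |wave l s (j ^ 2) g₀ g| ≤
      (Metric.closedBall (0 : EuclideanSpace ℝ (Fin n)) (2 * j)
        ×ˢ Set.Icc (-(2 * j)) (2 * j)).indicator (fun _ => (1 : ℝ)) g := by
  by_cases hg : g ∈ Metric.closedBall (0 : EuclideanSpace ℝ (Fin n)) (2 * j)
      ×ˢ Set.Icc (-(2 * j)) (2 * j)
  · rw [Set.indicator_of_mem hg, wave, abs_mul, abs_mul, abs_of_nonneg (cutoff_nonneg _),
      abs_of_nonneg (hWave_nonneg hl hs _ _)]
    exact mul_le_one₀ (mul_le_one₀ (cutoff_le_one _) (hWave_nonneg hl hs _ _)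
      (hWave_le_one hl hs _ _)) (abs_nonneg _) (abs_vWave_le_one _ _ _ _)
  · rw [Set.indicator_of_notMem hg, wave_eq_zero hj hg, abs_zero]

/-- On the support |x| ≤ 2j, so the logarithmic derivative is bounded. The constant depends on l and
j, which is harmless: it serves for domination and for qualitative bounds only. -/
theorem exists_abs_waveDot_le {l j : ℝ} (hl : l ≠ 0) (hj : 0 < j) (g₀ : GrushinSpace n) :
    ∃ B, 0 ≤ B ∧ ∀ s, 0 ≤ s → ∀ g : GrushinSpace n,
      |waveDot l s (j ^ 2) g₀ g| ≤ B * |wave l s (j ^ 2) g₀ g| := by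
  set X := ‖g₀.1‖ ^ 2 with hX
  set A := 2 * (1 + l ^ 2) with hA
  refine ⟨A ^ 2 * (4 * j ^ 2) + 2 * A * (4 * j ^ 2 + X) + X + n * A + l ^ 2 * (4 * j ^ 2),
    by positivity, fun s hs g => ?_⟩
  by_cases hg : g ∈ Metric.closedBall (0 : EuclideanSpace ℝ (Fin n)) (2 * j)
      ×ˢ Set.Icc (-(2 * j)) (2 * j)
  swap
  · rw [waveDot, wave_eq_zero hj hg]; simp
  have hP : ‖g.1‖ ^ 2 ≤ 4 * j ^ 2 := by
    have := mem_closedBall_zero_iff.1 hg.1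
    nlinarith [norm_nonneg g.1]
  rw [waveDot, abs_mul, mul_comm]
  refine mul_le_mul_of_nonneg_right ?_ (abs_nonneg _)
  obtain ⟨hd0, hd1⟩ := mD'_div_le hl hs
  have hD := one_add_le_mD hl hs
  have hDp := mD_pos hl hs
  have hQ : |(inner ℝ g.1 g₀.1 : ℝ)| ≤ ‖g.1‖ ^ 2 + X := by
    have := abs_real_inner_le_norm g.1 g₀.1
    nlinarith [sq_nonneg (‖g.1‖ - ‖g₀.1‖), sq_nonneg ‖g.1‖, sq_nonneg ‖g₀.1‖]
  set P := ‖g.1‖ ^ 2 with hPdef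
  set Q : ℝ := inner ℝ g.1 g₀.1
  have hP0 : 0 ≤ P := sq_nonneg _
  have hX0 : 0 ≤ X := sq_nonneg _
  have hi1 : 1 / mD l s ≤ 1 := by rw [div_le_one hDp]; linarith
  have hi0 : 0 ≤ 1 / mD l s := by positivity
  have e : mLog n l s P Q X = (mD' l s / mD l s) ^ 2 * P / 4 - (mD' l s / mD l s) * (Q * (1 / mD l s))
      + X * ((1 / mD l s) * (1 / mD l s)) - n * (mD' l s / mD l s) / 2 - l ^ 2 * P := by
    unfold mLog; field_simp
  rw [e]
  set d := mD' l s / mD l s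
  set i := 1 / mD l s
  have hA0 : 0 ≤ A := by positivity
  have b1 : |d ^ 2 * P / 4| ≤ A ^ 2 * (4 * j ^ 2) := by
    rw [abs_of_nonneg (by positivity)]
    have : d ^ 2 * P ≤ A ^ 2 * (4 * j ^ 2) := by gcongr
    have h0 : 0 ≤ d ^ 2 * P := by positivity
    linarith
  have b2 : |d * (Q * i)| ≤ 2 * A * (4 * j ^ 2 + X) := by
    rw [abs_mul, abs_mul, abs_of_nonneg hd0, abs_of_nonneg hi0]
    calc d * (|Q| * i) ≤ A * ((4 * j ^ 2 + X) * 1) := by gcongr; linarith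
      _ ≤ _ := by
        have : 0 ≤ A * (4 * j ^ 2 + X) := by positivity
        linarith
  have b3 : |X * (i * i)| ≤ X := by
    rw [abs_of_nonneg (by positivity)]
    exact mul_le_of_le_one_right hX0 (mul_le_one₀ hi1 hi0 hi1)
  have b4 : |n * d / 2| ≤ n * A := by
    rw [abs_of_nonneg (by positivity)]
    have : n * d ≤ n * A := by gcongr
    have h0 : 0 ≤ n * d := by positivity
    linarith
  have b5 : |l ^ 2 * P| ≤ l ^ 2 * (4 * j ^ 2) := by
    rw [abs_of_nonneg (by positivity)]; gcongr
  rw [abs_le] at *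
  constructor <;> linarith [b1.1, b1.2, b2.1, b2.2, b3.1, b3.2, b4.1, b4.2, b5.1, b5.2]

theorem hasDerivAt_wave {l s : ℝ} (hl : l ≠ 0) (hs : 0 ≤ s) (J : ℝ) (g₀ g : GrushinSpace n) :
    HasDerivAt (fun s => wave l s J g₀ g) (waveDot l s J g₀ g) s := by
  refine (((hasDerivAt_mehler n hl hs (‖g.1‖ ^ 2) (inner ℝ g.1 g₀.1) (‖g₀.1‖ ^ 2)).const_mul
    (cutoff (‖g.1‖ ^ 2 / J))).mul_const (vWave l g₀.2 J g.2)).congr_deriv ?_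
  rw [waveDot, wave, hWave]
  ring

theorem integrable_abs_mul_indicator (h : LTwo n) (j : ℝ) : Integrable fun g : GrushinSpace n =>
    |h g| * (Metric.closedBall (0 : EuclideanSpace ℝ (Fin n)) (2 * j)
        ×ˢ Set.Icc (-(2 * j)) (2 * j)).indicator (fun _ => (1 : ℝ)) g := by
  have hK : IsCompact (Metric.closedBall (0 : EuclideanSpace ℝ (Fin n)) (2 * j)
      ×ˢ Set.Icc (-(2 * j)) (2 * j)) :=
    (isCompact_closedBall (0 : EuclideanSpace ℝ (Fin n)) (2 * j)).prod isCompact_Icc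
  have hloc : LocallyIntegrable h (volume : Measure (GrushinSpace n)) :=
    (Lp.memLp h).locallyIntegrable (by norm_num)
  have h1 := (integrable_indicator_iff hK.measurableSet).2 (hloc.integrableOn_isCompact hK).abs
  refine h1.congr (Eventually.of_forall fun g => ?_)
  by_cases hg : g ∈ Metric.closedBall (0 : EuclideanSpace ℝ (Fin n)) (2 * j)
      ×ˢ Set.Icc (-(2 * j)) (2 * j)
  · simp only [Set.indicator_of_mem hg, mul_one]
  · simp only [Set.indicator_of_notMem hg, mul_zero]

theorem aestronglyMeasurable_mul_test (h : LTwo n) (ψ : testSpace n) :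
    AEStronglyMeasurable (fun g => h g * ψ.1 g) :=
  (Lp.aestronglyMeasurable h).mul (ψ.2.1.continuous.aestronglyMeasurable)

theorem hasDerivAt_inner_waveTest (h : LTwo n) {l s : ℝ} (hl : l ≠ 0) (hs : 0 < s) {j : ℝ}
    (hj : 0 < j) (g₀ : GrushinSpace n) :
    HasDerivAt (fun s => inner ℝ h (testClass n (waveTest l s hj g₀)))
      (inner ℝ h (testClass n (waveDotTest l s hj g₀))) s := by
  obtain ⟨B, hB0, hB⟩ := exists_abs_waveDot_le hl hj g₀
  simp only [inner_testClass_right]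
  refine (hasDerivAt_integral_of_dominated_loc_of_deriv_le
    (bound := fun g => B * (|h g| * (Metric.closedBall (0 : EuclideanSpace ℝ (Fin n)) (2 * j)
        ×ˢ Set.Icc (-(2 * j)) (2 * j)).indicator (fun _ => (1 : ℝ)) g))
    (F := fun s g => h g * wave l s (j ^ 2) g₀ g)
    (F' := fun s g => h g * waveDot l s (j ^ 2) g₀ g) (Ioi_mem_nhds hs) ?_ ?_ ?_ ?_ ?_ ?_).2
  · exact Eventually.of_forall fun s => aestronglyMeasurable_mul_test h (waveTest l s hj g₀)
  · refine (integrable_abs_mul_indicator h j).mono'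
      (aestronglyMeasurable_mul_test h (waveTest l s hj g₀)) (Eventually.of_forall fun g => ?_)
    rw [norm_mul, Real.norm_eq_abs, Real.norm_eq_abs]
    exact mul_le_mul_of_nonneg_left (abs_wave_le_indicator hl hs.le hj g₀ g) (abs_nonneg _)
  · exact aestronglyMeasurable_mul_test h (waveDotTest l s hj g₀)
  · refine Eventually.of_forall fun g t ht => ?_
    rw [norm_mul, Real.norm_eq_abs, Real.norm_eq_abs]
    have h1 := hB t (le_of_lt ht) g
    have h2 := mul_le_mul_of_nonneg_left (abs_wave_le_indicator hl (le_of_lt ht) hj g₀ g) hB0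
    calc _ ≤ |h g| * (B * _) := mul_le_mul_of_nonneg_left (h1.trans h2) (abs_nonneg _)
      _ = _ := by ring
  · exact (integrable_abs_mul_indicator h j).const_mul B
  · exact Eventually.of_forall fun g t ht => (hasDerivAt_wave hl (le_of_lt ht) _ g₀ g).const_mul _

theorem tendsto_inner_waveTest (h : LTwo n) {l : ℝ} (hl : l ≠ 0) {j : ℝ}
    (hj : 0 < j) (g₀ : GrushinSpace n) :
    Tendsto (fun s => inner ℝ h (testClass n (waveTest l s hj g₀))) (𝓝[>] 0)
      (𝓝 (inner ℝ h (testClass n (waveTest l 0 hj g₀)))) := by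
  simp only [inner_testClass_right]
  refine tendsto_integral_filter_of_dominated_convergence _ ?_ ?_
    (integrable_abs_mul_indicator h j) ?_
  · exact Eventually.of_forall fun s => aestronglyMeasurable_mul_test h (waveTest l s hj g₀)
  · filter_upwards [self_mem_nhdsWithin] with s hs
    refine Eventually.of_forall fun g => ?_
    rw [norm_mul, Real.norm_eq_abs, Real.norm_eq_abs]
    exact mul_le_mul_of_nonneg_left (abs_wave_le_indicator hl (le_of_lt hs) hj g₀ g) (abs_nonneg _)
  · refine Eventually.of_forall fun g => ?_
    exact ((hasDerivAt_wave hl le_rfl (j ^ 2) g₀ g).continuousAt.tendsto.mono_left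
      nhdsWithin_le_nhds).const_mul _

theorem integrableOn_one_add_rpow_neg_two :
    IntegrableOn (fun s : ℝ => (1 + s) ^ (-2 : ℝ)) (Set.Ioi 0) := by
  have := integrableOn_add_rpow_Ioi_of_lt (a := -2) (c := 0) (m := 1) (by norm_num) (by norm_num)
  simpa only [add_comm] using this

/-- The kernel of `T 1` tested against truncated waves, by subordination. -/
theorem IsPoissonSemigroup.exists_abs_inner_wave_sub_le (hn : 12 ≤ n) (hT : IsPoissonSemigroup n T)
    (φ : testSpace n) (g₀ : GrushinSpace n) :
    ∃ K, 0 ≤ K ∧ ∀ l j : ℝ, l ≠ 0 → 1 ≤ j → ∀ hj : 0 < j,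
      |inner ℝ (T 1 (testClass n φ)) (testClass n (waveTest l 0 hj g₀))
        - ∫ s in Set.Ioi 0, subordinator s * ∫ g, φ.1 g * wave l s (j ^ 2) g₀ g|
      ≤ K * (1 + l ^ 2) / √j := by
  obtain ⟨K₁, hK₁, hKe⟩ := exists_abs_waveErr_le g₀
  obtain ⟨K₂, hK₂, hKn⟩ := exists_norm_testClass_le hn g₀.1
  obtain ⟨k, hk1, hk2⟩ := hT.exists_generator φ
  set f := testClass n φ with hf
  set f' := testClass n (negLaplacian φ) with hf'
  set I := ∫ s in Set.Ioi (0 : ℝ), (1 + s) ^ (-2 : ℝ) with hI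
  have hI0 : 0 ≤ I := setIntegral_nonneg measurableSet_Ioi fun s hs =>
    Real.rpow_nonneg (by linarith [Set.mem_Ioi.1 hs]) _
  refine ⟨‖f‖ * K₁ * K₂ * I, by positivity, fun l j hl hj1 hj => ?_⟩
  let w : ℝ → LTwo n := fun s => testClass n (waveTest l s hj g₀)
  let w' : ℝ → LTwo n := fun s => testClass n (waveDotTest l s hj g₀)
  obtain ⟨B, hB0, hB⟩ := exists_abs_waveDot_le hl hj g₀
  have hw : ∀ s, 0 ≤ s → ‖w s‖ ≤ √j * K₂ * (1 + s) ^ (-2 : ℝ) := fun s hs => by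
    have := hKn l s j 1 hl hs hj zero_le_one (waveTest l s hj g₀) fun g => by
      rw [one_mul]; exact abs_wave_le hl hs hj g₀ g
    simpa using this
  have hpow : ∀ s : ℝ, 0 ≤ s → (1 + s) ^ (-2 : ℝ) ≤ 1 := fun s hs =>
    Real.rpow_le_one_of_one_le_of_nonpos (by linarith) (by norm_num)
  have hw1 : ∀ s, 0 ≤ s → ‖w s‖ ≤ √j * K₂ := fun s hs =>
    (hw s hs).trans (mul_le_of_le_one_right (by positivity) (hpow s hs))
  have hw' : ∀ s, 0 ≤ s → ‖w' s‖ ≤ B * (√j * K₂) := fun s hs => by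
    have := hKn l s j B hl hs hj hB0 (waveDotTest l s hj g₀) fun g =>
      (hB s hs g).trans (mul_le_mul_of_nonneg_left (abs_wave_le hl hs hj g₀ g) hB0)
    refine this.trans ?_
    rw [mul_assoc B]
    exact mul_le_of_le_one_right (by positivity) (hpow s hs)
  have hin : ∀ (a : LTwo n) (y : ℝ), 0 ≤ y → ∀ b : LTwo n, |inner ℝ (T y a) b| ≤ ‖a‖ * ‖b‖ :=
    fun a y hy b => (abs_real_inner_le_norm _ _).trans
      (mul_le_mul_of_nonneg_right (hT.semigroup.norm_le hy a) (norm_nonneg _))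
  have hcont : ∀ a b : LTwo n, ContinuousOn (fun y => (inner ℝ (T y a) b : ℝ)) (Set.Ici 0) :=
    fun a b => (hT.semigroup.continuousOn a).inner continuousOn_const
  have hT0 : T 0 f = f := by rw [hT.semigroup.zero]; rfl
  -- Differentiating T_y f twice in y gives T_y(-Δ_G f), and -Δ_G can be moved onto the wave. Hence
  -- ∂_s F + ∂_y² F pairs T_y f with the defect of the wave: 1/j from the cutoff, times √j from the
  -- L² norm on a slab of height 4j.
  have key := abs_sub_integral_subordinator_le (F := fun s y => inner ℝ (T y f) (w s))
    (F₁ := fun s y => -inner ℝ (T y k) (w s)) (F₂ := fun s y => inner ℝ (T y f') (w s))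
    (Fs := fun s y => inner ℝ (T y f) (w' s))
    (ε := fun s => ‖f‖ * (K₁ * (1 + l ^ 2) / j * √j * K₂) * (1 + s) ^ (-2 : ℝ))
    (m := fun s => ‖f‖ * (√j * K₂) * (1 + s) ^ (-2 : ℝ))
    (c := inner ℝ (T 1 f) (w 0)) (M := ‖f‖ * (√j * K₂)) ?_ ?_ ?_ ?_ ?_ ?_ ?_ ?_ ?_ ?_ ?_ ?_ ?_ ?_
  · have e1 : ∀ s, inner ℝ (T 0 f) (w s) = ∫ g, φ.1 g * wave l s (j ^ 2) g₀ g := fun s => by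
      rw [hT0]; exact inner_testClass φ (waveTest l s hj g₀)
    simp only [e1] at key
    refine key.trans_eq ?_
    rw [integral_const_mul, ← hI]
    have : √j * √j = j := Real.mul_self_sqrt hj.le
    have hsj : 0 < √j := Real.sqrt_pos.2 hj
    field_simp
    rw [Real.sq_sqrt hj.le]
  · intro s hs y hy
    refine ((hk1.hasDerivAt hT.semigroup hy).inner ℝ (hasDerivAt_const y (w s))).congr_deriv ?_
    simp
  · intro s hs y hy
    refine ((hk2.hasDerivAt hT.semigroup hy).inner ℝ (hasDerivAt_const y (w s))).neg.congr_deriv ?_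
    simp
  · intro s hs y hy
    exact hasDerivAt_inner_waveTest (T y f) hl hs hj g₀
  · exact fun s _ => (hcont f' (w s)).mono Set.Ioi_subset_Ici_self
  · exact fun s _ => (hcont f (w' s)).mono Set.Ioi_subset_Ici_self
  · intro s hs y hy
    have e2 : inner ℝ (T y f') (w s) = inner ℝ (T y f) (testClass n (negLaplacian (waveTest l s hj g₀))) :=
      hT.inner_negLaplacian φ (waveTest l s hj g₀) hy.le
    rw [e2, ← inner_add_right, ← map_add]
    refine (hin f y hy.le _).trans ?_
    rw [mul_assoc]
    refine mul_le_mul_of_nonneg_left ?_ (norm_nonneg _)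
    refine hKn l s j _ hl hs.le hj (by positivity) _ fun g => ?_
    refine le_of_eq_of_le ?_ (hKe l s j hl hs.le hj1 g)
    rw [← waveDot_sub_laplacian l s _ (mD_pos hl hs.le).ne']
    rfl
  · intro s₀ h₀
    refine ⟨(‖f‖ + ‖k‖ + ‖f'‖) * (√j * K₂) + ‖f‖ * (B * (√j * K₂)), fun s hs1 _ y hy => ?_⟩
    have hs : 0 ≤ s := by linarith
    have c0 : 0 ≤ √j * K₂ := by positivity
    have n1 := mul_nonneg (norm_nonneg f) c0
    have n2 := mul_nonneg (norm_nonneg k) c0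
    have n3 := mul_nonneg (norm_nonneg f') c0
    have n4 := mul_nonneg (norm_nonneg f) (mul_nonneg hB0 c0)
    have a := fun v : LTwo n => (hin v y hy.le (w s)).trans
      (mul_le_mul_of_nonneg_left (hw1 s hs) (norm_nonneg v))
    have b := (hin f y hy.le (w' s)).trans (mul_le_mul_of_nonneg_left (hw' s hs) (norm_nonneg f))
    refine ⟨(a f).trans ?_, ?_, (a f').trans ?_, b.trans ?_⟩
    · linarith
    · rw [abs_neg]; refine (a k).trans ?_; linarith
    · linarith
    · linarith
  · intro s hs
    exact ((hcont f (w s)) 0 Set.self_mem_Ici).tendsto.mono_left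
      (nhdsWithin_mono _ Set.Ioi_subset_Ici_self)
  · intro s hs y hy
    refine (hin f y hy.le (w s)).trans ?_
    rw [mul_assoc]
    exact mul_le_mul_of_nonneg_left (hw s hs.le) (norm_nonneg _)
  · have h1 : Tendsto (fun s : ℝ => (1 + s) ^ (-2 : ℝ)) atTop (𝓝 0) :=
      (tendsto_rpow_neg_atTop (y := 2) (by norm_num)).comp
        (tendsto_atTop_add_const_left _ 1 tendsto_id)
    simpa using h1.const_mul (‖f‖ * (√j * K₂))
  · intro s hs
    exact mul_le_of_le_one_right (by positivity) (hpow s hs.le)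
  · have t1 : Tendsto (fun p : ℝ × ℝ => (inner ℝ (T 1 f) (w p.1) : ℝ)) (𝓝[>] 0 ×ˢ 𝓝 1)
        (𝓝 (inner ℝ (T 1 f) (w 0))) :=
      (tendsto_inner_waveTest (T 1 f) hl hj g₀).comp tendsto_fst
    have t2 : Tendsto (fun p : ℝ × ℝ => ‖T p.2 f - T 1 f‖ * (√j * K₂)) (𝓝[>] 0 ×ˢ 𝓝 1)
        (𝓝 0) := by
      have c1 : Tendsto (fun y => T y f) (𝓝 1) (𝓝 (T 1 f)) :=
        ((hT.semigroup.continuousOn f).continuousAt (Ici_mem_nhds one_pos)).tendsto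
      have c2 := (c1.sub_const (T 1 f)).norm.mul_const (√j * K₂)
      rw [sub_self, norm_zero, zero_mul] at c2
      exact c2.comp tendsto_snd
    have t3 : Tendsto (fun p : ℝ × ℝ => (inner ℝ (T p.2 f - T 1 f) (w p.1) : ℝ)) (𝓝[>] 0 ×ˢ 𝓝 1)
        (𝓝 0) := by
      refine squeeze_zero_norm' ?_ t2
      have hpos : ∀ᶠ p : ℝ × ℝ in 𝓝[>] 0 ×ˢ 𝓝 1, 0 < p.1 :=
        (show ∀ᶠ s : ℝ in 𝓝[>] 0, 0 < s from self_mem_nhdsWithin).prod_inl _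
      filter_upwards [hpos] with p hp
      exact (abs_real_inner_le_norm _ _).trans
        (mul_le_mul_of_nonneg_left (hw1 p.1 hp.le) (norm_nonneg _))
    have t4 := t3.add t1
    rw [zero_add] at t4
    refine t4.congr fun p => ?_
    rw [← inner_add_left, sub_add_cancel]
  · exact integrableOn_one_add_rpow_neg_two.const_mul _
  · refine Integrable.mul_bdd (c := ‖f‖ * (√j * K₂)) integrableOn_subordinator ?_ ?_
    · refine ContinuousOn.aestronglyMeasurable (fun s hs => ?_) measurableSet_Ioi
      exact (hasDerivAt_inner_waveTest (T 0 f) hl hs hj g₀).continuousAt.continuousWithinAt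
    · filter_upwards [ae_restrict_mem measurableSet_Ioi] with s hs
      exact (hin f 0 le_rfl (w s)).trans
        (mul_le_mul_of_nonneg_left (hw1 s (le_of_lt hs)) (norm_nonneg _))

end Grushin

/-! ### From waves to Gaussian bumps. -/

namespace Grushin

variable {n : ℕ} {T : ℝ → LTwo n →L[ℝ] LTwo n}

/-- The standard Gaussian profile centred at `g₀`. -/
noncomputable def bump (g₀ g : GrushinSpace n) : ℝ :=
  Real.exp (-(1 / 2) * ‖g.1 - g₀.1‖ ^ 2) * Real.exp (-(1 / 2) * (g.2 - g₀.2) ^ 2)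

/-- The standard Gaussian density. -/
noncomputable def gaussDensity (l : ℝ) : ℝ := (√(2 * Real.pi))⁻¹ * Real.exp (-(1 / 2) * l ^ 2)

theorem gaussDensity_pos (l : ℝ) : 0 < gaussDensity l := by
  unfold gaussDensity; positivity

theorem continuous_gaussDensity : Continuous gaussDensity := by unfold gaussDensity; fun_prop

theorem integral_exp_mul_cos (t : ℝ) :
    ∫ l : ℝ, Real.exp (-(1 / 2) * l ^ 2) * Real.cos (l * t)
      = √(2 * Real.pi) * Real.exp (-(1 / 2) * t ^ 2) := by
  have h := fourierIntegral_gaussian (b := 1 / 2) (by norm_num) t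
  have hi : Integrable fun l : ℝ => Complex.exp (Complex.I * t * l) * Complex.exp (-(1 / 2) * l ^ 2) := by
    have := integrable_cexp_quadratic (b := (1 / 2 : ℂ)) (by norm_num) (Complex.I * t) 0
    refine this.congr (Eventually.of_forall fun l => ?_)
    simp only [← Complex.exp_add]
    congr 1; ring
  have h2 := congrArg Complex.re h
  rw [← RCLike.re_eq_complex_re, ← integral_re hi] at h2
  have e1 : ∀ l : ℝ, RCLike.re (Complex.exp (Complex.I * t * l) * Complex.exp (-(1 / 2) * l ^ 2))
      = Real.exp (-(1 / 2) * l ^ 2) * Real.cos (l * t) := fun l => by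
    rw [show Complex.exp (-(1 / 2) * l ^ 2) = ((Real.exp (-(1 / 2) * l ^ 2) : ℝ) : ℂ) by
      push_cast; rfl, RCLike.re_eq_complex_re, Complex.re_mul_ofReal, mul_comm,
      show Complex.I * t * l = ((l * t : ℝ) : ℂ) * Complex.I by push_cast; ring,
      Complex.exp_ofReal_mul_I_re]
  simp only [e1] at h2
  rw [h2]
  have e2 : ((Real.pi : ℂ) / (1 / 2)) ^ (1 / 2 : ℂ) * Complex.exp (-t ^ 2 / (4 * (1 / 2)))
      = ((√(2 * Real.pi) * Real.exp (-(1 / 2) * t ^ 2) : ℝ) : ℂ) := by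
    rw [Real.sqrt_eq_rpow]
    push_cast
    rw [Complex.ofReal_cpow (by positivity)]
    push_cast
    congr 2
    · ring
    · ring
  rw [e2]
  exact Complex.ofReal_re _

theorem integrable_one_add_sq_mul_gaussDensity :
    Integrable fun l : ℝ => (1 + l ^ 2) * gaussDensity l := by
  have h1 : Integrable fun l : ℝ => Real.exp (-(1 / 2) * l ^ 2) :=
    integrable_exp_neg_mul_sq (by norm_num)
  have h2 : Integrable fun l : ℝ => l ^ 2 * Real.exp (-(1 / 2) * l ^ 2) := by
    have := integrable_rpow_mul_exp_neg_mul_sq (b := 1 / 2) (by norm_num) (s := 2) (by norm_num)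
    simpa using this
  refine ((h1.add h2).const_mul (√(2 * Real.pi))⁻¹).congr (Eventually.of_forall fun l => ?_)
  simp only [gaussDensity, Pi.add_apply]; ring

/-- Averaging over Gaussian frequencies turns the vertical oscillation into a Gaussian, so the waves
at time 0 average to `bump`. -/
theorem integral_gaussDensity_mul_cos (t : ℝ) :
    ∫ l, gaussDensity l * Real.cos (l * t) = Real.exp (-(1 / 2) * t ^ 2) := by
  simp only [gaussDensity, mul_assoc]
  rw [integral_const_mul, integral_exp_mul_cos, inv_mul_cancel_left₀ (by positivity)]

theorem hWave_zero (l : ℝ) (x₀ x : EuclideanSpace ℝ (Fin n)) :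
    hWave l 0 x₀ x = Real.exp (-(1 / 2) * ‖x - x₀‖ ^ 2) := by
  have h1 : mD l 0 = 1 := by simp [mD, mC, mS]
  have h2 : mD' l 0 = 2 := by simp [mD', mC, mS]
  rw [hWave, mExp, h1, h2, Real.one_rpow, one_mul, norm_sub_sq_real]
  simp only [mC, mul_zero, Real.cosh_zero]
  congr 1; ring

theorem continuous_bump (g₀ : GrushinSpace n) : Continuous (bump g₀) := by unfold bump; fun_prop

theorem integrable_bump (g₀ : GrushinSpace n) : Integrable (bump g₀) :=
  (integrable_exp_neg_normSq g₀.1 (b := 1 / 2) (by norm_num)).1.mul_prod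
    ((integrable_exp_neg_mul_sq (b := 1 / 2) (by norm_num)).comp_sub_right g₀.2)

theorem memLp_bump (g₀ : GrushinSpace n) : MemLp (bump g₀) 2 := by
  rw [memLp_two_iff_integrable_sq (continuous_bump g₀).aestronglyMeasurable]
  refine ((integrable_exp_neg_normSq g₀.1 (b := 1) one_pos).1.mul_prod
    ((integrable_exp_neg_mul_sq (b := 1) one_pos).comp_sub_right g₀.2)).congr
    (Eventually.of_forall fun g => ?_)
  simp only [bump, mul_pow, ← Real.exp_nat_mul]
  congr 2 <;> push_cast <;> ring

theorem integrable_mul_bump (h : LTwo n) (g₀ : GrushinSpace n) :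
    Integrable fun g => h g * bump g₀ g :=
  (Lp.memLp h).integrable_mul (memLp_bump g₀)

theorem integral_gaussDensity_mul_inner (h : LTwo n) {j : ℝ} (hj : 0 < j) (g₀ : GrushinSpace n) :
    AEStronglyMeasurable (fun l => gaussDensity l * inner ℝ h (testClass n (waveTest l 0 hj g₀))) ∧
    ∫ l, gaussDensity l * inner ℝ h (testClass n (waveTest l 0 hj g₀))
      = ∫ g, h g * (cutoff (‖g.1‖ ^ 2 / j ^ 2) * cutoff (g.2 ^ 2 / j ^ 2) * bump g₀ g) := by
  simp only [inner_testClass_right, ← integral_const_mul]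
  have hi : Integrable (fun p : ℝ × GrushinSpace n =>
      gaussDensity p.1 * (h p.2 * (waveTest p.1 0 hj g₀).1 p.2)) (volume.prod volume) := by
    have hG : Integrable gaussDensity := by
      refine integrable_one_add_sq_mul_gaussDensity.mono'
        continuous_gaussDensity.aestronglyMeasurable (Eventually.of_forall fun l => ?_)
      rw [Real.norm_of_nonneg (gaussDensity_pos l).le]
      nlinarith [mul_nonneg (sq_nonneg l) (gaussDensity_pos l).le]
    refine (hG.mul_prod (integrable_abs_mul_indicator h j)).mono' ?_ ?_
    · have m1 : AEStronglyMeasurable (fun p : ℝ × GrushinSpace n => h p.2) (volume.prod volume) :=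
        (Lp.aestronglyMeasurable h).comp_snd
      have m2 : Continuous fun p : ℝ × GrushinSpace n => (waveTest p.1 0 hj g₀).1 p.2 := by
        simp only [waveTest, wave, hWave_zero, vWave]
        have := contDiff_cutoff.continuous
        fun_prop
      exact (continuous_gaussDensity.comp continuous_fst).aestronglyMeasurable.mul
        (m1.mul m2.aestronglyMeasurable)
    · have hne : ∀ᵐ p : ℝ × GrushinSpace n ∂(volume.prod volume), p.1 ≠ 0 :=
        Measure.quasiMeasurePreserving_fst.ae (Measure.ae_ne volume 0)
      filter_upwards [hne] with p hp
      rw [norm_mul, norm_mul, Real.norm_of_nonneg (gaussDensity_pos _).le, Real.norm_eq_abs,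
        Real.norm_eq_abs]
      gcongr
      · exact (gaussDensity_pos _).le
      · exact abs_wave_le_indicator hp le_rfl hj g₀ p.2
  refine ⟨hi.integral_prod_left.aestronglyMeasurable, ?_⟩
  rw [integral_integral_swap hi]
  refine integral_congr_ae (Eventually.of_forall fun g => ?_)
  simp only [waveTest, wave, hWave_zero, vWave]
  have := integral_gaussDensity_mul_cos (g.2 - g₀.2)
  rw [bump, ← this]
  simp only [← integral_const_mul]
  refine integral_congr_ae (Eventually.of_forall fun l => ?_)
  ring

theorem tendsto_cutoff_mul_bump (h : LTwo n) (g₀ : GrushinSpace n) :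
    Tendsto (fun k : ℕ => ∫ g, h g * (cutoff (‖g.1‖ ^ 2 / ((k : ℝ) + 1) ^ 2)
      * cutoff (g.2 ^ 2 / ((k : ℝ) + 1) ^ 2) * bump g₀ g)) atTop (𝓝 (∫ g, h g * bump g₀ g)) := by
  have hc := contDiff_cutoff.continuous
  have hb := continuous_bump g₀
  refine tendsto_integral_of_dominated_convergence (fun g => |h g * bump g₀ g|) (fun k => ?_)
    (integrable_mul_bump h g₀).abs (fun k => Eventually.of_forall fun g => ?_)
    (Eventually.of_forall fun g => ?_)
  · exact (Lp.aestronglyMeasurable h).mul (Continuous.aestronglyMeasurable (by fun_prop))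
  · rw [norm_mul, abs_mul, Real.norm_eq_abs, Real.norm_eq_abs, abs_mul, abs_mul,
      abs_of_nonneg (cutoff_nonneg _), abs_of_nonneg (cutoff_nonneg _)]
    refine mul_le_mul_of_nonneg_left (mul_le_of_le_one_left (abs_nonneg _) ?_) (abs_nonneg _)
    exact mul_le_one₀ (cutoff_le_one _) (cutoff_nonneg _) (cutoff_le_one _)
  · have h1 : Tendsto (fun k : ℕ => ((k : ℝ) + 1) ^ 2) atTop atTop :=
      (tendsto_pow_atTop two_ne_zero).comp
        (tendsto_atTop_add_const_right _ 1 tendsto_natCast_atTop_atTop)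
    refine tendsto_const_nhds.congr' ?_
    filter_upwards [h1.eventually_ge_atTop (‖g.1‖ ^ 2), h1.eventually_ge_atTop (g.2 ^ 2)]
      with k hk1 hk2
    have hp : (0 : ℝ) < ((k : ℝ) + 1) ^ 2 := by positivity
    rw [cutoff_of_le ((div_le_one hp).2 hk1), cutoff_of_le ((div_le_one hp).2 hk2)]
    ring

/-- The kernel of `T 1` tested against Gaussians, by subordination. -/
theorem IsPoissonSemigroup.integral_mul_bump (hn : 12 ≤ n) (hT : IsPoissonSemigroup n T)
    (φ : testSpace n) (g₀ : GrushinSpace n) :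
    ∫ g, (T 1 (testClass n φ)) g * bump g₀ g = ∫ l, gaussDensity l * ∫ s in Set.Ioi 0,
      subordinator s * ∫ g, φ.1 g * (hWave l s g₀.1 g.1 * Real.cos (l * (g.2 - g₀.2))) := by
  obtain ⟨K, hK0, hK⟩ := hT.exists_abs_inner_wave_sub_le hn φ g₀
  set h := T 1 (testClass n φ)
  have hj : ∀ k : ℕ, (0 : ℝ) < k + 1 := fun k => by positivity
  set A : ℕ → ℝ → ℝ := fun k l => inner ℝ h (testClass n (waveTest l 0 (hj k) g₀)) with hA
  set B : ℝ → ℝ := fun l => ∫ s in Set.Ioi 0, subordinator s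
    * ∫ g, φ.1 g * (hWave l s g₀.1 g.1 * Real.cos (l * (g.2 - g₀.2))) with hB
  set C := ∫ s in Set.Ioi 0, subordinator s * ∫ g, |φ.1 g| with hC
  have hφi : Integrable φ.1 := IsTestFunction.integrable φ.2
  have hBC : ∀ l, l ≠ 0 → |B l| ≤ C := fun l hl => by
    rw [← Real.norm_eq_abs]
    refine norm_integral_le_of_norm_le (Integrable.mul_const integrableOn_subordinator _) ?_
    filter_upwards [ae_restrict_mem measurableSet_Ioi] with s hs
    have hs0 : (0 : ℝ) ≤ s := le_of_lt hs
    rw [norm_mul, Real.norm_of_nonneg (subordinator_nonneg hs0)]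
    refine mul_le_mul_of_nonneg_left ?_ (subordinator_nonneg hs0)
    refine norm_integral_le_of_norm_le hφi.abs (Eventually.of_forall fun g => ?_)
    rw [norm_mul, norm_mul, Real.norm_of_nonneg (hWave_nonneg hl hs0 _ _)]
    refine mul_le_of_le_one_right (norm_nonneg _) ?_
    exact mul_le_one₀ (hWave_le_one hl hs0 _ _) (norm_nonneg _) (Real.abs_cos_le_one _)
  obtain ⟨J₀, hJ₀⟩ : ∃ J₀ : ℝ, ∀ g, φ.1 g ≠ 0 → ‖g‖ ≤ J₀ := by
    obtain ⟨J₀, hJ⟩ := (IsCompact.isBounded φ.2.2).exists_norm_le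
    exact ⟨J₀, fun g hg => hJ g (subset_tsupport _ hg)⟩
  -- Once k + 1 exceeds the radius of the support of φ, both cutoffs equal 1 on that support, so no
  -- truncation is left in `B`.
  have hAB : ∀ᶠ k : ℕ in atTop, ∀ l, l ≠ 0 → |A k l - B l| ≤ K * (1 + l ^ 2) / √((k : ℝ) + 1) := by
    filter_upwards [(tendsto_atTop_add_const_right _ (1 : ℝ)
      tendsto_natCast_atTop_atTop).eventually_ge_atTop J₀] with k hk l hl
    have := hK l (k + 1) hl (by simp) (hj k)
    convert this using 3
    refine setIntegral_congr_fun measurableSet_Ioi fun s hs => ?_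
    congr 1
    refine integral_congr_ae (Eventually.of_forall fun g => ?_)
    by_cases hg : φ.1 g = 0
    · simp [hg]
    · have hg1 := (hJ₀ g hg).trans hk
      have hx : ‖g.1‖ ≤ (k : ℝ) + 1 := (norm_fst_le g).trans hg1
      have hu : |g.2| ≤ (k : ℝ) + 1 := (norm_snd_le g).trans hg1
      have c1 : cutoff (‖g.1‖ ^ 2 / ((k : ℝ) + 1) ^ 2) = 1 := by
        refine cutoff_of_le ((div_le_one (by positivity)).2 ?_)
        gcongr
      have c2 : cutoff (g.2 ^ 2 / ((k : ℝ) + 1) ^ 2) = 1 := by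
        refine cutoff_of_le ((div_le_one (by positivity)).2 ?_)
        rw [← sq_abs]
        gcongr
      simp only [wave, vWave, c1, c2, one_mul]
  -- The truncation error grows like 1 + l², which the Gaussian frequency weight makes integrable.
  have hlim : Tendsto (fun k => ∫ l, gaussDensity l * A k l) atTop
      (𝓝 (∫ l, gaussDensity l * B l)) := by
    refine tendsto_integral_filter_of_dominated_convergence
      (fun l => (C + K) * ((1 + l ^ 2) * gaussDensity l))
      (Eventually.of_forall fun k => (integral_gaussDensity_mul_inner h (hj k) g₀).1) ?_
      (integrable_one_add_sq_mul_gaussDensity.const_mul _) ?_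
    · filter_upwards [hAB] with k hk
      filter_upwards [Measure.ae_ne volume (0 : ℝ)] with l hl
      have h1 := hk l hl
      have h2 := hBC l hl
      have h3 : K * (1 + l ^ 2) / √((k : ℝ) + 1) ≤ K * (1 + l ^ 2) := by
        refine div_le_self (by positivity) ?_
        rw [Real.one_le_sqrt]; simp
      have hC0 : 0 ≤ C := (abs_nonneg _).trans h2
      have h4 : |A k l| ≤ (C + K) * (1 + l ^ 2) := by
        have := abs_sub_abs_le_abs_sub (A k l) (B l)
        nlinarith [mul_nonneg hC0 (sq_nonneg l)]
      rw [norm_mul, Real.norm_of_nonneg (gaussDensity_pos l).le, Real.norm_eq_abs]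
      have := mul_le_mul_of_nonneg_left h4 (gaussDensity_pos l).le
      linarith
    · filter_upwards [Measure.ae_ne volume (0 : ℝ)] with l hl
      refine Tendsto.const_mul _ ?_
      rw [tendsto_iff_norm_sub_tendsto_zero]
      have t : Tendsto (fun k : ℕ => K * (1 + l ^ 2) / √((k : ℝ) + 1)) atTop (𝓝 0) :=
        (Real.tendsto_sqrt_atTop.comp (tendsto_atTop_add_const_right _ (1 : ℝ)
          tendsto_natCast_atTop_atTop)).const_div_atTop _
      refine squeeze_zero' (Eventually.of_forall fun _ => norm_nonneg _) ?_ t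
      filter_upwards [hAB] with k hk using hk l hl
  refine tendsto_nhds_unique ?_ hlim
  refine (tendsto_cutoff_mul_bump h g₀).congr fun k => ?_
  exact ((integral_gaussDensity_mul_inner h (hj k) g₀).2).symm

end Grushin

/-! ### The function sinh x / x and Mehler's kernel. -/

/-- `sinh x / x`, extended continuously. -/
noncomputable def sinhDiv (x : ℝ) : ℝ := dslope Real.sinh 0 x

theorem sinhDiv_zero : sinhDiv 0 = 1 := by
  rw [sinhDiv, dslope_same, Real.deriv_sinh, Real.cosh_zero]

theorem sinhDiv_of_ne {x : ℝ} (hx : x ≠ 0) : sinhDiv x = Real.sinh x / x := by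
  rw [sinhDiv, dslope_of_ne _ hx, slope_def_field]; simp

theorem mul_sinhDiv (x : ℝ) : x * sinhDiv x = Real.sinh x := by
  rcases eq_or_ne x 0 with rfl | hx
  · simp
  · rw [sinhDiv_of_ne hx]; field_simp

theorem continuous_sinhDiv : Continuous sinhDiv := by
  rw [← continuousOn_univ]
  exact (continuousOn_dslope univ_mem).2 ⟨Real.continuous_sinh.continuousOn,
    Real.differentiable_sinh 0⟩

theorem sinhDiv_neg (x : ℝ) : sinhDiv (-x) = sinhDiv x := by
  rcases eq_or_ne x 0 with rfl | hx
  · simp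
  · rw [sinhDiv_of_ne hx, sinhDiv_of_ne (neg_ne_zero.2 hx), Real.sinh_neg, neg_div_neg_eq]

theorem one_add_sq_half_le_cosh (x : ℝ) : 1 + x ^ 2 / 2 ≤ Real.cosh x := by
  have h := Real.cosh_sq (x / 2)
  have h2 := Real.cosh_two_mul (x / 2)
  rw [mul_div_cancel₀ x (two_ne_zero)] at h2
  have h3 : (x / 2) ^ 2 ≤ Real.sinh (x / 2) ^ 2 := by
    rw [← sq_abs (x / 2), ← sq_abs (Real.sinh _), Real.abs_sinh]
    exact pow_le_pow_left₀ (abs_nonneg _) (Real.self_le_sinh_iff.2 (abs_nonneg _)) 2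
  nlinarith

theorem one_add_sq_div_six_le_sinhDiv (x : ℝ) : 1 + x ^ 2 / 6 ≤ sinhDiv x := by
  have key : ∀ x : ℝ, 0 < x → 1 + x ^ 2 / 6 ≤ sinhDiv x := by
    intro x hx
    rw [sinhDiv_of_ne hx.ne', le_div_iff₀ hx]
    have hd : ∀ y : ℝ, HasDerivAt (fun y => Real.sinh y - (1 + y ^ 2 / 6) * y)
        (Real.cosh y - (1 + y ^ 2 / 2)) y := fun y => by
      have h1 : HasDerivAt (fun y : ℝ => (1 + y ^ 2 / 6) * y) (1 + y ^ 2 / 2) y := by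
        have := ((((hasDerivAt_pow 2 y).div_const 6).const_add 1).mul (hasDerivAt_id y))
        refine this.congr_deriv ?_
        simp; ring
      exact (Real.hasDerivAt_sinh y).sub h1
    have hm := monotone_of_deriv_nonneg (fun y => (hd y).differentiableAt) fun y => by
      rw [(hd y).deriv]; linarith [one_add_sq_half_le_cosh y]
    have := hm hx.le
    simp at this
    linarith
  rcases lt_trichotomy x 0 with h | h | h
  · have := key (-x) (by linarith)
    rwa [sinhDiv_neg, neg_sq] at this
  · subst h; simp [sinhDiv_zero]
  · exact key x h

theorem one_le_sinhDiv (x : ℝ) : 1 ≤ sinhDiv x := by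
  linarith [one_add_sq_div_six_le_sinhDiv x, sq_nonneg x]

theorem sinhDiv_pos (x : ℝ) : 0 < sinhDiv x := zero_lt_one.trans_le (one_le_sinhDiv x)

theorem mS_eq {l s : ℝ} (hl : l ≠ 0) (hs : s ≠ 0) : mS l s = s * sinhDiv (2 * l * s) := by
  rw [mS, sinhDiv_of_ne (by positivity)]
  field_simp

theorem integrable_sinhDiv_rpow {p : ℝ} (hp : 1 ≤ p) :
    Integrable fun x : ℝ => sinhDiv x ^ (-p) := by
  have h1 : Integrable fun x : ℝ => (1 + (x / √6) ^ 2)⁻¹ :=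
    integrable_inv_one_add_sq.comp_div (by positivity)
  refine h1.mono' ?_ (Eventually.of_forall fun x => ?_)
  · exact (continuous_sinhDiv.rpow_const fun x => Or.inl (sinhDiv_pos x).ne').aestronglyMeasurable
  · rw [Real.norm_of_nonneg (Real.rpow_nonneg (sinhDiv_pos x).le _), div_pow,
      Real.sq_sqrt (by norm_num)]
    have h2 := one_add_sq_div_six_le_sinhDiv x
    calc sinhDiv x ^ (-p) ≤ sinhDiv x ^ (-1 : ℝ) :=
          Real.rpow_le_rpow_of_exponent_le (one_le_sinhDiv x) (by linarith)
      _ = (sinhDiv x)⁻¹ := Real.rpow_neg_one _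
      _ ≤ _ := inv_anti₀ (by positivity) h2

namespace Grushin

variable {n : ℕ}

theorem integral_exp_quadratic {b : ℝ} (hb : 0 < b) (w : EuclideanSpace ℝ (Fin n)) :
    Integrable (fun v : EuclideanSpace ℝ (Fin n) => Real.exp (-b * ‖v‖ ^ 2 + inner ℝ w v)) ∧
    ∫ v : EuclideanSpace ℝ (Fin n), Real.exp (-b * ‖v‖ ^ 2 + inner ℝ w v)
      = (Real.pi / b) ^ ((n : ℝ) / 2) * Real.exp (‖w‖ ^ 2 / (4 * b)) := by
  obtain ⟨h1, h2⟩ := integrable_exp_neg_normSq ((1 / (2 * b)) • w) hb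
  have e : ∀ v : EuclideanSpace ℝ (Fin n), Real.exp (-b * ‖v‖ ^ 2 + inner ℝ w v)
      = Real.exp (-b * ‖v - (1 / (2 * b)) • w‖ ^ 2) * Real.exp (‖w‖ ^ 2 / (4 * b)) := fun v => by
    rw [← Real.exp_add, norm_sub_sq_real, inner_smul_right, norm_smul, mul_pow, Real.norm_eq_abs,
      sq_abs, real_inner_comm]
    congr 1
    field_simp
    ring
  simp only [e]
  exact ⟨h1.mul_const _, by rw [integral_mul_const, h2]⟩

/-- The heat kernel of the harmonic oscillator (Mehler). -/
noncomputable def mehler (l s : ℝ) (x x' : EuclideanSpace ℝ (Fin n)) : ℝ :=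
  (4 * Real.pi * mS l s) ^ (-(n : ℝ) / 2)
    * Real.exp (-((mC l s * (‖x‖ ^ 2 + ‖x'‖ ^ 2) - 2 * inner ℝ x x') / (4 * mS l s)))

theorem mehler_nonneg {l s : ℝ} (hl : l ≠ 0) (hs : 0 < s) (x x' : EuclideanSpace ℝ (Fin n)) :
    0 ≤ mehler l s x x' := by
  have hS := hs.trans_le (self_le_sinh_div hl hs.le)
  unfold mehler; positivity

theorem mehler_le {l s : ℝ} (hl : l ≠ 0) (hs : 0 < s) (x x' : EuclideanSpace ℝ (Fin n)) :
    mehler l s x x' ≤ (4 * Real.pi * mS l s) ^ (-(n : ℝ) / 2) := by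
  have hS := hs.trans_le (self_le_sinh_div hl hs.le)
  have hC := one_le_mC l s
  refine mul_le_of_le_one_right (by positivity) ?_
  rw [Real.exp_le_one_iff, neg_nonpos]
  refine div_nonneg ?_ (by positivity)
  have := norm_sub_sq_real x x'
  nlinarith [sq_nonneg ‖x - x'‖, sq_nonneg ‖x‖, sq_nonneg ‖x'‖]

/-- Completing the square in x'. Besides size bounds this is all that is needed of Mehler's kernel:
it reproduces the evolved Gaussian, so no heat equation for the kernel itself is required. -/
theorem integral_mehler_mul_exp {l s : ℝ} (hl : l ≠ 0) (hs : 0 < s)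
    (x₀ x : EuclideanSpace ℝ (Fin n)) :
    ∫ x', mehler l s x x' * Real.exp (-(1 / 2) * ‖x' - x₀‖ ^ 2) = hWave l s x₀ x := by
  have hS := hs.trans_le (self_le_sinh_div hl hs.le)
  have hD := mD_pos hl hs.le
  have hCS := mC_sq l s hl
  have hDe : mD l s = mC l s + 2 * mS l s := rfl
  obtain ⟨-, h⟩ := integral_exp_quadratic (n := n) (b := mD l s / (4 * mS l s)) (by positivity)
    ((1 / (2 * mS l s)) • x + x₀)
  have e : ∀ x', mehler l s x x' * Real.exp (-(1 / 2) * ‖x' - x₀‖ ^ 2)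
      = (4 * Real.pi * mS l s) ^ (-(n : ℝ) / 2)
        * Real.exp (-(mC l s * ‖x‖ ^ 2 / (4 * mS l s)) - ‖x₀‖ ^ 2 / 2)
        * Real.exp (-(mD l s / (4 * mS l s)) * ‖x'‖ ^ 2
          + inner ℝ ((1 / (2 * mS l s)) • x + x₀) x') := fun x' => by
    rw [mehler, mul_assoc _ (Real.exp _) (Real.exp _), mul_assoc _ (Real.exp _) (Real.exp _),
      ← Real.exp_add, ← Real.exp_add, norm_sub_sq_real,
      inner_add_left, inner_smul_left, real_inner_comm x₀ x', hDe]
    simp only [conj_trivial]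
    congr 2
    field_simp
    ring
  simp only [e]
  rw [integral_const_mul, h, hWave, mExp]
  have e1 : (4 * Real.pi * mS l s) ^ (-(n : ℝ) / 2) * (Real.pi / (mD l s / (4 * mS l s))) ^ ((n : ℝ) / 2)
      = mD l s ^ (-(n : ℝ) / 2) := by
    rw [show Real.pi / (mD l s / (4 * mS l s)) = (4 * Real.pi * mS l s) / mD l s by field_simp,
      Real.div_rpow (by positivity) hD.le, neg_div, Real.rpow_neg (by positivity),
      Real.rpow_neg hD.le]
    field_simp
  have e2 : ‖(1 / (2 * mS l s)) • x + x₀‖ ^ 2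
      = (1 / (2 * mS l s)) ^ 2 * ‖x‖ ^ 2 + 2 * (1 / (2 * mS l s) * inner ℝ x x₀) + ‖x₀‖ ^ 2 := by
    rw [norm_add_sq_real, norm_smul, mul_pow, Real.norm_eq_abs, sq_abs, inner_smul_left]
    simp
  rw [← e1, e2]
  generalize (4 * Real.pi * mS l s) ^ (-(n : ℝ) / 2) = A1
  generalize (Real.pi / (mD l s / (4 * mS l s))) ^ ((n : ℝ) / 2) = A2
  rw [show ∀ a b c d : ℝ, a * b * (c * d) = a * c * (b * d) by intros; ring, ← Real.exp_add]
  congr 2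
  have e3 : mD' l s * mS l s = mC l s * mD l s - 1 := by
    rw [hDe, mD']; linear_combination -hCS
  have e4 : mD' l s = (mC l s * mD l s - 1) / mS l s := by
    rw [← e3]; field_simp
  have e5 : mC l s = mD l s - 2 * mS l s := by rw [hDe]; ring
  rw [e4, e5]
  field_simp
  ring

end Grushin

/-! ### The kernel as an integral over frequencies and times. -/

namespace Grushin

variable {n : ℕ}

/-- Lebesgue measure on frequencies and positive times. -/
noncomputable def freqTime : Measure (ℝ × ℝ) := volume.prod (volume.restrict (Set.Ioi 0))

instance : SFinite freqTime := by unfold freqTime; infer_instance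

theorem ae_freqTime : ∀ᵐ p ∂freqTime, p.1 ≠ 0 ∧ 0 < p.2 := by
  have h1 : ∀ᵐ p ∂freqTime, p.1 ≠ 0 :=
    Measure.quasiMeasurePreserving_fst.ae (Measure.ae_ne volume 0)
  have h2 : ∀ᵐ p ∂freqTime, p.2 ∈ Set.Ioi (0 : ℝ) :=
    Measure.quasiMeasurePreserving_snd.ae (ae_restrict_mem measurableSet_Ioi)
  filter_upwards [h1, h2] with p hp1 hp2 using ⟨hp1, hp2⟩

/-- The size of the heat kernel at time `s`, weighted for subordination. -/
noncomputable def timeWeight (n : ℕ) (s : ℝ) : ℝ :=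
  subordinator s * (4 * Real.pi * s) ^ (-(n : ℝ) / 2) / (2 * s)

theorem timeWeight_nonneg {s : ℝ} (hs : 0 < s) : 0 ≤ timeWeight n s := by
  have := subordinator_nonneg hs.le
  unfold timeWeight; positivity

theorem timeWeight_eq {s : ℝ} (hs : 0 < s) :
    timeWeight n s = (√(4 * Real.pi))⁻¹ * (4 * Real.pi) ^ (-(n : ℝ) / 2) / 2
      * (s ^ (-((n : ℝ) / 2 + 3 / 2) - 1) * Real.exp (-((1 / 4) / s))) := by
  rw [timeWeight, subordinator_eq hs, Real.mul_rpow (by positivity) hs.le,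
    show -((n : ℝ) / 2 + 3 / 2) - 1 = (-(1 / 2) - 1) + -(n : ℝ) / 2 - 1 by ring,
    Real.rpow_sub_one hs.ne' (-(1 / 2) - 1 + -(n : ℝ) / 2), Real.rpow_add hs]
  field_simp

theorem integrableOn_timeWeight : IntegrableOn (timeWeight n) (Set.Ioi 0) :=
  IntegrableOn.congr_fun (Integrable.const_mul (integrableOn_rpow_mul_exp_neg_div
    (a := (n : ℝ) / 2 + 3 / 2) (b := 1 / 4) (by positivity) (by norm_num)) _)
    (fun _ hr => (timeWeight_eq hr).symm) measurableSet_Ioi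

theorem measurable_subordinator : Measurable subordinator := by
  unfold subordinator lineHeat; fun_prop

theorem measurable_mS : Measurable fun p : ℝ × ℝ => mS p.1 p.2 := by
  have := Real.continuous_sinh.measurable
  unfold mS; fun_prop

theorem measurable_mC : Measurable fun p : ℝ × ℝ => mC p.1 p.2 := by
  have := Real.continuous_cosh.measurable
  unfold mC; fun_prop

/-- The size of the heat kernel of the harmonic oscillator, weighted for subordination. -/
noncomputable def freqTimeWeight (n : ℕ) (p : ℝ × ℝ) : ℝ :=
  subordinator p.2 * (4 * Real.pi * mS p.1 p.2) ^ (-(n : ℝ) / 2)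

theorem measurable_freqTimeWeight : Measurable (freqTimeWeight n) := by
  have := measurable_mS
  have := measurable_subordinator
  unfold freqTimeWeight; fun_prop

theorem freqTimeWeight_eq {l s : ℝ} (hl : l ≠ 0) (hs : 0 < s) :
    freqTimeWeight n (l, s) = timeWeight n s * (2 * s) * sinhDiv (2 * s * l) ^ (-(n : ℝ) / 2) := by
  rw [freqTimeWeight, mS_eq hl hs.ne', ← mul_assoc, Real.mul_rpow (by positivity)
    (sinhDiv_pos _).le, timeWeight, show 2 * l * s = 2 * s * l by ring]
  field_simp

/-- In the variable x = 2sl the weight factors into `timeWeight n s` and a power of `sinhDiv x`, the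
Jacobian cancelling the factor 2s. -/
theorem integrable_freqTimeWeight (hn : 2 ≤ n) : Integrable (freqTimeWeight n) freqTime := by
  have hh : Integrable fun x : ℝ => sinhDiv x ^ (-(n : ℝ) / 2) := by
    have h2 : (2 : ℝ) ≤ n := by exact_mod_cast hn
    simpa only [neg_div] using integrable_sinhDiv_rpow (p := (n : ℝ) / 2) (by linarith)
  have hae : ∀ s, 0 < s → (fun l => timeWeight n s * (2 * s) * sinhDiv (2 * s * l) ^ (-(n : ℝ) / 2))
      =ᵐ[volume] fun l => freqTimeWeight n (l, s) := fun s hs => by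
    filter_upwards [Measure.ae_ne volume (0 : ℝ)] with l hl using (freqTimeWeight_eq hl hs).symm
  rw [freqTime, integrable_prod_iff' measurable_freqTimeWeight.aestronglyMeasurable]
  constructor
  · filter_upwards [ae_restrict_mem measurableSet_Ioi] with s hs
    have hs0 : (0 : ℝ) < s := hs
    exact ((hh.comp_mul_left' (R := 2 * s) (by positivity)).const_mul _).congr (hae s hs)
  · have h1 := (integrableOn_timeWeight (n := n)).mul_const (∫ x, sinhDiv x ^ (-(n : ℝ) / 2))
    refine h1.congr ?_
    filter_upwards [ae_restrict_mem measurableSet_Ioi] with s hs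
    have hs0 : (0 : ℝ) < s := hs
    have hc := integral_congr_ae ((hae s hs).fun_comp (fun x => ‖x‖))
    simp only [Function.comp_def] at hc
    rw [← hc]
    have e : ∀ l, ‖timeWeight n s * (2 * s) * sinhDiv (2 * s * l) ^ (-(n : ℝ) / 2)‖
        = timeWeight n s * (2 * s) * sinhDiv (2 * s * l) ^ (-(n : ℝ) / 2) := fun l => by
      have := timeWeight_nonneg (n := n) hs0
      have := sinhDiv_pos (2 * s * l)
      exact Real.norm_of_nonneg (by positivity)
    simp only [e]
    rw [integral_const_mul, Measure.integral_comp_mul_left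
      (fun x => sinhDiv x ^ (-(n : ℝ) / 2)) (2 * s), abs_of_pos (by positivity), smul_eq_mul]
    field_simp

/-- The integrand of the Poisson kernel. -/
noncomputable def freqTimeKernel (p : ℝ × ℝ) (g g' : GrushinSpace n) : ℝ :=
  (2 * Real.pi)⁻¹ * (subordinator p.2 * mehler p.1 p.2 g.1 g'.1 * Real.cos (p.1 * (g.2 - g'.2)))

theorem measurable_freqTimeKernel : Measurable fun r : (ℝ × ℝ) × (GrushinSpace n × GrushinSpace n) =>
    freqTimeKernel r.1 r.2.1 r.2.2 := by
  have h1 : Measurable fun r : (ℝ × ℝ) × (GrushinSpace n × GrushinSpace n) => mS r.1.1 r.1.2 :=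
    measurable_mS.comp measurable_fst
  have h2 : Measurable fun r : (ℝ × ℝ) × (GrushinSpace n × GrushinSpace n) => mC r.1.1 r.1.2 :=
    measurable_mC.comp measurable_fst
  have := measurable_subordinator
  unfold freqTimeKernel mehler
  fun_prop

theorem abs_freqTimeKernel_le {p : ℝ × ℝ} (hl : p.1 ≠ 0) (hs : 0 < p.2) (g g' : GrushinSpace n) :
    |freqTimeKernel p g g'| ≤ freqTimeWeight n p := by
  have h1 := subordinator_nonneg hs.le
  have h2 := mehler_nonneg hl hs g.1 g'.1
  have h3 := mehler_le hl hs g.1 g'.1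
  have hpi : (2 * Real.pi)⁻¹ ≤ 1 := inv_le_one_of_one_le₀ (by linarith [Real.pi_gt_three])
  rw [freqTimeKernel, abs_mul, abs_mul, abs_mul, abs_of_nonneg h1, abs_of_nonneg h2,
    abs_of_nonneg (show 0 ≤ (2 * Real.pi)⁻¹ by positivity), freqTimeWeight]
  calc _ ≤ 1 * (subordinator p.2 * mehler p.1 p.2 g.1 g'.1 * 1) := by
        gcongr; exact Real.abs_cos_le_one _
    _ ≤ _ := by rw [one_mul, mul_one]; gcongr

theorem integral_sin_mul_exp (l : ℝ) : ∫ v : ℝ, Real.exp (-(1 / 2) * v ^ 2) * Real.sin (v * l) = 0 := by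
  have h := integral_neg_eq_self (fun v : ℝ => Real.exp (-(1 / 2) * v ^ 2) * Real.sin (v * l)) volume
  simp only [neg_sq, neg_mul, Real.sin_neg, mul_neg, integral_neg] at h ⊢
  linarith

theorem integral_cos_sub_mul_exp (l u u₀ : ℝ) :
    ∫ u', Real.cos (l * (u - u')) * Real.exp (-(1 / 2) * (u' - u₀) ^ 2)
      = 2 * Real.pi * (gaussDensity l * Real.cos (l * (u - u₀))) := by
  have hG : Integrable fun v : ℝ => Real.exp (-(1 / 2) * v ^ 2) :=
    integrable_exp_neg_mul_sq (by norm_num)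
  have e : ∀ v : ℝ, Real.cos (l * (u - (v + u₀))) * Real.exp (-(1 / 2) * (v + u₀ - u₀) ^ 2)
      = Real.cos (l * (u - u₀)) * (Real.exp (-(1 / 2) * v ^ 2) * Real.cos (v * l))
        + Real.sin (l * (u - u₀)) * (Real.exp (-(1 / 2) * v ^ 2) * Real.sin (v * l)) := fun v => by
    rw [show l * (u - (v + u₀)) = l * (u - u₀) - v * l by ring, Real.cos_sub, add_sub_cancel_right]
    ring
  have hc : Integrable fun v : ℝ => Real.exp (-(1 / 2) * v ^ 2) * Real.cos (v * l) :=
    hG.mul_bdd (c := 1) (by fun_prop) (Eventually.of_forall fun v => Real.abs_cos_le_one _)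
  have hsn : Integrable fun v : ℝ => Real.exp (-(1 / 2) * v ^ 2) * Real.sin (v * l) :=
    hG.mul_bdd (c := 1) (by fun_prop) (Eventually.of_forall fun v => Real.abs_sin_le_one _)
  rw [← integral_add_right_eq_self _ u₀]
  simp only [e]
  rw [integral_add (hc.const_mul _) (hsn.const_mul _), integral_const_mul, integral_const_mul,
    integral_sin_mul_exp, integral_exp_mul_cos, gaussDensity]
  have h4 : 2 * Real.pi * (√(2 * Real.pi))⁻¹ = √(2 * Real.pi) := by
    rw [← div_eq_mul_inv]; exact Real.div_sqrt
  rw [mul_zero, add_zero]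
  linear_combination -(Real.exp (-(1 / 2) * l ^ 2) * Real.cos (l * (u - u₀))) * h4

/-- The Poisson kernel, as an integral over frequencies and times. -/
noncomputable def kernelPre (g g' : GrushinSpace n) : ℝ := ∫ p, freqTimeKernel p g g' ∂freqTime

theorem integrable_freqTimeKernel (hn : 2 ≤ n) (g g' : GrushinSpace n) :
    Integrable (fun p => freqTimeKernel p g g') freqTime := by
  refine (integrable_freqTimeWeight hn).mono' ?_ ?_
  · exact (measurable_freqTimeKernel.comp (measurable_id.prodMk measurable_const)
      (g := fun r : (ℝ × ℝ) × (GrushinSpace n × GrushinSpace n) =>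
        freqTimeKernel r.1 r.2.1 r.2.2) (f := fun p => (p, (g, g')))).aestronglyMeasurable
  · filter_upwards [ae_freqTime] with p hp using abs_freqTimeKernel_le hp.1 hp.2 g g'

theorem integral_freqTimeKernel_mul_bump {p : ℝ × ℝ} (hl : p.1 ≠ 0) (hs : 0 < p.2)
    (g₀ g : GrushinSpace n) :
    ∫ g', freqTimeKernel p g g' * bump g₀ g'
      = gaussDensity p.1 * (subordinator p.2 * (hWave p.1 p.2 g₀.1 g.1
        * Real.cos (p.1 * (g.2 - g₀.2)))) := by
  have h1 := integral_prod_mul (μ := (volume : Measure (EuclideanSpace ℝ (Fin n))))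
    (ν := (volume : Measure ℝ))
    (fun x' => mehler p.1 p.2 g.1 x' * Real.exp (-(1 / 2) * ‖x' - g₀.1‖ ^ 2))
    (fun u' => Real.cos (p.1 * (g.2 - u')) * Real.exp (-(1 / 2) * (u' - g₀.2) ^ 2))
  rw [integral_mehler_mul_exp hl hs, integral_cos_sub_mul_exp] at h1
  have e : ∀ g' : GrushinSpace n, freqTimeKernel p g g' * bump g₀ g'
      = (2 * Real.pi)⁻¹ * subordinator p.2 *
        (mehler p.1 p.2 g.1 g'.1 * Real.exp (-(1 / 2) * ‖g'.1 - g₀.1‖ ^ 2)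
        * (Real.cos (p.1 * (g.2 - g'.2)) * Real.exp (-(1 / 2) * (g'.2 - g₀.2) ^ 2))) := fun g' => by
    rw [freqTimeKernel, bump]; ring
  simp only [e]
  rw [integral_const_mul]
  refine (congrArg _ h1).trans ?_
  field_simp

/-- The evolved wave is unfolded into an integral of the Mehler kernel and a cosine against `bump`;
Fubini, with a majorant that is a product of `freqTimeWeight` and |φ| ⊗ `bump`, collects frequency
and time into `kernelPre`. -/
theorem integral_freqTime_eq (hn : 2 ≤ n) {φ : GrushinSpace n → ℝ} (hφ : Integrable φ)
    (g₀ : GrushinSpace n) :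
    ∫ l, gaussDensity l * ∫ s in Set.Ioi 0,
      subordinator s * ∫ g, φ g * (hWave l s g₀.1 g.1 * Real.cos (l * (g.2 - g₀.2)))
    = ∫ g', (∫ g, φ g * kernelPre g g') * bump g₀ g' := by
  have hq : Integrable (fun q : GrushinSpace n × GrushinSpace n => φ q.1 * bump g₀ q.2)
      (volume.prod volume) := hφ.mul_prod (integrable_bump g₀)
  have hΨ : Integrable (fun r : (ℝ × ℝ) × (GrushinSpace n × GrushinSpace n) =>
      freqTimeKernel r.1 r.2.1 r.2.2 * (φ r.2.1 * bump g₀ r.2.2))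
      (freqTime.prod (volume.prod volume)) := by
    refine ((integrable_freqTimeWeight hn).mul_prod hq.norm).mono'
      (measurable_freqTimeKernel.aestronglyMeasurable.mul hq.aestronglyMeasurable.comp_snd) ?_
    filter_upwards [Measure.quasiMeasurePreserving_fst.ae ae_freqTime] with r hr
    rw [norm_mul]
    exact mul_le_mul_of_nonneg_right (abs_freqTimeKernel_le hr.1 hr.2 _ _) (norm_nonneg _)
  have hΘ := hΨ.integral_prod_left
  have hΘae : ∀ᵐ p ∂freqTime, Integrable (fun q : GrushinSpace n × GrushinSpace n =>
      freqTimeKernel p q.1 q.2 * (φ q.1 * bump g₀ q.2)) (volume.prod volume) := hΨ.prod_right_ae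
  have hΘeq : ∀ᵐ p ∂freqTime, ∫ q : GrushinSpace n × GrushinSpace n,
        freqTimeKernel p q.1 q.2 * (φ q.1 * bump g₀ q.2) ∂(volume.prod volume)
      = gaussDensity p.1 * (subordinator p.2 * ∫ g, φ g * (hWave p.1 p.2 g₀.1 g.1
        * Real.cos (p.1 * (g.2 - g₀.2)))) := by
    filter_upwards [hΘae, ae_freqTime] with p hp hp2
    rw [integral_prod _ hp, ← integral_const_mul, ← integral_const_mul]
    refine integral_congr_ae (Eventually.of_forall fun g => ?_)
    have := integral_freqTimeKernel_mul_bump hp2.1 hp2.2 g₀ g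
    simp only
    calc _ = ∫ g', φ g * (freqTimeKernel p g g' * bump g₀ g') := by congr 1; ext g'; ring
      _ = _ := by rw [integral_const_mul, this]; ring
  have hΘ' := hΘ.congr hΘeq
  calc _ = ∫ l, ∫ s in Set.Ioi 0, gaussDensity l * (subordinator s * ∫ g, φ g *
        (hWave l s g₀.1 g.1 * Real.cos (l * (g.2 - g₀.2)))) := by
        simp only [integral_const_mul]
    _ = ∫ p, gaussDensity p.1 * (subordinator p.2 * ∫ g, φ g * (hWave p.1 p.2 g₀.1 g.1
        * Real.cos (p.1 * (g.2 - g₀.2)))) ∂freqTime := (integral_prod _ hΘ').symm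
    _ = ∫ p, ∫ q : GrushinSpace n × GrushinSpace n,
        freqTimeKernel p q.1 q.2 * (φ q.1 * bump g₀ q.2) ∂(volume.prod volume) ∂freqTime :=
        (integral_congr_ae hΘeq).symm
    _ = ∫ q : GrushinSpace n × GrushinSpace n, ∫ p,
        freqTimeKernel p q.1 q.2 * (φ q.1 * bump g₀ q.2) ∂freqTime ∂(volume.prod volume) :=
        integral_integral_swap hΨ
    _ = ∫ g', ∫ g, ∫ p, freqTimeKernel p g g' * (φ g * bump g₀ g') ∂freqTime :=
        integral_prod_symm _ hΨ.integral_prod_right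
    _ = _ := by
        refine integral_congr_ae (Eventually.of_forall fun g' => ?_)
        simp only
        rw [← integral_mul_const]
        refine integral_congr_ae (Eventually.of_forall fun g => ?_)
        simp only
        rw [integral_mul_const, kernelPre]
        ring

end Grushin

/-! ### Gaussian bumps separate functions. -/

namespace Grushin

variable {n : ℕ}

/-- A signed density all of whose exponential moments exist and vanish is zero. -/
theorem ae_eq_zero_of_forall_integral_mul_exp {E : Type*} [NormedAddCommGroup E] [NormedSpace ℝ E]
    [CompleteSpace E] [MeasurableSpace E] [BorelSpace E] [SecondCountableTopology E] {μ : Measure E}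
    [SigmaFinite μ] {w : E → ℝ} (hw : Measurable w)
    (hi : ∀ L : StrongDual ℝ E, Integrable (fun x => w x * Real.exp (L x)) μ)
    (h : ∀ L : StrongDual ℝ E, ∫ x, w x * Real.exp (L x) ∂μ = 0) : w =ᵐ[μ] 0 := by
  have hw0 : Integrable w μ := by simpa using hi 0
  let P : (E → ℝ) → Measure E := fun v => μ.withDensity fun x => ENNReal.ofReal (v x)
  have hfin : ∀ v : E → ℝ, Integrable v μ → IsFiniteMeasure (P v) := fun v hv =>
    isFiniteMeasure_withDensity_ofReal hv.2
  have hint : ∀ v : E → ℝ, Measurable v → ∀ f : E → ℝ,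
      ∫ x, f x ∂(P v) = ∫ x, max (v x) 0 * f x ∂μ := fun v hv f => by
    rw [integral_withDensity_eq_integral_toReal_smul hv.ennreal_ofReal
      (Eventually.of_forall fun _ => ENNReal.ofReal_lt_top)]
    simp only [ENNReal.toReal_ofReal', smul_eq_mul]
  have hint' : ∀ v : E → ℝ, Measurable v → ∀ L : StrongDual ℝ E,
      Integrable (fun x => v x * Real.exp (L x)) μ →
      Integrable (fun x => Real.exp (L x)) (P v) ∧
        Integrable (fun x => max (v x) 0 * Real.exp (L x)) μ := fun v hv L hL => by
    have e : ∀ x, max (v x) 0 * Real.exp (L x) = max (v x * Real.exp (L x)) 0 := fun x => by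
      rw [max_mul_of_nonneg _ _ (Real.exp_pos _).le, zero_mul]
    have h2 : Integrable (fun x => max (v x) 0 * Real.exp (L x)) μ := by
      simp only [e]; exact hL.pos_part
    refine ⟨?_, h2⟩
    rw [integrable_withDensity_iff_integrable_smul' hv.ennreal_ofReal
      (Eventually.of_forall fun _ => ENNReal.ofReal_lt_top)]
    simpa only [ENNReal.toReal_ofReal', smul_eq_mul] using h2
  have hneg : ∀ L : StrongDual ℝ E, Integrable (fun x => -w x * Real.exp (L x)) μ := fun L => by
    exact (hi L).neg.congr (Eventually.of_forall fun x => by simp)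
  have := hfin w hw0
  have := hfin (fun x => -w x) hw0.neg
  have hexp : ∀ L : StrongDual ℝ E,
      ∫ x, Real.exp (L x) ∂(P w) = ∫ x, Real.exp (L x) ∂(P fun x => -w x) := fun L => by
    rw [hint w hw, hint (fun x => -w x) hw.neg, ← sub_eq_zero, ← integral_sub (hint' w hw L (hi L)).2
      (hint' (fun x => -w x) hw.neg L (hneg L)).2]
    refine Eq.trans ?_ (h L)
    refine integral_congr_ae (Eventually.of_forall fun x => ?_)
    simp only
    rw [← sub_mul]
    congr 1
    rcases le_total 0 (w x) with h0 | h0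
    · rw [max_eq_left h0, max_eq_right (by linarith)]; ring
    · rw [max_eq_right h0, max_eq_left (by linarith)]; ring
  have hmass : P w = 0 ↔ (P fun x => -w x) = 0 := by
    have := hexp 0
    simp only [zero_apply, Real.exp_zero, integral_const, smul_eq_mul,
      mul_one] at this
    rw [← Measure.measure_univ_eq_zero, ← Measure.measure_univ_eq_zero,
      ← measureReal_eq_zero_iff, ← measureReal_eq_zero_iff, this]
  -- The positive and negative parts of `w` define finite measures whose moment generating functions
  -- along every functional agree and are finite everywhere. Analytic continuation to the point i
  -- gives equal characteristic functions.
  have heq : P w = P fun x => -w x := by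
    refine Measure.ext_of_charFunDual ?_
    ext L
    have hm : ProbabilityTheory.mgf L (P w) = ProbabilityTheory.mgf L (P fun x => -w x) := by
      ext t
      have := hexp (t • L)
      simpa [ProbabilityTheory.mgf] using this
    have hset : ProbabilityTheory.integrableExpSet L (P w) = Set.univ := by
      ext t
      have := (hint' w hw (t • L) (hi (t • L))).1
      simpa [ProbabilityTheory.integrableExpSet] using this
    have key := ProbabilityTheory.eqOn_complexMGF_of_mgf' hm hmass
    have h1 := key (x := Complex.I) (by simp [hset])
    simp only [ProbabilityTheory.complexMGF] at h1
    simp only [charFunDual_apply]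
    simpa only [mul_comm] using h1
  have hae := (withDensity_eq_iff hw.ennreal_ofReal.aemeasurable hw.neg.ennreal_ofReal.aemeasurable
    (by
      have : P w Set.univ ≠ ⊤ := measure_ne_top _ _
      rwa [withDensity_apply _ MeasurableSet.univ, Measure.restrict_univ] at this)).1 heq
  filter_upwards [hae] with x hx
  have hx' := congrArg ENNReal.toReal hx
  simp only [ENNReal.toReal_ofReal', Pi.neg_apply] at hx'
  rcases le_total 0 (w x) with h0 | h0
  · rw [max_eq_left h0, max_eq_right (by linarith)] at hx'; simpa using hx'
  · rw [max_eq_right h0, max_eq_left (by linarith)] at hx'; simp; linarith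

/-- A translated Gaussian is a constant times the centred one times the exponential of a linear
functional, and every functional arises. So all exponential moments of v · `bump 0` vanish. -/
theorem ae_eq_zero_of_forall_integral_mul_bump {v : GrushinSpace n → ℝ} (hv : Measurable v)
    (hi : ∀ g₀, Integrable fun g => v g * bump g₀ g) (h : ∀ g₀, ∫ g, v g * bump g₀ g = 0) :
    v =ᵐ[volume] 0 := by
  have key : ∀ L : StrongDual ℝ (GrushinSpace n), ∃ (c : ℝ) (g₀ : GrushinSpace n), ∀ g,
      v g * bump 0 g * Real.exp (L g) = v g * bump g₀ g * c := fun L => by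
    let L₁ : StrongDual ℝ (EuclideanSpace ℝ (Fin n)) := L.comp (ContinuousLinearMap.inl ℝ _ _)
    let y := (InnerProductSpace.toDual ℝ (EuclideanSpace ℝ (Fin n))).symm L₁
    have hy : ∀ x, L (x, 0) = inner ℝ y x := fun x =>
      (InnerProductSpace.toDual_symm_apply (x := x) (y := L₁)).symm
    let c := L (0, 1)
    refine ⟨Real.exp (1 / 2 * ‖y‖ ^ 2 + 1 / 2 * c ^ 2), (y, c), fun g => ?_⟩
    have hL : L g = inner ℝ y g.1 + g.2 * c := by
      have : g = (g.1, 0) + g.2 • ((0 : EuclideanSpace ℝ (Fin n)), (1 : ℝ)) := by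
        ext <;> simp
      conv_lhs => rw [this]
      rw [map_add, map_smul, hy, smul_eq_mul]
    rw [hL, mul_assoc, mul_assoc, bump, bump, ← Real.exp_add, ← Real.exp_add, ← Real.exp_add,
      ← Real.exp_add]
    congr 2
    simp only [Prod.fst_zero, Prod.snd_zero, sub_zero]
    rw [norm_sub_sq_real, real_inner_comm]
    ring
  have hb : Measurable fun g => v g * bump 0 g := hv.mul (continuous_bump 0).measurable
  have := ae_eq_zero_of_forall_integral_mul_exp (μ := volume) hb (fun L => by
    obtain ⟨c, g₀, he⟩ := key L
    simp only [he]
    exact (hi g₀).mul_const c) (fun L => by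
    obtain ⟨c, g₀, he⟩ := key L
    simp only [he]
    rw [integral_mul_const, h, zero_mul])
  filter_upwards [this] with g hg
  have hb0 : bump 0 g ≠ 0 := by unfold bump; positivity
  exact (mul_eq_zero.1 hg).resolve_right hb0

end Grushin

/-! ### The closed formula for the kernel. -/

/-- The Gamma integral with a complex rate. -/
theorem integral_rpow_mul_cexp_neg_mul_Ioi {a : ℝ} (ha : 0 < a) {z : ℂ} (hz : 0 < z.re) :
    ∫ t in Set.Ioi (0 : ℝ), ((t ^ (a - 1) : ℝ) : ℂ) * Complex.exp (-(z * t))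
      = Real.Gamma a * z ^ (-(a : ℂ)) := by
  -- The integral is the complex moment generating function of t^{a-1} dt at -z, which provides its
  -- analyticity.
  let μ : Measure ℝ := (volume.restrict (Set.Ioi 0)).withDensity
    fun t => ENNReal.ofReal (t ^ (a - 1))
  have hm : Measurable fun t : ℝ => ENNReal.ofReal (t ^ (a - 1)) := by fun_prop
  have hint : ∀ w : ℂ, ProbabilityTheory.complexMGF id μ w
      = ∫ t in Set.Ioi (0 : ℝ), ((t ^ (a - 1) : ℝ) : ℂ) * Complex.exp (w * t) := fun w => by
    rw [ProbabilityTheory.complexMGF, integral_withDensity_eq_integral_toReal_smul hm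
      (Eventually.of_forall fun _ => ENNReal.ofReal_lt_top)]
    refine setIntegral_congr_fun measurableSet_Ioi fun t ht => ?_
    simp only [id]
    rw [ENNReal.toReal_ofReal (Real.rpow_nonneg (le_of_lt ht) _), Complex.real_smul]
  have hset : Set.Iio 0 ⊆ ProbabilityTheory.integrableExpSet id μ := fun w hw => by
    have h1 := integrableOn_rpow_mul_exp_neg_mul_rpow (p := 1) (s := a - 1) (by linarith) one_pos
      (neg_pos.2 hw)
    rw [ProbabilityTheory.integrableExpSet, Set.mem_ofPred_eq,
      integrable_withDensity_iff_integrable_smul' hm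
        (Eventually.of_forall fun _ => ENNReal.ofReal_lt_top)]
    refine IntegrableOn.congr_fun h1 (fun t ht => ?_) measurableSet_Ioi
    rw [ENNReal.toReal_ofReal (Real.rpow_nonneg (le_of_lt ht) _), smul_eq_mul, Real.rpow_one,
      neg_neg]
    rfl
  let S : Set ℂ := {w | w.re < 0}
  have hS : ∀ w ∈ S, w.re ∈ interior (ProbabilityTheory.integrableExpSet id μ) := fun w hw =>
    interior_maximal hset isOpen_Iio hw
  have hF : AnalyticOnNhd ℂ (ProbabilityTheory.complexMGF id μ) S := fun w hw =>
    ProbabilityTheory.analyticAt_complexMGF (hS w hw)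
  have hSo : IsOpen S := isOpen_lt Complex.continuous_re continuous_const
  have hG : AnalyticOnNhd ℂ (fun w => (Real.Gamma a : ℂ) * (-w) ^ (-(a : ℂ))) S := by
    refine DifferentiableOn.analyticOnNhd (fun w hw => ?_) hSo
    refine DifferentiableAt.differentiableWithinAt ?_
    refine (DifferentiableAt.cpow_const differentiableAt_id.neg ?_).const_mul _
    left
    have : w.re < 0 := hw
    simpa using this
  have hconn : IsPreconnected S := by
    have : Convex ℝ S := by
      have := (convex_Iio (0 : ℝ)).linear_preimage Complex.reLm
      exact this
    exact this.isPreconnected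
  have heq : ∀ t : ℝ, t < 0 → ProbabilityTheory.complexMGF id μ t
      = (Real.Gamma a : ℂ) * (-(t : ℂ)) ^ (-(a : ℂ)) := fun t ht => by
    have h1 := Real.integral_rpow_mul_exp_neg_mul_Ioi ha (neg_pos.2 ht)
    have h2 := congrArg (fun x : ℝ => (x : ℂ)) h1
    rw [← integral_complex_ofReal] at h2
    rw [hint]
    refine Eq.trans ?_ (h2.trans ?_)
    · refine setIntegral_congr_fun measurableSet_Ioi fun t _ => ?_
      push_cast
      congr 2
      ring
    · rw [one_div, Real.inv_rpow (by linarith), ← Real.rpow_neg (by linarith), mul_comm]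
      push_cast
      rw [Complex.ofReal_cpow (by linarith)]
      push_cast
      rfl
  -- Both sides are analytic on the left half-plane and agree on the negative real axis, which
  -- accumulates at -1.
  have key := AnalyticOnNhd.eqOn_of_preconnected_of_frequently_eq hF hG hconn
    (z₀ := ((-1 : ℝ) : ℂ)) (by simp [S]) (by
      have h_real : ∃ᶠ (x : ℝ) in 𝓝[≠] (-1), ProbabilityTheory.complexMGF id μ x
          = (Real.Gamma a : ℂ) * (-(x : ℂ)) ^ (-(a : ℂ)) := by
        refine Eventually.frequently ?_
        filter_upwards [nhdsWithin_le_nhds (Iio_mem_nhds (show (-1 : ℝ) < 0 by norm_num))] with x hx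
        exact heq x hx
      have ht : Tendsto (fun x : ℝ => (x : ℂ)) (𝓝[≠] (-1)) (𝓝[≠] ((-1 : ℝ) : ℂ)) := by
        refine tendsto_nhdsWithin_of_tendsto_nhds_of_eventually_within _
          ((Complex.continuous_ofReal.tendsto _).mono_left nhdsWithin_le_nhds) ?_
        filter_upwards [self_mem_nhdsWithin] with x hx
        simpa only [Set.mem_compl_iff, Set.mem_singleton_iff, Complex.ofReal_inj] using hx
      exact ht.frequently h_real)
  have h := key (x := -z) (by simpa [S] using hz)
  simp only [neg_neg] at h
  rw [← h, hint]
  simp only [neg_mul]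

/-- The Gamma integral with a complex rate, in the variable `1 / s`. -/
theorem integral_rpow_mul_cexp_neg_div_Ioi {a : ℝ} (ha : 0 < a) {z : ℂ} (hz : 0 < z.re) :
    ∫ s in Set.Ioi (0 : ℝ), ((s ^ (-a - 1) : ℝ) : ℂ) * Complex.exp (-(z / s))
      = Real.Gamma a * z ^ (-(a : ℂ)) := by
  rw [← integral_rpow_mul_cexp_neg_mul_Ioi ha hz, ← integral_comp_rpow_Ioi _
    (show (-1 : ℝ) ≠ 0 by norm_num)]
  refine setIntegral_congr_fun measurableSet_Ioi fun s hs => ?_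
  have hs0 : (0 : ℝ) < s := hs
  rw [Complex.real_smul, ← mul_assoc, ← Complex.ofReal_mul, ← Real.rpow_mul hs0.le, abs_neg,
    abs_one, one_mul, ← Real.rpow_add hs0, Real.rpow_neg_one, Complex.ofReal_inv, div_eq_mul_inv, inv_inv]
  congr 3
  ring

theorem ofReal_mul_cpow {r : ℝ} (hr : 0 < r) {z : ℂ} (hz : z ≠ 0) (b : ℝ) :
    ((r : ℂ) * z) ^ (b : ℂ) = ((r ^ b : ℝ) : ℂ) * z ^ (b : ℂ) := by
  have hr' : (r : ℂ) ≠ 0 := Complex.ofReal_ne_zero.2 hr.ne'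
  rw [Complex.ofReal_cpow hr.le, Complex.cpow_def_of_ne_zero (mul_ne_zero hr' hz),
    Complex.log_ofReal_mul hr hz, add_mul, Complex.exp_add, Complex.cpow_def_of_ne_zero hz,
    Complex.cpow_def_of_ne_zero hr', Complex.ofReal_log hr.le]

/-- `sinh z / z`, extended holomorphically. -/
noncomputable def csinhDiv (z : ℂ) : ℂ := dslope Complex.sinh 0 z

theorem csinhDiv_of_ne {z : ℂ} (hz : z ≠ 0) : csinhDiv z = Complex.sinh z / z := by
  rw [csinhDiv, dslope_of_ne _ hz, slope_def_field]; simp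

theorem csinhDiv_zero : csinhDiv 0 = 1 := by
  rw [csinhDiv, dslope_same, Complex.deriv_sinh, Complex.cosh_zero]

theorem csinhDiv_ofReal (x : ℝ) : csinhDiv x = sinhDiv x := by
  rcases eq_or_ne x 0 with rfl | hx
  · simp [csinhDiv_zero, sinhDiv_zero]
  · rw [sinhDiv_of_ne hx, csinhDiv_of_ne (Complex.ofReal_ne_zero.2 hx)]; push_cast; rfl

theorem differentiable_csinhDiv : Differentiable ℂ csinhDiv := by
  rw [← differentiableOn_univ]
  exact (Complex.differentiableOn_dslope univ_mem).2 Complex.differentiable_sinh.differentiableOn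

namespace Grushin

variable {n : ℕ}

/-- The exponent occurring in the Poisson kernel. -/
noncomputable def kernelExponent (n : ℕ) : ℝ := n / 2 + 3 / 2

theorem kernelExponent_pos : 0 < kernelExponent n := by unfold kernelExponent; positivity

/-- The complex squared distance along the contour. -/
noncomputable def phase (g g' : GrushinSpace n) (z : ℂ) : ℂ :=
  csinhDiv z + (sqR g g' * Complex.cosh z - (2 * inner ℝ g.1 g'.1 : ℝ)
    - 2 * Complex.I * sepS g g' * Complex.sinh z)

/-- The integrand in the closed formula for the Poisson kernel. -/
noncomputable def kernelIntegrand (g g' : GrushinSpace n) (z : ℂ) : ℂ :=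
  csinhDiv z ^ ((3 / 2 : ℝ) : ℂ) * phase g g' z ^ (-(kernelExponent n : ℂ))

theorem two_inner_le_sqR (g g' : GrushinSpace n) : 2 * inner ℝ g.1 g'.1 ≤ sqR g g' := by
  have := norm_sub_sq_real g.1 g'.1
  unfold sqR
  nlinarith [sq_nonneg ‖g.1 - g'.1‖]

theorem sqR_nonneg (g g' : GrushinSpace n) : 0 ≤ sqR g g' := by unfold sqR; positivity

theorem two_inner_le_mul_cosh (g g' : GrushinSpace n) (x : ℝ) :
    2 * inner ℝ g.1 g'.1 ≤ sqR g g' * Real.cosh x := by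
  nlinarith [two_inner_le_sqR g g', sqR_nonneg g g', Real.one_le_cosh x]

theorem phase_ofReal (g g' : GrushinSpace n) (x : ℝ) :
    phase g g' x = ((sinhDiv x + (sqR g g' * Real.cosh x - 2 * inner ℝ g.1 g'.1) : ℝ) : ℂ)
      - Complex.I * ((2 * sepS g g' * Real.sinh x : ℝ) : ℂ) := by
  rw [phase, csinhDiv_ofReal]; push_cast; ring

theorem re_phase_ofReal (g g' : GrushinSpace n) (x : ℝ) :
    (phase g g' x).re = sinhDiv x + (sqR g g' * Real.cosh x - 2 * inner ℝ g.1 g'.1) := by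
  rw [phase_ofReal, Complex.sub_re, Complex.ofReal_re, Complex.re_mul_ofReal]; simp

theorem sinhDiv_le_re_phase (g g' : GrushinSpace n) (x : ℝ) : sinhDiv x ≤ (phase g g' x).re := by
  rw [re_phase_ofReal]; linarith [two_inner_le_mul_cosh g g' x]

theorem kernelIntegrand_ofReal (g g' : GrushinSpace n) (x : ℝ) : kernelIntegrand g g' x
    = ((sinhDiv x ^ (3 / 2 : ℝ) : ℝ) : ℂ) * phase g g' x ^ (-(kernelExponent n : ℂ)) := by
  rw [kernelIntegrand, csinhDiv_ofReal, Complex.ofReal_cpow (sinhDiv_pos x).le]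

/-- The integrand of the Poisson kernel in rescaled frequencies. -/
noncomputable def timeKernel (g g' : GrushinSpace n) (s x : ℝ) : ℝ :=
  (2 * Real.pi)⁻¹ * timeWeight n s * sinhDiv x ^ (-(n : ℝ) / 2)
    * (Real.exp (-((sqR g g' * Real.cosh x - 2 * inner ℝ g.1 g'.1) / (4 * s * sinhDiv x)))
      * Real.cos (x * sepS g g' / (2 * s)))

theorem freqTimeKernel_eq (g g' : GrushinSpace n) {s x : ℝ} (hs : 0 < s) (hx : x ≠ 0) :
    freqTimeKernel (x / (2 * s), s) g g' = (2 * s) * timeKernel g g' s x := by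
  have hl : x / (2 * s) ≠ 0 := div_ne_zero hx (by positivity)
  have e : 2 * (x / (2 * s)) * s = x := by field_simp
  have hS : mS (x / (2 * s)) s = s * sinhDiv x := by rw [mS_eq hl hs.ne', e]
  have hC : mC (x / (2 * s)) s = Real.cosh x := by rw [mC, e]
  have hcos : Real.cos (x / (2 * s) * (g.2 - g'.2)) = Real.cos (x * sepS g g' / (2 * s)) := by
    rw [sepS, ← Real.cos_abs, abs_mul, ← Real.cos_abs (x * _ / _), abs_div x, abs_div (x * _),
      abs_mul x, abs_abs]
    congr 1; ring
  rw [freqTimeKernel, mehler, hS, hC, hcos, ← mul_assoc (4 * Real.pi),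
    Real.mul_rpow (by positivity) (sinhDiv_pos x).le, timeKernel, timeWeight, ← mul_assoc 4 s, sqR,
    mul_comm (Real.cosh x)]
  field_simp

theorem integral_freqTimeKernel_freq (g g' : GrushinSpace n) {s : ℝ} (hs : 0 < s) :
    ∫ l, freqTimeKernel (l, s) g g' = ∫ x, timeKernel g g' s x := by
  have h := Measure.integral_comp_div (fun l => freqTimeKernel (l, s) g g') (2 * s)
  rw [abs_of_pos (by positivity), smul_eq_mul] at h
  have h2 : ∫ x, freqTimeKernel (x / (2 * s), s) g g' = ∫ x, (2 * s) * timeKernel g g' s x := by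
    refine integral_congr_ae ?_
    filter_upwards [Measure.ae_ne volume (0 : ℝ)] with x hx using freqTimeKernel_eq g g' hs hx
  rw [h, integral_const_mul] at h2
  exact mul_left_cancel₀ (by positivity) h2

theorem integrable_timeKernel (hn : 2 ≤ n) (g g' : GrushinSpace n) :
    Integrable (fun p : ℝ × ℝ => timeKernel g g' p.1 p.2)
      ((volume.restrict (Set.Ioi 0)).prod volume) := by
  have hh : Integrable fun x : ℝ => sinhDiv x ^ (-(n : ℝ) / 2) := by
    have h2 : (2 : ℝ) ≤ n := by exact_mod_cast hn
    simpa only [neg_div] using integrable_sinhDiv_rpow (p := (n : ℝ) / 2) (by linarith)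
  have h1 : IntegrableOn (timeWeight n) (Set.Ioi 0) := integrableOn_timeWeight
  refine (h1.mul_prod hh).mono' ?_ ?_
  · have m1 := measurable_subordinator
    have m2 := continuous_sinhDiv.measurable
    have m3 := Real.continuous_cosh.measurable
    refine Measurable.aestronglyMeasurable ?_
    unfold timeKernel timeWeight
    fun_prop
  · have h2 : ∀ᵐ p : ℝ × ℝ ∂((volume.restrict (Set.Ioi 0)).prod volume), p.1 ∈ Set.Ioi (0 : ℝ) :=
      Measure.quasiMeasurePreserving_fst.ae (ae_restrict_mem measurableSet_Ioi)
    filter_upwards [h2] with p hp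
    have hp0 : (0 : ℝ) < p.1 := hp
    have b1 := timeWeight_nonneg (n := n) hp0
    have b2 := sinhDiv_pos p.2
    have hpi : (2 * Real.pi)⁻¹ ≤ 1 := inv_le_one_of_one_le₀ (by linarith [Real.pi_gt_three])
    have b3 : Real.exp (-((sqR g g' * Real.cosh p.2 - 2 * inner ℝ g.1 g'.1) / (4 * p.1 * sinhDiv p.2)))
        ≤ 1 := by
      rw [Real.exp_le_one_iff, neg_nonpos]
      exact div_nonneg (sub_nonneg.2 (two_inner_le_mul_cosh g g' p.2)) (by positivity)
    rw [timeKernel, norm_mul, norm_mul (Real.exp _), Real.norm_of_nonneg (show 0 ≤ (2 * Real.pi)⁻¹ * timeWeight n p.1 * sinhDiv p.2 ^ (-(n : ℝ) / 2) by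
        positivity),
      Real.norm_of_nonneg (Real.exp_pos _).le]
    calc _ ≤ 1 * timeWeight n p.1 * sinhDiv p.2 ^ (-(n : ℝ) / 2) * (1 * 1) := by
          gcongr; exact Real.abs_cos_le_one _
      _ = _ := by ring

/-- The subordinator, the Mehler exponential and the cosine combine into Re exp(-A/s) with Re A > 0,
and `phase` is 4hA with h = `sinhDiv x`; the integral in s is then a Gamma integral with complex
rate. -/
theorem integral_timeKernel (g g' : GrushinSpace n) (x : ℝ) :
    ∫ s in Set.Ioi 0, timeKernel g g' s x
      = Real.Gamma (kernelExponent n) / Real.pi ^ kernelExponent n * (kernelIntegrand g g' x).re := by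
  have hh := sinhDiv_pos x
  set h := sinhDiv x with hdef
  set E := sqR g g' * Real.cosh x - 2 * inner ℝ g.1 g'.1 with hE
  have hE0 : 0 ≤ E := sub_nonneg.2 (two_inner_le_mul_cosh g g' x)
  set a := kernelExponent n with ha
  have ha0 : 0 < a := kernelExponent_pos
  set A : ℂ := (((1 + E / h) / 4 : ℝ) : ℂ) - Complex.I * ((x * sepS g g' / 2 : ℝ) : ℂ) with hA
  have hAre : A.re = (1 + E / h) / 4 := by
    rw [hA, Complex.sub_re, Complex.ofReal_re, Complex.re_mul_ofReal]; simp
  have hApos : 0 < A.re := by rw [hAre]; positivity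
  have hphase : phase g g' x = ((4 * h : ℝ) : ℂ) * A := by
    have hm := mul_sinhDiv x
    rw [phase_ofReal, hA, ← hE, ← hdef, mul_sub, ← Complex.ofReal_mul, mul_left_comm,
      ← Complex.ofReal_mul, ← hm, ← hdef]
    congr 2
    · field_simp
    · congr 1; ring
  have hA0 : A ≠ 0 := fun h0 => by rw [h0] at hApos; simp at hApos
  have hG := integral_rpow_mul_cexp_neg_div_Ioi ha0 hApos
  have hGre := congrArg Complex.re hG
  have hi : IntegrableOn (fun s : ℝ => ((s ^ (-a - 1) : ℝ) : ℂ) * Complex.exp (-(A / s))) (Set.Ioi 0) := by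
    -- A non-integrable function would have integral 0, while the Gamma value is nonzero.
    by_contra hc
    rw [integral_undef hc] at hG
    refine mul_ne_zero (Complex.ofReal_ne_zero.2 (Real.Gamma_pos_of_pos ha0).ne') ?_ hG.symm
    rw [Complex.cpow_def_of_ne_zero hA0]
    exact Complex.exp_ne_zero _
  rw [← RCLike.re_eq_complex_re, ← integral_re hi] at hGre
  have e1 : ∀ s : ℝ, 0 < s → RCLike.re (((s ^ (-a - 1) : ℝ) : ℂ) * Complex.exp (-(A / s)))
      = s ^ (-a - 1) * Real.exp (-((1 / 4) / s)) * (Real.exp (-(E / (4 * s * h)))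
        * Real.cos (x * sepS g g' / (2 * s))) := fun s hs => by
    rw [RCLike.re_eq_complex_re, Complex.re_ofReal_mul, Complex.exp_re, mul_assoc, ← mul_assoc
      (Real.exp _) (Real.exp _), ← Real.exp_add]
    have q1 : (-(A / (s : ℂ))).re = -(1 / 4 / s) + -(E / (4 * s * h)) := by
      rw [Complex.neg_re, Complex.div_ofReal_re, hAre]
      field_simp
      ring
    have q2 : (-(A / (s : ℂ))).im = x * sepS g g' / (2 * s) := by
      rw [Complex.neg_im, Complex.div_ofReal_im, hA, Complex.sub_im, Complex.ofReal_im,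
        Complex.im_mul_ofReal]
      simp only [Complex.I_im, one_mul, zero_sub]
      field_simp
    rw [q1, q2]
  set c := (2 * Real.pi)⁻¹ * ((√(4 * Real.pi))⁻¹ * (4 * Real.pi) ^ (-(n : ℝ) / 2) / 2)
    * h ^ (-(n : ℝ) / 2) with hc
  have e2 : ∫ s in Set.Ioi 0, timeKernel g g' s x
      = c * ∫ s in Set.Ioi (0 : ℝ), RCLike.re (((s ^ (-a - 1) : ℝ) : ℂ) * Complex.exp (-(A / s))) := by
    rw [← integral_const_mul]
    refine setIntegral_congr_fun measurableSet_Ioi fun s hs => ?_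
    rw [e1 s hs, timeKernel, timeWeight_eq hs, ← hE, ← hdef, hc, ha, kernelExponent]
    ring
  rw [e2, hGre, RCLike.re_eq_complex_re, Complex.re_ofReal_mul, kernelIntegrand_ofReal,
    Complex.re_ofReal_mul, hphase, ← ha, ← Complex.ofReal_neg, ofReal_mul_cpow (by positivity) hA0,
    Complex.re_ofReal_mul, ← hdef]
  have e3 : c = h ^ (3 / 2 : ℝ) * (4 * h) ^ (-a) / Real.pi ^ a := by
    have p4 : (4 * Real.pi) ^ (-(n : ℝ) / 2) = 4 ^ (-(n : ℝ) / 2) * Real.pi ^ (-(n : ℝ) / 2) :=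
      Real.mul_rpow (by norm_num) Real.pi_pos.le
    have p5 : (4 * h) ^ (-a) = 4 ^ (-a) * h ^ (-a) := Real.mul_rpow (by norm_num) hh.le
    have p6 : h ^ (3 / 2 : ℝ) * h ^ (-a) = h ^ (-(n : ℝ) / 2) := by
      rw [← Real.rpow_add hh, ha, kernelExponent]; congr 1; ring
    have p7 : (4 : ℝ) ^ (-a) = 4 ^ (-(n : ℝ) / 2) / 8 := by
      rw [ha, kernelExponent, show -((n : ℝ) / 2 + 3 / 2) = -(n : ℝ) / 2 - 3 / 2 by ring,
        Real.rpow_sub (by norm_num)]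
      congr 1
      rw [show (4 : ℝ) = 2 ^ (2 : ℝ) by norm_num, ← Real.rpow_mul (by norm_num)]
      norm_num
    have p8 : Real.pi ^ a = Real.pi ^ ((n : ℝ) / 2) * (Real.pi * √Real.pi) := by
      rw [ha, kernelExponent, Real.rpow_add Real.pi_pos, Real.sqrt_eq_rpow]
      congr 1
      nth_rewrite 2 [← Real.rpow_one Real.pi]
      rw [← Real.rpow_add Real.pi_pos]; norm_num
    have p9 : √(4 * Real.pi) = 2 * √Real.pi := by
      rw [Real.sqrt_mul (by norm_num), show (4 : ℝ) = 2 ^ 2 by norm_num, Real.sqrt_sq (by norm_num)]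
    rw [p5, mul_left_comm, p6, p7, p8, hc, p9, p4, neg_div, Real.rpow_neg Real.pi_pos.le]
    have := Real.sqrt_pos.2 Real.pi_pos
    field_simp
    norm_num
  rw [e3]
  ring

/-- The closed formula for the Poisson kernel. -/
noncomputable def poissonKernel (g g' : GrushinSpace n) : ℝ :=
  Real.Gamma (kernelExponent n) / Real.pi ^ kernelExponent n
    * ∫ x : ℝ, (kernelIntegrand g g' x).re

theorem kernelPre_eq (hn : 2 ≤ n) (g g' : GrushinSpace n) : kernelPre g g' = poissonKernel g g' := by
  have hI := integrable_freqTimeKernel hn g g'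
  rw [freqTime] at hI
  rw [kernelPre, freqTime, integral_prod_symm _ hI]
  calc _ = ∫ s in Set.Ioi 0, ∫ x, timeKernel g g' s x :=
        setIntegral_congr_fun measurableSet_Ioi fun s hs => integral_freqTimeKernel_freq g g' hs
    _ = ∫ x, ∫ s in Set.Ioi 0, timeKernel g g' s x :=
        integral_integral_swap (integrable_timeKernel hn g g')
    _ = _ := by
        simp only [integral_timeKernel]
        rw [integral_const_mul, poissonKernel]

end Grushin

/-! ### Continuity of the closed formula, and existence and uniqueness of the kernel. -/

namespace Grushin

variable {n : ℕ}

/-- The modulus of `phase` is at least its real part, hence at least `sinhDiv x`, and 3/2 - (n/2 +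
3/2) = -n/2. The majorant does not involve g or g', which gives continuity and boundedness of the
kernel. -/
theorem norm_kernelIntegrand_ofReal_le (g g' : GrushinSpace n) (x : ℝ) :
    ‖kernelIntegrand g g' x‖ ≤ sinhDiv x ^ (-(n : ℝ) / 2) := by
  have hh := sinhDiv_pos x
  have h1 : sinhDiv x ≤ ‖phase g g' x‖ :=
    (sinhDiv_le_re_phase g g' x).trans (Complex.re_le_norm _)
  rw [kernelIntegrand_ofReal, norm_mul, Complex.norm_real, ← Complex.ofReal_neg,
    Complex.norm_cpow_real, Real.norm_of_nonneg (by positivity)]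
  calc _ ≤ sinhDiv x ^ (3 / 2 : ℝ) * sinhDiv x ^ (-kernelExponent n) := by
        gcongr ?_ * ?_
        exact Real.rpow_le_rpow_of_nonpos hh h1 (neg_nonpos.2 kernelExponent_pos.le)
    _ = _ := by
        rw [← Real.rpow_add hh, kernelExponent]; congr 1; ring

theorem phase_ofReal_mem_slitPlane (g g' : GrushinSpace n) (x : ℝ) :
    phase g g' x ∈ Complex.slitPlane :=
  Or.inl ((sinhDiv_pos x).trans_le (sinhDiv_le_re_phase g g' x))

theorem continuous_kernelIntegrand (g g' : GrushinSpace n) :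
    Continuous fun x : ℝ => kernelIntegrand g g' x := by
  have h1 : Continuous fun x : ℝ => ((sinhDiv x ^ (3 / 2 : ℝ) : ℝ) : ℂ) :=
    Complex.continuous_ofReal.comp (continuous_sinhDiv.rpow_const fun x => Or.inl (sinhDiv_pos x).ne')
  have h2 : Continuous fun x : ℝ => phase g g' x := by
    have := differentiable_csinhDiv.continuous
    unfold phase; fun_prop
  have h3 : Continuous fun x : ℝ => phase g g' x ^ (-(kernelExponent n : ℂ)) :=
    h2.cpow continuous_const (phase_ofReal_mem_slitPlane g g')
  simp only [kernelIntegrand_ofReal]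
  exact h1.mul h3

theorem integrable_sinhDiv_rpow_half (hn : 2 ≤ n) :
    Integrable fun x : ℝ => sinhDiv x ^ (-(n : ℝ) / 2) := by
  have h2 : (2 : ℝ) ≤ n := by exact_mod_cast hn
  simpa only [neg_div] using integrable_sinhDiv_rpow (p := (n : ℝ) / 2) (by linarith)

theorem integrable_kernelIntegrand (hn : 2 ≤ n) (g g' : GrushinSpace n) :
    Integrable fun x : ℝ => kernelIntegrand g g' x :=
  (integrable_sinhDiv_rpow_half hn).mono' (continuous_kernelIntegrand g g').aestronglyMeasurable
    (Eventually.of_forall (norm_kernelIntegrand_ofReal_le g g'))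

theorem continuous_poissonKernel (hn : 2 ≤ n) :
    Continuous (Function.uncurry (poissonKernel (n := n))) := by
  refine Continuous.mul continuous_const ?_
  refine continuous_of_dominated (fun q => ?_) (fun q => Eventually.of_forall fun x => ?_)
    (integrable_sinhDiv_rpow_half hn) (Eventually.of_forall fun x => ?_)
  · exact (Complex.continuous_re.comp (continuous_kernelIntegrand q.1 q.2)).aestronglyMeasurable
  · exact (Complex.abs_re_le_norm _).trans (norm_kernelIntegrand_ofReal_le q.1 q.2 x)
  · have h2 : Continuous fun q : GrushinSpace n × GrushinSpace n => phase q.1 q.2 x := by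
      unfold phase sqR sepS; fun_prop
    have h3 : Continuous fun q : GrushinSpace n × GrushinSpace n =>
        phase q.1 q.2 x ^ (-(kernelExponent n : ℂ)) :=
      h2.cpow continuous_const fun q => phase_ofReal_mem_slitPlane q.1 q.2 x
    exact Complex.continuous_re.comp (continuous_const.mul h3)

theorem exists_abs_poissonKernel_le (hn : 2 ≤ n) :
    ∃ C, ∀ g g' : GrushinSpace n, |poissonKernel g g'| ≤ C := by
  refine ⟨Real.Gamma (kernelExponent n) / Real.pi ^ kernelExponent n
    * ∫ x, sinhDiv x ^ (-(n : ℝ) / 2), fun g g' => ?_⟩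
  have hG := Real.Gamma_pos_of_pos (kernelExponent_pos (n := n))
  rw [poissonKernel, abs_mul, abs_of_nonneg (by positivity)]
  gcongr
  rw [← Real.norm_eq_abs]
  exact norm_integral_le_of_norm_le (integrable_sinhDiv_rpow_half hn)
    (Eventually.of_forall fun x =>
      (Complex.abs_re_le_norm _).trans (norm_kernelIntegrand_ofReal_le g g' x))

/-- Needed because `integral_freqTime_eq` places the test function in the first variable, while an
integral operator integrates over the second. -/
theorem poissonKernel_comm (g g' : GrushinSpace n) : poissonKernel g g' = poissonKernel g' g := by
  have h1 : sqR g g' = sqR g' g := add_comm _ _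
  have h2 : sepS g g' = sepS g' g := abs_sub_comm _ _
  simp only [poissonKernel, kernelIntegrand, phase, h1, h2, real_inner_comm]

theorem continuous_integral_mul_test {P : GrushinSpace n → GrushinSpace n → ℝ}
    (hP : Continuous (Function.uncurry P)) {φ : GrushinSpace n → ℝ} (hφ : IsTestFunction φ) :
    Continuous fun g => ∫ g', P g g' * φ g' := by
  have h1 : Continuous (Function.uncurry fun g g' => P g g' * φ g') :=
    hP.mul (hφ.1.continuous.comp continuous_snd)
  have h2 := continuous_parametric_integral_of_continuous (μ := volume) h1 hφ.2
  refine h2.congr fun g => ?_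
  refine setIntegral_eq_integral_of_forall_compl_eq_zero fun g' hg' => ?_
  rw [image_eq_zero_of_notMem_tsupport hg', mul_zero]

/-- The operator `T 1` of any Poisson semigroup is given by the closed formula. -/
theorem IsPoissonSemigroup.apply_one_ae_eq (hn : 12 ≤ n) {T : ℝ → LTwo n →L[ℝ] LTwo n}
    (hT : IsPoissonSemigroup n T) (φ : testSpace n) :
    T 1 (testClass n φ) =ᵐ[volume] fun g => ∫ g', poissonKernel g g' * φ.1 g' := by
  have hn2 : 2 ≤ n := by omega
  set f := T 1 (testClass n φ)
  set Y : GrushinSpace n → ℝ := fun g => ∫ g', poissonKernel g g' * φ.1 g' with hY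
  have hYc : Continuous Y := continuous_integral_mul_test (continuous_poissonKernel hn2) φ.2
  have hφ : Integrable φ.1 := IsTestFunction.integrable φ.2
  obtain ⟨C, hC⟩ := exists_abs_poissonKernel_le (n := n) hn2
  have hYb : ∀ g, ‖Y g‖ ≤ ∫ g', C * |φ.1 g'| := fun g => by
    refine norm_integral_le_of_norm_le (hφ.abs.const_mul C) (Eventually.of_forall fun g' => ?_)
    rw [norm_mul]
    exact mul_le_mul_of_nonneg_right (hC g g') (abs_nonneg _)
  have hYi : ∀ g₀, Integrable fun g => Y g * bump g₀ g := fun g₀ =>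
    (integrable_bump g₀).bdd_mul hYc.aestronglyMeasurable (Eventually.of_forall hYb)
  have key := ae_eq_zero_of_forall_integral_mul_bump (v := fun g => f g - Y g)
    ((Lp.stronglyMeasurable f).measurable.sub hYc.measurable)
    (fun g₀ => ((integrable_mul_bump f g₀).sub (hYi g₀)).congr
      (Eventually.of_forall fun g => (sub_mul _ _ _).symm))
    (fun g₀ => by
      simp only [sub_mul]
      rw [integral_sub (integrable_mul_bump f g₀) (hYi g₀), hT.integral_mul_bump hn φ g₀,
        integral_freqTime_eq hn2 hφ g₀, sub_eq_zero]
      refine integral_congr_ae (Eventually.of_forall fun g' => ?_)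
      simp only [hY]
      congr 1
      refine integral_congr_ae (Eventually.of_forall fun g => ?_)
      simp only
      rw [kernelPre_eq hn2, poissonKernel_comm, mul_comm])
  filter_upwards [key] with g hg
  exact sub_eq_zero.1 hg

theorem isPoissonKernel_poissonKernel (hn : 12 ≤ n) :
    IsPoissonKernel n 1 (poissonKernel (n := n)) := by
  obtain ⟨T, hT⟩ := exists_isPoissonSemigroup n
  refine ⟨T, hT, continuous_poissonKernel (by omega), fun φ hφ f hf => ?_⟩
  rw [eq_testClass_of_ae_eq ⟨φ, hφ⟩ hf]
  exact hT.apply_one_ae_eq hn ⟨φ, hφ⟩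

theorem eq_of_forall_integral_mul_eq {K K' : GrushinSpace n → ℝ} (c1 : Continuous K)
    (c2 : Continuous K') (h : ∀ φ : GrushinSpace n → ℝ, IsTestFunction φ →
      ∫ g, K g * φ g = ∫ g, K' g * φ g) : K = K' := by
  have hz : ∀ᵐ g : GrushinSpace n ∂volume, K g - K' g = 0 := by
    refine ae_eq_zero_of_integral_contDiff_smul_eq_zero (c1.sub c2).locallyIntegrable
      fun φ h1 h2 => ?_
    have i1 : Integrable fun g' => K g' * φ g' :=
      (c1.mul h1.continuous).integrable_of_hasCompactSupport h2.mul_left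
    have i2 : Integrable fun g' => K' g' * φ g' :=
      (c2.mul h1.continuous).integrable_of_hasCompactSupport h2.mul_left
    have := h φ ⟨h1, h2⟩
    rw [← sub_eq_zero, ← integral_sub i1 i2] at this
    rw [← this]
    refine integral_congr_ae (Eventually.of_forall fun g' => ?_)
    simp only [smul_eq_mul]; ring
  refine (Continuous.ae_eq_iff_eq (volume : Measure (GrushinSpace n)) c1 c2).1 ?_
  filter_upwards [hz] with x hx using sub_eq_zero.1 hx

theorem IsIntegralKernel.integral_eq (hn : 12 ≤ n) {T : ℝ → LTwo n →L[ℝ] LTwo n}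
    (hT : IsPoissonSemigroup n T) {P : GrushinSpace n → GrushinSpace n → ℝ}
    (hP : IsIntegralKernel (T 1) P) (φ : testSpace n) (g : GrushinSpace n) :
    ∫ g', P g g' * φ.1 g' = ∫ g', poissonKernel g g' * φ.1 g' := by
  have h1 : T 1 (testClass n φ) =ᵐ[volume] fun g => ∫ g', P g g' * φ.1 g' :=
    hP.2 φ.1 φ.2 (testClass n φ) (IsTestFunction.memLp φ.2).coeFn_toLp
  have h2 := hT.apply_one_ae_eq hn φ
  have h3 : (fun g => ∫ g', P g g' * φ.1 g') =ᵐ[volume]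
      fun g => ∫ g', poissonKernel g g' * φ.1 g' := h1.symm.trans h2
  have c1 := continuous_integral_mul_test hP.1 φ.2
  have c2 := continuous_integral_mul_test (continuous_poissonKernel (n := n) (by omega)) φ.2
  exact congrFun ((Continuous.ae_eq_iff_eq volume c1 c2).1 h3) g

/-- The closed formula holds for every Poisson semigroup, so the kernel cannot depend on which one
is chosen. -/
theorem IsIntegralKernel.eq_poissonKernel (hn : 12 ≤ n) {T : ℝ → LTwo n →L[ℝ] LTwo n}
    (hT : IsPoissonSemigroup n T) {P : GrushinSpace n → GrushinSpace n → ℝ}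
    (hP : IsIntegralKernel (T 1) P) : P = poissonKernel (n := n) := by
  funext g
  have c1 : Continuous (P g) := hP.1.uncurry_left g
  have c2 : Continuous (poissonKernel g) :=
    (continuous_poissonKernel (n := n) (by omega)).uncurry_left g
  have h : ∀ φ : GrushinSpace n → ℝ, IsTestFunction φ →
      ∫ g', P g g' * φ g' = ∫ g', poissonKernel g g' * φ g' := fun φ hφ =>
    hP.integral_eq hn hT ⟨φ, hφ⟩ g
  exact eq_of_forall_integral_mul_eq c1 c2 h

theorem IsPoissonKernel.eq_poissonKernel (hn : 12 ≤ n) {P : GrushinSpace n → GrushinSpace n → ℝ}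
    (hP : IsPoissonKernel n 1 P) : P = poissonKernel (n := n) :=
  Exists.elim hP fun _ hT => IsIntegralKernel.eq_poissonKernel hn hT.1 hT.2

theorem existsUnique_isPoissonKernel (hn : 12 ≤ n) :
    ∃! P : GrushinSpace n → GrushinSpace n → ℝ, IsPoissonKernel n 1 P :=
  ⟨poissonKernel, isPoissonKernel_poissonKernel hn, fun _ hP => hP.eq_poissonKernel hn⟩

end Grushin

/-! ### Integrals of powers of 1 + v². -/

theorem integrable_one_add_sq_rpow {p : ℝ} (hp : 1 / 2 < p) :
    Integrable fun v : ℝ => (1 + v ^ 2) ^ (-p) := by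
  have := integrable_rpow_neg_one_add_norm_sq (E := ℝ) (μ := volume) (r := 2 * p)
    (by simp; linarith)
  refine this.congr (Eventually.of_forall fun v => ?_)
  simp only [Real.norm_eq_abs, sq_abs]
  congr 1; ring

/-- Γ(p)(1 + v²)^{-p} is a Gamma integral in t with rate 1 + v²; after exchanging the integrals, the
Gaussian in v leaves Γ(p - 1/2). -/
theorem integral_one_add_sq_rpow {p : ℝ} (hp : 1 / 2 < p) :
    ∫ v : ℝ, (1 + v ^ 2) ^ (-p) = √Real.pi * Real.Gamma (p - 1 / 2) / Real.Gamma p := by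
  have hp0 : 0 < p := by linarith
  have hΓ := Real.Gamma_pos_of_pos hp0
  have hin : ∀ v : ℝ, ∫ t in Set.Ioi (0 : ℝ), t ^ (p - 1) * Real.exp (-((1 + v ^ 2) * t))
      = (1 + v ^ 2) ^ (-p) * Real.Gamma p := fun v => by
    rw [Real.integral_rpow_mul_exp_neg_mul_Ioi hp0 (by positivity), one_div,
      Real.inv_rpow (by positivity), Real.rpow_neg (by positivity)]
  have hii : ∀ v : ℝ, IntegrableOn (fun t : ℝ => t ^ (p - 1) * Real.exp (-((1 + v ^ 2) * t)))
      (Set.Ioi 0) := fun v => by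
    have := integrableOn_rpow_mul_exp_neg_mul_rpow (p := 1) (s := p - 1) (b := 1 + v ^ 2)
      (by linarith) one_pos (by positivity)
    simpa only [Real.rpow_one, neg_mul] using this
  have hprod : Integrable (fun q : ℝ × ℝ => q.2 ^ (p - 1) * Real.exp (-((1 + q.1 ^ 2) * q.2)))
      (volume.prod (volume.restrict (Set.Ioi 0))) := by
    rw [integrable_prod_iff (Measurable.aestronglyMeasurable (by fun_prop))]
    refine ⟨Eventually.of_forall hii, ?_⟩
    refine ((integrable_one_add_sq_rpow hp).mul_const (Real.Gamma p)).congr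
      (Eventually.of_forall fun v => ?_)
    simp only
    rw [← hin]
    refine setIntegral_congr_fun measurableSet_Ioi fun t ht => ?_
    have ht0 : (0 : ℝ) < t := ht
    exact (Real.norm_of_nonneg (by positivity)).symm
  have hswap := integral_integral_swap
    (f := fun v t : ℝ => t ^ (p - 1) * Real.exp (-((1 + v ^ 2) * t))) hprod
  simp only [hin] at hswap
  rw [integral_mul_const] at hswap
  rw [eq_div_iff hΓ.ne', hswap]
  have h2 := Real.integral_rpow_mul_exp_neg_mul_Ioi (a := p - 1 / 2) (r := 1) (by linarith) one_pos
  simp only [one_div, inv_one, Real.one_rpow, one_mul] at h2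
  rw [one_div, ← h2, ← integral_const_mul]
  refine setIntegral_congr_fun measurableSet_Ioi fun t ht => ?_
  have ht0 : (0 : ℝ) < t := ht
  have hg := integral_gaussian t
  have e : ∀ v : ℝ, t ^ (p - 1) * Real.exp (-((1 + v ^ 2) * t))
      = t ^ (p - 1) * Real.exp (-t) * Real.exp (-t * v ^ 2) := fun v => by
    rw [mul_assoc, ← Real.exp_add]; congr 2; ring
  simp only [e]
  rw [integral_const_mul, hg, Real.sqrt_div' _ ht0.le, show p - 2⁻¹ - 1 = p - 1 - 1 / 2 by ring,
    Real.rpow_sub ht0 (p - 1), ← Real.sqrt_eq_rpow]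
  ring

theorem integral_one_add_sq_rpow_pos {p : ℝ} (hp : 1 / 2 < p) :
    0 < ∫ v : ℝ, (1 + v ^ 2) ^ (-p) := by
  have h1 := Real.Gamma_pos_of_pos (show 0 < p by linarith)
  have h2 := Real.Gamma_pos_of_pos (show 0 < p - 1 / 2 by linarith)
  rw [integral_one_add_sq_rpow hp]; positivity

theorem integral_one_add_sq_rpow_recurrence {p : ℝ} (hp : 1 / 2 < p) :
    (p - 1 / 2) * ∫ v : ℝ, (1 + v ^ 2) ^ (-p) = p * ∫ v : ℝ, (1 + v ^ 2) ^ (-(p + 1)) := by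
  have h0 : 0 < p := by linarith
  have h1 := Real.Gamma_pos_of_pos h0
  rw [integral_one_add_sq_rpow hp, integral_one_add_sq_rpow (by linarith : 1 / 2 < p + 1),
    Real.Gamma_add_one h0.ne', show p + 1 - 1 / 2 = (p - 1 / 2) + 1 by ring,
    Real.Gamma_add_one (by linarith)]
  field_simp

theorem integral_sq_mul_one_add_sq_rpow {p : ℝ} (hp : 1 / 2 < p) :
    Integrable (fun v : ℝ => v ^ 2 * (1 + v ^ 2) ^ (-(p + 1))) ∧
    ∫ v : ℝ, v ^ 2 * (1 + v ^ 2) ^ (-(p + 1))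
      = 1 / 2 / p * ∫ v : ℝ, (1 + v ^ 2) ^ (-p) := by
  have e : ∀ v : ℝ, v ^ 2 * (1 + v ^ 2) ^ (-(p + 1))
      = (1 + v ^ 2) ^ (-p) - (1 + v ^ 2) ^ (-(p + 1)) := fun v => by
    have hv : (0 : ℝ) < 1 + v ^ 2 := by positivity
    have : (1 + v ^ 2) ^ (-p) = (1 + v ^ 2) * (1 + v ^ 2) ^ (-(p + 1)) := by
      conv_rhs => rw [← Real.rpow_one_add' hv.le (by linarith)]
      congr 1; ring
    rw [this]; ring
  have i1 := integrable_one_add_sq_rpow hp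
  have i2 := integrable_one_add_sq_rpow (show 1 / 2 < p + 1 by linarith)
  simp only [e]
  refine ⟨i1.sub i2, ?_⟩
  rw [integral_sub i1 i2]
  have := integral_one_add_sq_rpow_recurrence hp
  have h0 : 0 < p := by linarith
  field_simp
  linarith

theorem integral_one_add_sq_rpow_eq_beta {p : ℝ} (hp : 1 / 2 < p) :
    ∫ v : ℝ, (1 + v ^ 2) ^ (-p) = ProbabilityTheory.beta (p - 1 / 2) (1 / 2) := by
  rw [integral_one_add_sq_rpow hp, ProbabilityTheory.beta, Real.Gamma_one_half_eq,
    sub_add_cancel, mul_comm]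

/-- Arithmetic-geometric mean: |v| ≤ (k v² + 1/k)/2, and the second moment gains 1/p. The free
parameter k is later √n, making both terms of order n^{-1/2}. -/
theorem integral_abs_mul_one_add_sq_rpow_le {p k : ℝ} (hp : 1 / 2 < p) (hk : 0 < k) :
    Integrable (fun v : ℝ => |v| * (1 + v ^ 2) ^ (-(p + 1))) ∧
    ∫ v : ℝ, |v| * (1 + v ^ 2) ^ (-(p + 1))
      ≤ (k / p + 1 / k) / 2 * ∫ v : ℝ, (1 + v ^ 2) ^ (-p) := by
  obtain ⟨i1, e1⟩ := integral_sq_mul_one_add_sq_rpow hp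
  have i2 := integrable_one_add_sq_rpow (show 1 / 2 < p + 1 by linarith)
  have h0 : 0 < p := by linarith
  have hle : ∀ v : ℝ, |v| * (1 + v ^ 2) ^ (-(p + 1))
      ≤ k / 2 * (v ^ 2 * (1 + v ^ 2) ^ (-(p + 1))) + 1 / k / 2 * (1 + v ^ 2) ^ (-(p + 1)) := fun v => by
    have h1 : |v| ≤ k / 2 * v ^ 2 + 1 / k / 2 := by
      rw [← sub_nonneg]
      have : k / 2 * v ^ 2 + 1 / k / 2 - |v| = (k * |v| - 1) ^ 2 / (2 * k) := by
        rw [← sq_abs v]; field_simp; ring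
      rw [this]; positivity
    have h2 : (0 : ℝ) ≤ (1 + v ^ 2) ^ (-(p + 1)) := by positivity
    nlinarith
  have i3 := (i1.const_mul (k / 2)).add (i2.const_mul (1 / k / 2))
  have i4 : Integrable (fun v : ℝ => |v| * (1 + v ^ 2) ^ (-(p + 1))) := by
    refine i3.mono' (Measurable.aestronglyMeasurable (by fun_prop))
      (Eventually.of_forall fun v => ?_)
    rw [Real.norm_of_nonneg (by positivity)]
    exact hle v
  refine ⟨i4, (integral_mono i4 i3 hle).trans ?_⟩
  have hm := integral_one_add_sq_rpow_pos hp
  have hrec := integral_one_add_sq_rpow_recurrence hp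
  simp only [Pi.add_apply]
  rw [integral_add (i1.const_mul _) (i2.const_mul _), integral_const_mul, integral_const_mul, e1]
  have h3 : ∫ v : ℝ, (1 + v ^ 2) ^ (-(p + 1)) ≤ ∫ v : ℝ, (1 + v ^ 2) ^ (-p) := by
    refine integral_mono i2 (integrable_one_add_sq_rpow hp) fun v => ?_
    exact Real.rpow_le_rpow_of_exponent_le (by nlinarith [sq_nonneg v]) (by linarith)
  set m := ∫ v : ℝ, (1 + v ^ 2) ^ (-p)
  calc _ ≤ k / 2 * (1 / 2 / p * m) + 1 / k / 2 * m := by gcongr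
    _ = (k / p / 2 + 1 / k) / 2 * m := by ring
    _ ≤ _ := by
      have h4 : 0 ≤ k / p := by positivity
      exact mul_le_mul_of_nonneg_right (by linarith) hm.le

/-! ### The function sinh z / z in the strip 0 ≤ Im z ≤ π/2. -/

theorem norm_ccosh_le (z : ℂ) : ‖Complex.cosh z‖ ≤ Real.cosh z.re := by
  rw [Complex.cosh, Real.cosh_eq, norm_div, Complex.norm_ofNat]
  gcongr
  refine (norm_add_le _ _).trans_eq ?_
  rw [Complex.norm_exp, Complex.norm_exp, Complex.neg_re]

theorem norm_csinh_le (z : ℂ) : ‖Complex.sinh z‖ ≤ Real.cosh z.re := by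
  rw [Complex.sinh, Real.cosh_eq, norm_div, Complex.norm_ofNat]
  gcongr
  refine (norm_sub_le _ _).trans_eq ?_
  rw [Complex.norm_exp, Complex.norm_exp, Complex.neg_re]

/-- As an average of cosh over the segment from 0 to z, sinh z / z inherits the bounds for cosh,
with no special treatment of z = 0. -/
theorem csinhDiv_eq_integral (z : ℂ) : csinhDiv z = ∫ t in (0 : ℝ)..1, Complex.cosh (t * z) := by
  rcases eq_or_ne z 0 with rfl | hz
  · simp [csinhDiv_zero]
  · have h : ∀ t ∈ Set.uIcc (0 : ℝ) 1,
        HasDerivAt (fun t : ℝ => Complex.sinh (t * z) / z) (Complex.cosh (t * z)) t := fun t _ => by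
      have h1 : HasDerivAt (fun t : ℝ => (t : ℂ) * z) (1 * z) t :=
        (Complex.ofRealCLM.hasDerivAt (x := t)).mul_const z
      exact ((Complex.hasDerivAt_sinh _).comp t h1 |>.div_const z).congr_deriv (by field_simp)
    rw [intervalIntegral.integral_eq_sub_of_hasDerivAt h
      (Continuous.intervalIntegrable (by fun_prop) _ _), csinhDiv_of_ne hz]
    simp

theorem cosh_mul_le {t : ℝ} (h0 : 0 ≤ t) (h1 : t ≤ 1) (x : ℝ) : Real.cosh (t * x) ≤ Real.cosh x := by
  rw [Real.cosh_le_cosh, abs_mul, abs_of_nonneg h0]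
  exact mul_le_of_le_one_left (abs_nonneg x) h1

theorem norm_csinhDiv_le (z : ℂ) : ‖csinhDiv z‖ ≤ Real.cosh z.re := by
  rw [csinhDiv_eq_integral]
  refine (intervalIntegral.norm_integral_le_of_norm_le_const (C := Real.cosh z.re) fun t ht => ?_).trans_eq
    (by simp)
  rw [Set.uIoc_of_le zero_le_one] at ht
  refine (norm_ccosh_le _).trans ?_
  rw [Complex.re_ofReal_mul]
  exact cosh_mul_le ht.1.le ht.2 _

theorem norm_ccosh_sub_le (w y : ℝ) :
    ‖Complex.cosh (w + y * Complex.I) - Complex.cosh (y * Complex.I)‖ ≤ |w| * Real.cosh w := by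
  have hc : Convex ℝ {z : ℂ | |z.re| ≤ |w|} := by
    have : {z : ℂ | |z.re| ≤ |w|} = Complex.reLm ⁻¹' (Set.Icc (-|w|) |w|) := by
      ext z; simp [abs_le]
    rw [this]; exact (convex_Icc _ _).linear_preimage _
  have := hc.norm_image_sub_le_of_norm_hasDerivWithin_le (𝕜 := ℂ) (f := Complex.cosh) (C := Real.cosh w)
    (x := y * Complex.I) (y := w + y * Complex.I)
    (fun z _ => (Complex.hasDerivAt_cosh z).hasDerivWithinAt)
    (fun z hz => (norm_csinh_le z).trans (Real.cosh_le_cosh.2 hz))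
    (show |(y * Complex.I).re| ≤ |w| by simp) (show |(w + y * Complex.I).re| ≤ |w| by simp)
  simpa [mul_comm] using this

theorem norm_csinhDiv_sub_le (w y : ℝ) :
    ‖csinhDiv (w + y * Complex.I) - csinhDiv (y * Complex.I)‖ ≤ |w| * Real.cosh w := by
  rw [csinhDiv_eq_integral, csinhDiv_eq_integral, ← intervalIntegral.integral_sub
    (Continuous.intervalIntegrable (by fun_prop) _ _) (Continuous.intervalIntegrable (by fun_prop) _ _)]
  refine (intervalIntegral.norm_integral_le_of_norm_le_const (C := |w| * Real.cosh w)
    fun t ht => ?_).trans_eq (by simp)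
  rw [Set.uIoc_of_le zero_le_one] at ht
  have h := norm_ccosh_sub_le (t * w) (t * y)
  push_cast at h
  rw [mul_add, ← mul_assoc]
  refine h.trans (mul_le_mul ?_ (cosh_mul_le ht.1.le ht.2 _) (Real.cosh_pos _).le (abs_nonneg _))
  rw [abs_mul, abs_of_pos ht.1]
  exact mul_le_of_le_one_left (abs_nonneg _) ht.2

theorem csinhDiv_mul_I (y : ℝ) : csinhDiv (y * Complex.I) = Real.sinc y := by
  rcases eq_or_ne y 0 with rfl | hy
  · simp [csinhDiv_zero]
  · rw [csinhDiv_of_ne (by simpa using hy), Complex.sinh_mul_I, Real.sinc_of_ne_zero hy]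
    push_cast
    rw [mul_div_mul_right _ _ Complex.I_ne_zero]

theorem half_le_sinc {y : ℝ} (h0 : 0 ≤ y) (h1 : y ≤ Real.pi / 2) : 1 / 2 ≤ Real.sinc y := by
  rcases h0.eq_or_lt with rfl | hy
  · norm_num
  · rw [Real.sinc_of_ne_zero hy.ne', le_div_iff₀ hy]
    refine le_trans ?_ (Real.mul_le_sin h0 h1)
    refine mul_le_mul_of_nonneg_right ?_ h0
    rw [div_le_div_iff₀ two_pos Real.pi_pos]
    linarith [Real.pi_le_four]

/-- Both sides are the real part of z̄ sinh z. -/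
theorem re_csinhDiv_mul_normSq (x y : ℝ) : (csinhDiv (x + y * Complex.I)).re * (x ^ 2 + y ^ 2)
    = x * Real.sinh x * Real.cos y + y * Real.cosh x * Real.sin y := by
  have h : (x + y * Complex.I) * csinhDiv (x + y * Complex.I) = Complex.sinh (x + y * Complex.I) := by
    rcases eq_or_ne ((x : ℂ) + y * Complex.I) 0 with hz | hz
    · rw [hz]; simp
    · rw [csinhDiv_of_ne hz, mul_div_cancel₀ _ hz]
  rw [Complex.sinh_add, Complex.cosh_mul_I, Complex.sinh_mul_I, ← Complex.ofReal_sinh,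
    ← Complex.ofReal_cosh, ← Complex.ofReal_cos, ← Complex.ofReal_sin] at h
  have hr := congrArg Complex.re h
  have hi := congrArg Complex.im h
  simp [-Complex.ofReal_sinh, -Complex.ofReal_cosh, -Complex.ofReal_sin, -Complex.ofReal_cos] at hr hi
  linear_combination x * hr + y * hi

/-- From y ≥ sin y and cos y ≥ cos² y the right side is at least cos² y + sin² y. -/
theorem one_le_cos_add_mul_sin {y : ℝ} (h0 : 0 ≤ y) (h1 : y ≤ Real.pi / 2) :
    1 ≤ Real.cos y + y * Real.sin y := by
  have hs := Real.sin_le h0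
  have hs0 := Real.sin_nonneg_of_nonneg_of_le_pi h0 (by linarith)
  have hc0 := Real.cos_nonneg_of_neg_pi_div_two_le_of_le (by linarith) h1
  have hc1 := Real.cos_le_one y
  nlinarith [Real.sin_sq_add_cos_sq y]

/-- Keeps sinh z / z in the right half-plane throughout the strip, so the fractional powers are
holomorphic there. -/
theorem re_csinhDiv_pos {x y : ℝ} (h0 : 0 ≤ y) (h1 : y ≤ Real.pi / 2) :
    0 < (csinhDiv (x + y * Complex.I)).re := by
  by_cases hx : x = 0
  · subst hx
    rw [Complex.ofReal_zero, zero_add, csinhDiv_mul_I, Complex.ofReal_re]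
    linarith [half_le_sinc h0 h1]
  · have hm := re_csinhDiv_mul_normSq x y
    have hs0 := Real.sin_nonneg_of_nonneg_of_le_pi h0 (by linarith)
    have hc0 := Real.cos_nonneg_of_neg_pi_div_two_le_of_le (by linarith) h1
    have hxs : 0 < x * Real.sinh x := by
      rw [← mul_sinhDiv, ← mul_assoc]
      have := sinhDiv_pos x
      have := mul_self_pos.2 hx
      positivity
    have hch := Real.cosh_pos x
    have : 0 < x * Real.sinh x * Real.cos y + y * Real.cosh x * Real.sin y := by
      rcases hc0.eq_or_lt with hc | hc
      · have := one_le_cos_add_mul_sin h0 h1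
        rw [← hc] at this ⊢
        nlinarith
      · positivity
    rw [← hm] at this
    exact pos_of_mul_pos_left this (by positivity)

/-- Half of the exponential growth is given up to absorb the division by |z|². This is only used for
decay on the vertical sides of the contour. -/
theorem exp_half_le_re_csinhDiv {x y : ℝ} (hx : 1 ≤ |x|) (h0 : 0 ≤ y) (h1 : y ≤ Real.pi / 2) :
    Real.exp (|x| / 2) / 32 ≤ (csinhDiv (x + y * Complex.I)).re := by
  have hm := re_csinhDiv_mul_normSq x y
  have hc := one_le_cos_add_mul_sin h0 h1
  have hs0 := Real.sin_nonneg_of_nonneg_of_le_pi h0 (by linarith)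
  have hc0 := Real.cos_nonneg_of_neg_pi_div_two_le_of_le (by linarith) h1
  have hp := re_csinhDiv_pos (x := x) h0 h1
  set A := (csinhDiv (x + y * Complex.I)).re
  have hxs : x * Real.sinh x = |x| * Real.sinh |x| := by
    rcases abs_cases x with ⟨h, _⟩ | ⟨h, _⟩ <;> rw [h]
    rw [Real.sinh_neg]; ring
  rw [hxs, ← Real.cosh_abs, ← sq_abs x] at hm
  set t := |x|
  have hsc := Real.sinh_lt_cosh t
  have hsp : 0 < Real.sinh t := Real.sinh_pos_iff.2 (by linarith)
  have hy2 : y ^ 2 ≤ 3 := by nlinarith [Real.pi_lt_d2]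
  have e1 : Real.sinh t ≤ A * (t ^ 2 + 3) := by
    have : Real.sinh t ≤ t * Real.sinh t * Real.cos y + y * Real.cosh t * Real.sin y := by
      have a1 : Real.sinh t * Real.cos y ≤ t * Real.sinh t * Real.cos y := by
        nlinarith [mul_nonneg hsp.le hc0]
      have a2 : y * Real.sinh t * Real.sin y ≤ y * Real.cosh t * Real.sin y := by gcongr
      nlinarith
    nlinarith
  have e2 : Real.exp t / 4 ≤ Real.sinh t := by
    rw [Real.sinh_eq]
    have : Real.exp (-t) ≤ Real.exp t / 2 := by
      rw [Real.exp_neg, inv_le_iff_one_le_mul₀ (Real.exp_pos _)]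
      have := Real.add_one_le_exp t
      nlinarith
    linarith
  have e3 : t ^ 2 + 3 ≤ 8 * Real.exp (t / 2) := by
    have := Real.quadratic_le_exp_of_nonneg (show 0 ≤ t / 2 by linarith)
    nlinarith
  have e4 : Real.exp t = Real.exp (t / 2) * Real.exp (t / 2) := by rw [← Real.exp_add]; ring_nf
  have hep := Real.exp_pos (t / 2)
  have : Real.exp (t / 2) * (Real.exp (t / 2) / 4) ≤ Real.exp (t / 2) * (A * 8) := by
    nlinarith
  have := le_of_mul_le_mul_left this hep
  linarith

theorem norm_cpow_three_half_sub_le {z : ℂ} {s B : ℝ} (hz : 0 < z.re) (hzB : ‖z‖ ≤ B) (hs : 0 < s)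
    (hs1 : s ≤ 1) (hB : 1 ≤ B) :
    ‖z ^ ((3 / 2 : ℝ) : ℂ) - ((s ^ (3 / 2 : ℝ) : ℝ) : ℂ)‖ ≤ 3 / 2 * B * ‖z - s‖ := by
  have hc : Convex ℝ ({z : ℂ | 0 < z.re} ∩ Metric.closedBall 0 B) :=
    (convex_halfSpace_re_gt 0).inter (convex_closedBall 0 B)
  have := hc.norm_image_sub_le_of_norm_hasDerivWithin_le (𝕜 := ℂ)
    (f := fun z : ℂ => z ^ ((3 / 2 : ℝ) : ℂ)) (C := 3 / 2 * B) (x := (s : ℂ)) (y := z)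
    (f' := fun z : ℂ => ((3 / 2 : ℝ) : ℂ) * z ^ (((3 / 2 : ℝ) : ℂ) - 1) * 1)
    (fun z hz => ((hasDerivAt_id z).cpow_const (Or.inl hz.1)).hasDerivWithinAt)
    (fun z hz => ?_) ⟨by simpa using hs, by simp [abs_of_pos hs]; linarith⟩ ⟨hz, by simpa using hzB⟩
  · rwa [Complex.ofReal_cpow hs.le]
  · have hzB : ‖z‖ ≤ B := by simpa using hz.2
    rw [mul_one, norm_mul, ← Complex.ofReal_one, ← Complex.ofReal_sub, Complex.norm_cpow_real,
      Complex.norm_real, Real.norm_of_nonneg (by norm_num)]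
    gcongr
    calc ‖z‖ ^ (3 / 2 - 1 : ℝ) ≤ B ^ (3 / 2 - 1 : ℝ) := by gcongr
      _ ≤ B ^ (1 : ℝ) := Real.rpow_le_rpow_of_exponent_le hB (by norm_num)
      _ = B := Real.rpow_one B

/-- Mean value inequality on the half-plane Re z ≥ X, where the derivative of z^{-a} is at most a
X^{-a-1}. -/
theorem norm_add_cpow_neg_sub_le {h : ℂ} {X a : ℝ} (hh : 0 ≤ h.re) (hX : 0 < X) (ha : 0 < a) :
    ‖(h + X) ^ (-(a : ℂ)) - ((X ^ (-a) : ℝ) : ℂ)‖ ≤ a * X ^ (-a - 1) * ‖h‖ := by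
  have := (convex_halfSpace_re_ge X).norm_image_sub_le_of_norm_hasDerivWithin_le (𝕜 := ℂ)
    (f := fun z : ℂ => z ^ ((-a : ℝ) : ℂ)) (C := a * X ^ (-a - 1)) (x := (X : ℂ)) (y := h + X)
    (f' := fun z : ℂ => ((-a : ℝ) : ℂ) * z ^ (((-a : ℝ) : ℂ) - 1) * 1)
    (fun z hz => ((hasDerivAt_id z).cpow_const (Or.inl (hX.trans_le hz))).hasDerivWithinAt)
    (fun z hz => ?_) (show X ≤ (X : ℂ).re by simp)
    (show X ≤ (h + X : ℂ).re by simpa using hh)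
  · rw [add_sub_cancel_right, ← Complex.ofReal_cpow hX.le] at this
    simpa using this
  · have hz : X ≤ z.re := hz
    have hzX : X ≤ ‖z‖ := hz.trans (Complex.re_le_norm z)
    rw [mul_one, norm_mul, ← Complex.ofReal_one, ← Complex.ofReal_sub, Complex.norm_cpow_real,
      Complex.norm_real, norm_neg, Real.norm_of_nonneg ha.le]
    exact mul_le_mul_of_nonneg_left (Real.rpow_le_rpow_of_nonpos hX hzX (by linarith)) ha.le

/-! ### Shifting the contour. -/

namespace Grushin

variable {n : ℕ} {g g' : GrushinSpace n} {A φ : ℝ}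

/-- The addition formula for cosh, with A = D_K². On the line Im z = φ the cosine-hyperbolic term is
real. -/
theorem phase_eq_cosh (hR : sqR g g' = A * Real.cos φ) (hσ : 2 * sepS g g' = A * Real.sin φ)
    (z : ℂ) : phase g g' z
      = csinhDiv z + (A * Complex.cosh (z - φ * Complex.I) - (2 * inner ℝ g.1 g'.1 : ℝ)) := by
  have h1 : (sqR g g' : ℂ) = A * Complex.cos φ := by rw [hR]; push_cast; rfl
  have h2 : (2 * sepS g g' : ℂ) = A * Complex.sin φ := by
    rw [← Complex.ofReal_sin, ← Complex.ofReal_mul, ← hσ]; push_cast; rfl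
  rw [phase, Complex.cosh_sub, Complex.cosh_mul_I, Complex.sinh_mul_I]
  linear_combination Complex.cosh z * h1 - Complex.I * Complex.sinh z * h2

theorem phase_add_mul_I (hR : sqR g g' = A * Real.cos φ) (hσ : 2 * sepS g g' = A * Real.sin φ)
    (w : ℝ) : phase g g' (w + φ * Complex.I)
      = csinhDiv (w + φ * Complex.I) + ((A * Real.cosh w - 2 * inner ℝ g.1 g'.1 : ℝ) : ℂ) := by
  rw [phase_eq_cosh hR hσ, add_sub_cancel_right]
  push_cast
  rfl

/-- For 0 ≤ y ≤ φ one has cos(φ - y) ≥ cos φ, so A cos(φ - y) cosh x ≥ R² cosh x ≥ 2 x·x'. The phase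
therefore stays in the right half-plane during the shift. -/
theorem re_csinhDiv_le_re_phase (hR : sqR g g' = A * Real.cos φ)
    (hσ : 2 * sepS g g' = A * Real.sin φ) (hA : 0 ≤ A) (hφ : φ ≤ Real.pi / 2) {x y : ℝ}
    (h0 : 0 ≤ y) (h1 : y ≤ φ) :
    (csinhDiv (x + y * Complex.I)).re ≤ (phase g g' (x + y * Complex.I)).re := by
  have e : (A * Complex.cosh (x + y * Complex.I - φ * Complex.I) - (2 * inner ℝ g.1 g'.1 : ℝ) : ℂ).re
      = A * Real.cos (φ - y) * Real.cosh x - 2 * inner ℝ g.1 g'.1 := by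
    have : (x + y * Complex.I - φ * Complex.I : ℂ) = x - ((φ - y : ℝ) : ℂ) * Complex.I := by
      push_cast; ring
    rw [this, Complex.cosh_sub, Complex.cosh_mul_I, Complex.sinh_mul_I, ← Complex.ofReal_cosh,
      ← Complex.ofReal_sinh, ← Complex.ofReal_sin, ← Complex.ofReal_cos, Complex.sub_re,
      Complex.re_ofReal_mul, Complex.ofReal_re, Complex.sub_re, ← Complex.ofReal_mul,
      Complex.ofReal_re, Complex.re_ofReal_mul, Complex.re_ofReal_mul, Complex.I_re]
    ring
  rw [phase_eq_cosh hR hσ, Complex.add_re, e]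
  have h2 : A * Real.cos φ * Real.cosh x ≤ A * Real.cos (φ - y) * Real.cosh x := by
    have := Real.cosh_pos x
    have : Real.cos φ ≤ Real.cos (φ - y) :=
      Real.cos_le_cos_of_nonneg_of_le_pi (by linarith) (by linarith [Real.pi_pos]) (by linarith)
    gcongr
  have := two_inner_le_mul_cosh g g' x
  rw [hR] at this
  linarith

theorem norm_kernelIntegrand (z : ℂ) : ‖kernelIntegrand g g' z‖
    = ‖csinhDiv z‖ ^ (3 / 2 : ℝ) * ‖phase g g' z‖ ^ (-kernelExponent n) := by
  rw [kernelIntegrand, norm_mul, ← Complex.ofReal_neg, Complex.norm_cpow_real,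
    Complex.norm_cpow_real]

theorem norm_kernelIntegrand_le_exp (hR : sqR g g' = A * Real.cos φ)
    (hσ : 2 * sepS g g' = A * Real.sin φ) (hA : 0 ≤ A) (hφ : φ ≤ Real.pi / 2) {x y : ℝ}
    (hx : 1 ≤ |x|) (h0 : 0 ≤ y) (h1 : y ≤ φ) :
    ‖kernelIntegrand g g' (x + y * Complex.I)‖
      ≤ 32 ^ kernelExponent n * Real.exp (-((kernelExponent n - 3) / 2 * |x|)) := by
  have ha := kernelExponent_pos (n := n)
  have hre := exp_half_le_re_csinhDiv hx h0 (h1.trans hφ)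
  have hph := (hre.trans (re_csinhDiv_le_re_phase hR hσ hA hφ h0 h1)).trans (Complex.re_le_norm _)
  have hcs : ‖csinhDiv (x + y * Complex.I)‖ ≤ Real.exp |x| := by
    refine (norm_csinhDiv_le _).trans ?_
    have : (x + y * Complex.I : ℂ).re = x := by simp
    rw [this, ← Real.cosh_abs, Real.cosh_eq]
    have : Real.exp (-|x|) ≤ Real.exp |x| := Real.exp_le_exp.2 (by linarith)
    linarith
  rw [norm_kernelIntegrand]
  calc _ ≤ Real.exp |x| ^ (3 / 2 : ℝ) * (Real.exp (|x| / 2) / 32) ^ (-kernelExponent n) := by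
        refine mul_le_mul ?_ (Real.rpow_le_rpow_of_nonpos (by positivity) hph (by linarith))
          (by positivity) (by positivity)
        gcongr
    _ = _ := by
        rw [Real.div_rpow (Real.exp_pos _).le (by norm_num), ← Real.exp_mul, ← Real.exp_mul,
          Real.rpow_neg (by norm_num), div_inv_eq_mul, mul_comm _ (32 ^ _), mul_left_comm,
          ← Real.exp_add]
        congr 2
        ring

theorem differentiableAt_kernelIntegrand (hR : sqR g g' = A * Real.cos φ)
    (hσ : 2 * sepS g g' = A * Real.sin φ) (hA : 0 ≤ A) (hφ : φ ≤ Real.pi / 2) {x y : ℝ}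
    (h0 : 0 ≤ y) (h1 : y ≤ φ) : DifferentiableAt ℂ (kernelIntegrand g g') (x + y * Complex.I) := by
  have hp := re_csinhDiv_pos (x := x) h0 (h1.trans hφ)
  have hq := hp.trans_le (re_csinhDiv_le_re_phase hR hσ hA hφ h0 h1)
  have d1 := differentiable_csinhDiv (x + y * Complex.I)
  have d2 : DifferentiableAt ℂ (phase g g') (x + y * Complex.I) := by
    unfold phase
    fun_prop
  exact (d1.cpow_const (Or.inl hp)).mul (d2.cpow_const (Or.inl hq))

theorem tendsto_intervalIntegral_kernelIntegrand {ε : ℝ} (hn : 4 ≤ n) (hε : |ε| = 1)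
    (hR : sqR g g' = A * Real.cos φ) (hσ : 2 * sepS g g' = A * Real.sin φ) (hA : 0 ≤ A)
    (hφ0 : 0 ≤ φ) (hφ : φ ≤ Real.pi / 2) :
    Tendsto (fun T : ℝ => ∫ y in (0 : ℝ)..φ, kernelIntegrand g g' ((ε * T : ℝ) + y * Complex.I))
      atTop (𝓝 0) := by
  have hn' : (4 : ℝ) ≤ n := by exact_mod_cast hn
  -- The decay rate is positive exactly when n > 3.
  have hb : 0 < (kernelExponent n - 3) / 2 := by unfold kernelExponent; linarith
  have hlim : Tendsto (fun T : ℝ => 32 ^ kernelExponent n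
      * Real.exp (-((kernelExponent n - 3) / 2 * T)) * |φ - 0|) atTop (𝓝 0) := by
    have := (Real.tendsto_exp_neg_atTop_nhds_zero.comp (tendsto_id.const_mul_atTop hb)).const_mul
      (32 ^ kernelExponent n) |>.mul_const |φ - 0|
    simpa using this
  refine squeeze_zero_norm' ?_ hlim
  filter_upwards [eventually_ge_atTop 1] with T hT
  refine intervalIntegral.norm_integral_le_of_norm_le_const fun y hy => ?_
  rw [Set.uIoc_of_le hφ0] at hy
  have hT' : |ε * T| = T := by rw [abs_mul, hε, one_mul, abs_of_pos (by linarith)]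
  have := norm_kernelIntegrand_le_exp hR hσ hA hφ (x := ε * T) (by rw [hT']; exact hT) hy.1.le hy.2
  rwa [hT'] at this

/-- Cauchy's theorem on rectangles, whose vertical sides vanish in the limit. Integrability on the
shifted line is a hypothesis because the Laplace estimate provides it. -/
theorem integral_kernelIntegrand_shift (hn : 4 ≤ n) (hR : sqR g g' = A * Real.cos φ)
    (hσ : 2 * sepS g g' = A * Real.sin φ) (hA : 0 ≤ A) (hφ0 : 0 ≤ φ) (hφ : φ ≤ Real.pi / 2)
    (hi : Integrable fun w : ℝ => kernelIntegrand g g' (w + φ * Complex.I)) :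
    ∫ x : ℝ, kernelIntegrand g g' x = ∫ w : ℝ, kernelIntegrand g g' (w + φ * Complex.I) := by
  have h1 := intervalIntegral_tendsto_integral (integrable_kernelIntegrand (by omega) g g')
    tendsto_neg_atTop_atBot tendsto_id
  have h2 := intervalIntegral_tendsto_integral hi tendsto_neg_atTop_atBot tendsto_id
  have h3 := tendsto_intervalIntegral_kernelIntegrand (ε := 1) hn (by simp) hR hσ hA hφ0 hφ
  have h4 := tendsto_intervalIntegral_kernelIntegrand (ε := -1) hn (by simp) hR hσ hA hφ0 hφ
  have h5 := ((h1.sub h2).add (h3.const_smul Complex.I)).sub (h4.const_smul Complex.I)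
  have h6 : ∀ T : ℝ, (((∫ x in (-T)..T, kernelIntegrand g g' x)
      - ∫ w in (-T)..T, kernelIntegrand g g' (w + φ * Complex.I))
      + Complex.I • ∫ y in (0 : ℝ)..φ, kernelIntegrand g g' ((1 * T : ℝ) + y * Complex.I))
      - Complex.I • ∫ y in (0 : ℝ)..φ, kernelIntegrand g g' ((-1 * T : ℝ) + y * Complex.I) = 0 := by
    intro T
    have := Complex.integral_boundary_rect_eq_zero_of_differentiableOn (kernelIntegrand g g')
      (-T : ℝ) (T + φ * Complex.I) (fun z hz => by
        have hz2 : z.im ∈ Set.uIcc (0 : ℝ) φ := by simpa using hz.2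
        rw [Set.uIcc_of_le hφ0] at hz2
        have := differentiableAt_kernelIntegrand hR hσ hA hφ (x := z.re) hz2.1 hz2.2
        rw [Complex.re_add_im] at this
        exact this.differentiableWithinAt)
    simpa using this
  have h7 := tendsto_nhds_unique (h5.congr h6) tendsto_const_nhds
  simp only [smul_zero, add_zero, sub_zero] at h7
  exact sub_eq_zero.1 h7

end Grushin

/-! ### Laplace's method with explicit constants. -/

theorem hasDerivAt_mul_sinh_half (c w : ℝ) :
    HasDerivAt (fun w => c * Real.sinh (w / 2)) (c / 2 * Real.cosh (w / 2)) w := by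
  have := (((hasDerivAt_id w).div_const 2).sinh).const_mul c
  exact this.congr_deriv (by simp; ring)

theorem injective_mul_sinh_half {c : ℝ} (hc : 0 < c) :
    Function.Injective fun w => c * Real.sinh (w / 2) := fun x y h => by
  have := Real.sinh_injective (mul_left_cancel₀ hc.ne' h)
  linarith

theorem range_mul_sinh_half {c : ℝ} (hc : 0 < c) :
    (fun w => c * Real.sinh (w / 2)) '' Set.univ = Set.univ := by
  rw [Set.image_univ]
  refine Set.range_eq_univ.2 fun y => ?_
  obtain ⟨x, hx⟩ := Real.sinh_surjective (y / c)
  exact ⟨2 * x, by rw [mul_div_cancel_left₀ _ two_ne_zero, hx, mul_div_cancel₀ _ hc.ne']⟩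

/-- The substitution v = c sinh(w/2), with Jacobian (c/2) cosh(w/2). -/
theorem integral_cosh_half_mul_comp {c : ℝ} (hc : 0 < c) {G : ℝ → ℝ} (hG : Integrable G) :
    Integrable (fun w => Real.cosh (w / 2) * G (c * Real.sinh (w / 2))) ∧
    ∫ w, Real.cosh (w / 2) * G (c * Real.sinh (w / 2)) = 2 / c * ∫ v, G v := by
  have hd : ∀ x ∈ Set.univ, HasDerivWithinAt (fun w => c * Real.sinh (w / 2))
      (c / 2 * Real.cosh (x / 2)) Set.univ x := fun x _ =>
    (hasDerivAt_mul_sinh_half c x).hasDerivWithinAt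
  have e : ∀ w, 2 / c * (|c / 2 * Real.cosh (w / 2)| • G (c * Real.sinh (w / 2)))
      = Real.cosh (w / 2) * G (c * Real.sinh (w / 2)) := fun w => by
    have := Real.cosh_pos (w / 2)
    rw [abs_of_pos (by positivity), smul_eq_mul]
    field_simp
  have h1 := integrableOn_image_iff_integrableOn_abs_deriv_smul MeasurableSet.univ hd
    (injective_mul_sinh_half hc).injOn G
  have h2 := integral_image_eq_integral_abs_deriv_smul MeasurableSet.univ hd
    (injective_mul_sinh_half hc).injOn G
  rw [range_mul_sinh_half hc, integrableOn_univ, integrableOn_univ] at h1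
  rw [range_mul_sinh_half hc, setIntegral_univ, setIntegral_univ] at h2
  constructor
  · exact ((h1.1 hG).const_mul (2 / c)).congr (Eventually.of_forall e)
  · rw [h2, ← integral_const_mul]
    exact integral_congr_ae (Eventually.of_forall fun w => (e w).symm)

theorem integral_le_of_le_cosh_half_mul_comp {c : ℝ} (hc : 0 < c) {G H : ℝ → ℝ}
    (hG : Integrable G) (hm : AEStronglyMeasurable H) (h0 : ∀ w, 0 ≤ H w)
    (hle : ∀ w, H w ≤ Real.cosh (w / 2) * G (c * Real.sinh (w / 2))) :
    Integrable H ∧ ∫ w, H w ≤ 2 / c * ∫ v, G v := by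
  obtain ⟨i, e⟩ := integral_cosh_half_mul_comp hc hG
  have hi : Integrable H := i.mono' hm
    (Eventually.of_forall fun w => (Real.norm_of_nonneg (h0 w)).trans_le (hle w))
  exact ⟨hi, e ▸ integral_mono hi i hle⟩

/-- Since cosh w = 1 + 2 sinh²(w/2), every factor cosh w costs one power of 1 + v² as long as c ≥ 1.
-/
theorem cosh_le_two_mul {c : ℝ} (hc : 1 ≤ c) (w : ℝ) :
    Real.cosh w ≤ 2 * (1 + (c * Real.sinh (w / 2)) ^ 2) := by
  have h : Real.cosh w = 1 + 2 * Real.sinh (w / 2) ^ 2 := by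
    have := Real.cosh_two_mul (w / 2)
    rw [mul_div_cancel₀ _ two_ne_zero] at this
    rw [this, Real.cosh_sq]; ring
  have : 1 * Real.sinh (w / 2) ^ 2 ≤ c ^ 2 * Real.sinh (w / 2) ^ 2 := by gcongr; nlinarith
  rw [h, mul_pow]; linarith

theorem abs_le_two_mul_abs_sinh_half {c : ℝ} (hc : 1 ≤ c) (w : ℝ) :
    |w| ≤ 2 * |c * Real.sinh (w / 2)| := by
  have h1 : |w / 2| ≤ |Real.sinh (w / 2)| := by
    rw [← mul_sinhDiv, abs_mul, abs_of_pos (sinhDiv_pos _)]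
    exact le_mul_of_one_le_right (abs_nonneg _) (one_le_sinhDiv _)
  rw [abs_mul, abs_of_pos (by linarith : 0 < c)]
  rw [abs_div, abs_two] at h1
  nlinarith [abs_nonneg (Real.sinh (w / 2))]

theorem cosh_half_sub_one_le {c : ℝ} (hc : 1 ≤ c) (w : ℝ) :
    Real.cosh (w / 2) - 1 ≤ 1 / 2 * (c * Real.sinh (w / 2)) ^ 2 := by
  have h1 := Real.cosh_sq (w / 2)
  have : 1 * Real.sinh (w / 2) ^ 2 ≤ c ^ 2 * Real.sinh (w / 2) ^ 2 := by gcongr; nlinarith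
  rw [mul_pow]
  nlinarith [Real.one_le_cosh (w / 2), sq_nonneg (Real.cosh (w / 2) - 1)]

theorem integral_one_add_sq_rpow_le_two_mul {p : ℝ} (hp : 1 ≤ p) :
    ∫ v : ℝ, (1 + v ^ 2) ^ (-p) ≤ 2 * ∫ v : ℝ, (1 + v ^ 2) ^ (-(p + 1)) := by
  have h1 := integral_one_add_sq_rpow_recurrence (by linarith : 1 / 2 < p)
  have h2 := integral_one_add_sq_rpow_pos (by linarith : 1 / 2 < p)
  have h3 := integral_one_add_sq_rpow_pos (by linarith : 1 / 2 < p + 1)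
  nlinarith

theorem sq_mul_rpow_neg {V a : ℝ} (hV : 0 < V) : V ^ 2 * V ^ (-a) = V ^ (-(a - 2)) := by
  rw [← Real.rpow_natCast, ← Real.rpow_add hV]; congr 1; push_cast; ring

theorem measurable_one_add_sinh_rpow (c a : ℝ) :
    Measurable fun w : ℝ => (1 + (c * Real.sinh (w / 2)) ^ 2) ^ (-a) := by
  have := Real.continuous_sinh.measurable
  fun_prop

/-- Two factors cosh w lower the exponent from a to a - 2 with a constant 4;
`integral_one_add_sq_rpow_le_two_mul` restores it, doubling twice, which makes 16. -/
theorem integral_cosh_sq_mul_le {c a : ℝ} (hc : 1 ≤ c) (ha : 4 ≤ a) :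
    Integrable (fun w => Real.cosh w ^ 2 * (1 + (c * Real.sinh (w / 2)) ^ 2) ^ (-a)) ∧
    ∫ w, Real.cosh w ^ 2 * (1 + (c * Real.sinh (w / 2)) ^ 2) ^ (-a)
      ≤ 2 / c * (16 * ∫ v : ℝ, (1 + v ^ 2) ^ (-a)) := by
  have hc0 : 0 < c := by linarith
  have hm := measurable_one_add_sinh_rpow c a
  have hm2 := Real.continuous_cosh.measurable
  obtain ⟨i, e⟩ := integral_le_of_le_cosh_half_mul_comp hc0
    (G := fun v => 4 * (1 + v ^ 2) ^ (-(a - 2)))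
    (H := fun w => Real.cosh w ^ 2 * (1 + (c * Real.sinh (w / 2)) ^ 2) ^ (-a))
    ((integrable_one_add_sq_rpow (by linarith)).const_mul 4)
    (Measurable.aestronglyMeasurable (by fun_prop)) (fun w => by positivity) (fun w => by
      have hV : (0 : ℝ) < 1 + (c * Real.sinh (w / 2)) ^ 2 := by positivity
      have h1 := pow_le_pow_left₀ (Real.cosh_pos w).le (cosh_le_two_mul hc w) 2
      have h2 := Real.rpow_pos_of_pos hV (-(a - 2))
      have h3 := Real.rpow_pos_of_pos hV (-a)
      calc _ ≤ (2 * (1 + (c * Real.sinh (w / 2)) ^ 2)) ^ 2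
            * (1 + (c * Real.sinh (w / 2)) ^ 2) ^ (-a) := by gcongr
        _ = 4 * (1 + (c * Real.sinh (w / 2)) ^ 2) ^ (-(a - 2)) := by
            rw [← sq_mul_rpow_neg hV]; ring
        _ ≤ _ := le_mul_of_one_le_left (by positivity) (Real.one_le_cosh _))
  refine ⟨i, e.trans ?_⟩
  have h1 := integral_one_add_sq_rpow_le_two_mul (by linarith : 1 ≤ a - 2)
  have h2 := integral_one_add_sq_rpow_le_two_mul (by linarith : 1 ≤ a - 1)
  rw [show a - 2 + 1 = a - 1 by ring] at h1
  rw [sub_add_cancel] at h2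
  rw [integral_const_mul]
  refine mul_le_mul_of_nonneg_left ?_ (by positivity)
  linarith

/-- The factor |w| ≤ 2|v| lowers the exponent once more, to a - 3, whence a ≥ 4 and three doublings.
-/
theorem integral_abs_mul_cosh_sq_mul_le {c a k : ℝ} (hc : 1 ≤ c) (ha : 4 ≤ a) (hk : 0 < k) :
    Integrable (fun w => |w| * Real.cosh w ^ 2 * (1 + (c * Real.sinh (w / 2)) ^ 2) ^ (-a)) ∧
    ∫ w, |w| * Real.cosh w ^ 2 * (1 + (c * Real.sinh (w / 2)) ^ 2) ^ (-a)
      ≤ 2 / c * (32 * (k / (a - 3) + 1 / k) * ∫ v : ℝ, (1 + v ^ 2) ^ (-a)) := by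
  have hc0 : 0 < c := by linarith
  have hm := measurable_one_add_sinh_rpow c a
  have hm2 := Real.continuous_cosh.measurable
  obtain ⟨i0, e0⟩ := integral_abs_mul_one_add_sq_rpow_le (by linarith : 1 / 2 < a - 3) hk
  rw [show a - 3 + 1 = a - 2 by ring] at i0 e0
  obtain ⟨i, e⟩ := integral_le_of_le_cosh_half_mul_comp hc0
    (G := fun v => 8 * (|v| * (1 + v ^ 2) ^ (-(a - 2))))
    (H := fun w => |w| * Real.cosh w ^ 2 * (1 + (c * Real.sinh (w / 2)) ^ 2) ^ (-a))
    (i0.const_mul 8)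
    (Measurable.aestronglyMeasurable (by fun_prop)) (fun w => by positivity) (fun w => by
      have hV : (0 : ℝ) < 1 + (c * Real.sinh (w / 2)) ^ 2 := by positivity
      have h1 := pow_le_pow_left₀ (Real.cosh_pos w).le (cosh_le_two_mul hc w) 2
      have h2 := Real.rpow_pos_of_pos hV (-(a - 2))
      have h3 := Real.rpow_pos_of_pos hV (-a)
      calc _ ≤ (2 * |c * Real.sinh (w / 2)|) * (2 * (1 + (c * Real.sinh (w / 2)) ^ 2)) ^ 2
            * (1 + (c * Real.sinh (w / 2)) ^ 2) ^ (-a) := by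
            gcongr
            exact abs_le_two_mul_abs_sinh_half hc w
        _ = 8 * (|c * Real.sinh (w / 2)| * (1 + (c * Real.sinh (w / 2)) ^ 2) ^ (-(a - 2))) := by
            rw [← sq_mul_rpow_neg hV]; ring
        _ ≤ _ := le_mul_of_one_le_left (by positivity) (Real.one_le_cosh _))
  refine ⟨i, e.trans ?_⟩
  have h0 := integral_one_add_sq_rpow_le_two_mul (by linarith : 1 ≤ a - 3)
  have h1 := integral_one_add_sq_rpow_le_two_mul (by linarith : 1 ≤ a - 2)
  have h2 := integral_one_add_sq_rpow_le_two_mul (by linarith : 1 ≤ a - 1)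
  rw [show a - 3 + 1 = a - 2 by ring] at h0
  rw [show a - 2 + 1 = a - 1 by ring] at h1
  rw [sub_add_cancel] at h2
  rw [integral_const_mul]
  refine mul_le_mul_of_nonneg_left ?_ (by positivity)
  have hq : 0 ≤ k / (a - 3) + 1 / k := by
    have : 0 < a - 3 := by linarith
    positivity
  have h3 : ∫ v : ℝ, (1 + v ^ 2) ^ (-(a - 3)) ≤ 8 * ∫ v : ℝ, (1 + v ^ 2) ^ (-a) := by linarith
  have := mul_le_mul_of_nonneg_left h3 hq
  linarith

/-- The integral with the Jacobian weight cosh(w/2) is exact; removing the weight costs cosh(w/2) -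
1 ≤ v²/2, and the second moment is of relative size 1/a. -/
theorem integral_one_add_sinh_rpow_bounds {c a : ℝ} (hc : 1 ≤ c) (ha : 4 ≤ a) :
    Integrable (fun w => (1 + (c * Real.sinh (w / 2)) ^ 2) ^ (-a)) ∧
    |(∫ w, (1 + (c * Real.sinh (w / 2)) ^ 2) ^ (-a)) - 2 / c * ∫ v : ℝ, (1 + v ^ 2) ^ (-a)|
      ≤ 1 / a * (2 / c * ∫ v : ℝ, (1 + v ^ 2) ^ (-a)) := by
  have hc0 : 0 < c := by linarith
  have hm := measurable_one_add_sinh_rpow c a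
  have hm2 := Real.continuous_cosh.measurable
  have i1 := integrable_one_add_sq_rpow (show 1 / 2 < a by linarith)
  obtain ⟨i2, e2⟩ := integral_cosh_half_mul_comp hc0 i1
  obtain ⟨i3, -⟩ := integral_le_of_le_cosh_half_mul_comp hc0 i1
    (H := fun w => (1 + (c * Real.sinh (w / 2)) ^ 2) ^ (-a)) hm.aestronglyMeasurable
    (fun w => by positivity)
    (fun w => le_mul_of_one_le_left (by positivity) (Real.one_le_cosh _))
  obtain ⟨i0, e0⟩ := integral_sq_mul_one_add_sq_rpow (by linarith : 1 / 2 < a - 1)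
  rw [sub_add_cancel] at i0 e0
  obtain ⟨i4, e4⟩ := integral_le_of_le_cosh_half_mul_comp hc0 (i0.const_mul (1 / 2))
    (H := fun w => (Real.cosh (w / 2) - 1) * (1 + (c * Real.sinh (w / 2)) ^ 2) ^ (-a))
    (Measurable.aestronglyMeasurable (by fun_prop))
    (fun w => mul_nonneg (sub_nonneg.2 (Real.one_le_cosh _)) (by positivity))
    (fun w => by
      calc _ ≤ 1 / 2 * (c * Real.sinh (w / 2)) ^ 2 * (1 + (c * Real.sinh (w / 2)) ^ 2) ^ (-a) := by
            gcongr
            exact cosh_half_sub_one_le hc w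
        _ = 1 / 2 * ((c * Real.sinh (w / 2)) ^ 2 * (1 + (c * Real.sinh (w / 2)) ^ 2) ^ (-a)) := by
            ring
        _ ≤ _ := le_mul_of_one_le_left (by positivity) (Real.one_le_cosh _))
  have h0 : 0 ≤ ∫ w, (Real.cosh (w / 2) - 1) * (1 + (c * Real.sinh (w / 2)) ^ 2) ^ (-a) :=
    integral_nonneg fun w => mul_nonneg (sub_nonneg.2 (Real.one_le_cosh _)) (by positivity)
  have h2 := integral_one_add_sq_rpow_le_two_mul (by linarith : 1 ≤ a - 1)
  have hpos := integral_one_add_sq_rpow_pos (by linarith : 1 / 2 < a)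
  rw [sub_add_cancel] at h2
  have hsub : ∫ w, (Real.cosh (w / 2) - 1) * (1 + (c * Real.sinh (w / 2)) ^ 2) ^ (-a)
      = 2 / c * (∫ v : ℝ, (1 + v ^ 2) ^ (-a)) - ∫ w, (1 + (c * Real.sinh (w / 2)) ^ 2) ^ (-a) := by
    rw [← e2, ← integral_sub i2 i3]
    congr 1; ext w; ring
  refine ⟨i3, ?_⟩
  rw [abs_sub_comm, ← hsub, abs_of_nonneg h0]
  refine e4.trans ?_
  rw [integral_const_mul, e0, ← mul_assoc, ← mul_assoc, mul_comm (2 / c * (1 / 2)), ← mul_assoc,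
    mul_left_comm (1 / a)]
  set m := ∫ v : ℝ, (1 + v ^ 2) ^ (-a)
  set m1 := ∫ v : ℝ, (1 + v ^ 2) ^ (-(a - 1))
  have ha1 : 0 < a - 1 := by linarith
  have h5 : 1 / 2 / (a - 1) ≤ 1 / a := by
    rw [div_div, div_le_div_iff₀ (by positivity) (by linarith)]; linarith
  calc _ = 2 / c * (1 / 2 / (a - 1) * (m1 / 2)) := by ring
    _ ≤ 2 / c * (1 / a * m) := by
        refine mul_le_mul_of_nonneg_left (mul_le_mul h5 (by linarith) ?_ (by positivity))
          (by positivity)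
        exact div_nonneg (integral_nonneg fun v => by positivity) zero_le_two

theorem one_fourth_le_rpow_three_half {s : ℝ} (hs : 1 / 2 ≤ s) (hs1 : s ≤ 1) :
    1 / 4 ≤ s ^ (3 / 2 : ℝ) := by
  have h := Real.rpow_le_rpow_of_exponent_ge (by linarith) hs1 (by norm_num : (3 / 2 : ℝ) ≤ 2)
  rw [Real.rpow_two] at h
  nlinarith

theorem aestronglyMeasurable_cpow {f : ℝ → ℂ} (hf : Continuous f) (h : ∀ w, 0 < (f w).re) (r : ℂ) :
    AEStronglyMeasurable fun w => f w ^ r :=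
  (hf.cpow continuous_const fun w => Or.inl (h w)).aestronglyMeasurable

section

variable {h : ℝ → ℂ} {a c b s : ℝ}

theorem norm_mul_add_cpow_sub_le (hre : ∀ w, 0 < (h w).re) (hn : ∀ w, ‖h w‖ ≤ Real.cosh w)
    (hc : 1 ≤ c) (hb : 0 < b) (ha : 4 ≤ a) (w : ℝ) :
    ‖h w ^ ((3 / 2 : ℝ) : ℂ) * (h w + (b * (1 + (c * Real.sinh (w / 2)) ^ 2) : ℝ)) ^ (-(a : ℂ))
      - h w ^ ((3 / 2 : ℝ) : ℂ) * (((b * (1 + (c * Real.sinh (w / 2)) ^ 2)) ^ (-a) : ℝ) : ℂ)‖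
      ≤ 2 * a / b * b ^ (-a) * (Real.cosh w ^ 2 * (1 + (c * Real.sinh (w / 2)) ^ 2) ^ (-a)) := by
  have hV : (0 : ℝ) < 1 + (c * Real.sinh (w / 2)) ^ 2 := by positivity
  have hVc := cosh_le_two_mul hc w
  set V := 1 + (c * Real.sinh (w / 2)) ^ 2 with hVdef
  have h1 := norm_add_cpow_neg_sub_le (hre w).le (mul_pos hb hV) (by linarith : 0 < a)
  have hC := Real.one_le_cosh w
  rw [← mul_sub, norm_mul, Complex.norm_cpow_real]
  have h2 : ‖h w‖ ^ (3 / 2 : ℝ) ≤ Real.cosh w ^ 2 := by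
    calc _ ≤ Real.cosh w ^ (3 / 2 : ℝ) := by gcongr; exact hn w
      _ ≤ Real.cosh w ^ (2 : ℝ) := Real.rpow_le_rpow_of_exponent_le hC (by norm_num)
      _ = _ := Real.rpow_two _
  have h3 : (b * V) ^ (-a - 1) = b ^ (-a) * V ^ (-a) / (b * V) := by
    rw [Real.rpow_sub (by positivity), Real.mul_rpow hb.le hV.le, Real.rpow_one]
  have h4 : ‖h w‖ / V ≤ 2 := by
    rw [div_le_iff₀ hV]
    exact (hn w).trans hVc
  calc _ ≤ Real.cosh w ^ 2 * (a * (b * V) ^ (-a - 1) * ‖h w‖) := by gcongr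
    _ = a / b * b ^ (-a) * (Real.cosh w ^ 2 * V ^ (-a)) * (‖h w‖ / V) := by
        rw [h3]; field_simp
    _ ≤ a / b * b ^ (-a) * (Real.cosh w ^ 2 * V ^ (-a)) * 2 := by gcongr
    _ = _ := by ring

theorem norm_cpow_sub_mul_le (hre : ∀ w, 0 < (h w).re) (hn : ∀ w, ‖h w‖ ≤ Real.cosh w)
    (hd : ∀ w, ‖h w - s‖ ≤ |w| * Real.cosh w) (hs : 0 < s) (hs1 : s ≤ 1) (hb : 0 < b) (w : ℝ) :
    ‖h w ^ ((3 / 2 : ℝ) : ℂ) * (((b * (1 + (c * Real.sinh (w / 2)) ^ 2)) ^ (-a) : ℝ) : ℂ)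
      - ((s ^ (3 / 2 : ℝ) : ℝ) : ℂ) * (((b * (1 + (c * Real.sinh (w / 2)) ^ 2)) ^ (-a) : ℝ) : ℂ)‖
      ≤ 3 / 2 * b ^ (-a)
        * (|w| * Real.cosh w ^ 2 * (1 + (c * Real.sinh (w / 2)) ^ 2) ^ (-a)) := by
  have hV : (0 : ℝ) < 1 + (c * Real.sinh (w / 2)) ^ 2 := by positivity
  set V := 1 + (c * Real.sinh (w / 2)) ^ 2 with hVdef
  have h1 := norm_cpow_three_half_sub_le (hre w) (hn w) hs hs1 (Real.one_le_cosh w)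
  rw [← sub_mul, norm_mul, Complex.norm_real, Real.norm_of_nonneg (by positivity),
    Real.mul_rpow hb.le hV.le]
  have hcp := Real.cosh_pos w
  calc _ ≤ 3 / 2 * Real.cosh w * (|w| * Real.cosh w) * (b ^ (-a) * V ^ (-a)) := by
        gcongr
        exact h1.trans (mul_le_mul_of_nonneg_left (hd w) (by positivity))
    _ = _ := by ring

/-- Laplace type asymptotics with explicit error terms. -/
theorem exists_laplace_approximation (hcont : Continuous h) (hre : ∀ w, 0 < (h w).re)
    (hn : ∀ w, ‖h w‖ ≤ Real.cosh w) (hd : ∀ w, ‖h w - s‖ ≤ |w| * Real.cosh w) (hs : 1 / 2 ≤ s)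
    (hs1 : s ≤ 1) (hc : 1 ≤ c) (hb : 0 < b) (ha : 4 ≤ a) {k : ℝ} (hk : 0 < k) :
    Integrable (fun w : ℝ => h w ^ ((3 / 2 : ℝ) : ℂ)
      * (h w + (b * (1 + (c * Real.sinh (w / 2)) ^ 2) : ℝ)) ^ (-(a : ℂ))) ∧
    ∃ J : ℂ, ‖(∫ w : ℝ, h w ^ ((3 / 2 : ℝ) : ℂ)
      * (h w + (b * (1 + (c * Real.sinh (w / 2)) ^ 2) : ℝ)) ^ (-(a : ℂ))) - J‖
        ≤ 128 * a / b * (s ^ (3 / 2 : ℝ) * (b ^ (-a) * (2 / c * ∫ v : ℝ, (1 + v ^ 2) ^ (-a)))) ∧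
      ‖J - ((s ^ (3 / 2 : ℝ) * (b ^ (-a) * (2 / c * ∫ v : ℝ, (1 + v ^ 2) ^ (-a))) : ℝ) : ℂ)‖
        ≤ (192 * (k / (a - 3) + 1 / k) + 1 / a)
          * (s ^ (3 / 2 : ℝ) * (b ^ (-a) * (2 / c * ∫ v : ℝ, (1 + v ^ 2) ^ (-a)))) := by
  -- The errors come with constants 2·16 = 32 and (3/2)·32 = 48; the bound s^{3/2} ≥ 1/4 makes them
  -- relative, with 128 and 192.
  have hs32 := one_fourth_le_rpow_three_half hs hs1
  set V := fun w : ℝ => 1 + (c * Real.sinh (w / 2)) ^ 2 with hVdef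
  have hV : ∀ w, 0 < V w := fun w => by simp only [hVdef]; positivity
  set m := 2 / c * ∫ v : ℝ, (1 + v ^ 2) ^ (-a) with hm
  have hm0 : 0 < m := mul_pos (by positivity) (integral_one_add_sq_rpow_pos (by linarith))
  obtain ⟨i1, e1⟩ := integral_cosh_sq_mul_le hc ha
  obtain ⟨i2, e2⟩ := integral_abs_mul_cosh_sq_mul_le hc ha hk
  obtain ⟨i3, e3⟩ := integral_one_add_sinh_rpow_bounds hc ha
  set F := fun w : ℝ => h w ^ ((3 / 2 : ℝ) : ℂ) * (h w + (b * V w : ℝ)) ^ (-(a : ℂ)) with hF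
  set G := fun w : ℝ => h w ^ ((3 / 2 : ℝ) : ℂ) * (((b * V w) ^ (-a) : ℝ) : ℂ) with hG
  set K := fun w : ℝ => ((s ^ (3 / 2 : ℝ) : ℝ) : ℂ) * (((b * V w) ^ (-a) : ℝ) : ℂ) with hK
  have hba : 0 < b ^ (-a) := by positivity
  have hVc : Continuous V := by
    have := Real.continuous_sinh
    simp only [hVdef]; fun_prop
  have hVmeas : Measurable fun w => (((b * V w) ^ (-a) : ℝ) : ℂ) := by
    have := hVc.measurable
    fun_prop
  have hKi : Integrable K := by
    have : Integrable fun w => s ^ (3 / 2 : ℝ) * (b ^ (-a) * V w ^ (-a)) :=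
      (i3.const_mul (b ^ (-a))).const_mul (s ^ (3 / 2 : ℝ))
    refine this.ofReal.congr (Eventually.of_forall fun w => ?_)
    simp only [hK]
    rw [Real.mul_rpow hb.le (hV w).le, ← Complex.ofReal_mul]
    rfl
  have hGm : AEStronglyMeasurable G :=
    (aestronglyMeasurable_cpow hcont hre _).mul hVmeas.aestronglyMeasurable
  have hFm : AEStronglyMeasurable F :=
    (aestronglyMeasurable_cpow hcont hre _).mul (aestronglyMeasurable_cpow
      (hcont.add (Complex.continuous_ofReal.comp (hVc.const_mul b)))
      (fun w => by
        have := mul_pos hb (hV w)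
        have := hre w
        show 0 < (h w + ((b * V w : ℝ) : ℂ)).re
        rw [Complex.add_re, Complex.ofReal_re]
        positivity) _)
  have bGK := norm_cpow_sub_mul_le (a := a) (c := c) hre hn hd (by linarith) hs1 hb
  have bFG := norm_mul_add_cpow_sub_le hre hn hc hb ha
  have hGi : Integrable G := by
    have : Integrable (fun w => G w - K w) :=
      (i2.const_mul (3 / 2 * b ^ (-a))).mono' (hGm.sub hKi.aestronglyMeasurable)
        (Eventually.of_forall bGK)
    exact (this.add hKi).congr (Eventually.of_forall fun w => by simp)
  have hFi : Integrable F := by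
    have : Integrable (fun w => F w - G w) :=
      (i1.const_mul (2 * a / b * b ^ (-a))).mono' (hFm.sub hGm) (Eventually.of_forall bFG)
    exact (this.add hGi).congr (Eventually.of_forall fun w => by simp)
  -- The intermediate integral `G` has the base of the power -a already simplified but the 3/2 power
  -- still exact, which separates the two kinds of error.
  refine ⟨hFi, ∫ w, G w, ?_, ?_⟩
  · rw [← integral_sub hFi hGi]
    refine (norm_integral_le_of_norm_le (i1.const_mul _) (Eventually.of_forall bFG)).trans ?_
    rw [integral_const_mul]
    calc _ ≤ 2 * a / b * b ^ (-a) * (2 / c * (16 * ∫ v : ℝ, (1 + v ^ 2) ^ (-a))) := by gcongr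
      _ = 128 * a / b * (1 / 4 * (b ^ (-a) * m)) := by rw [hm]; ring
      _ ≤ _ := by gcongr
  · have hKint : ∫ w, K w
        = ((s ^ (3 / 2 : ℝ) * (b ^ (-a) * ∫ w, (1 + (c * Real.sinh (w / 2)) ^ 2) ^ (-a)) : ℝ) : ℂ) := by
      rw [← integral_const_mul, ← integral_const_mul, ← integral_complex_ofReal]
      refine integral_congr_ae (Eventually.of_forall fun w => ?_)
      simp only [hK]
      rw [Real.mul_rpow hb.le (hV w).le, ← Complex.ofReal_mul]
    have n1 : ‖(∫ w, G w) - ∫ w, K w‖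
        ≤ 192 * (k / (a - 3) + 1 / k) * (s ^ (3 / 2 : ℝ) * (b ^ (-a) * m)) := by
      have hq : 0 ≤ k / (a - 3) + 1 / k := by
        have : 0 < a - 3 := by linarith
        positivity
      rw [← integral_sub hGi hKi]
      refine (norm_integral_le_of_norm_le (i2.const_mul _) (Eventually.of_forall bGK)).trans ?_
      rw [integral_const_mul]
      calc _ ≤ 3 / 2 * b ^ (-a) * (2 / c * (32 * (k / (a - 3) + 1 / k)
            * ∫ v : ℝ, (1 + v ^ 2) ^ (-a))) := by gcongr
        _ = 192 * (k / (a - 3) + 1 / k) * (1 / 4 * (b ^ (-a) * m)) := by rw [hm]; ring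
        _ ≤ _ := by gcongr
    have n2 : ‖(∫ w, K w) - ((s ^ (3 / 2 : ℝ) * (b ^ (-a) * m) : ℝ) : ℂ)‖
        ≤ 1 / a * (s ^ (3 / 2 : ℝ) * (b ^ (-a) * m)) := by
      rw [hKint, ← Complex.ofReal_sub, Complex.norm_real, Real.norm_eq_abs, ← mul_sub, ← mul_sub,
        abs_mul, abs_mul, abs_of_pos hba, abs_of_pos (by linarith : 0 < s ^ (3 / 2 : ℝ))]
      calc _ ≤ s ^ (3 / 2 : ℝ) * (b ^ (-a) * (1 / a * m)) := by gcongr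
        _ = _ := by ring
    calc _ ≤ ‖(∫ w, G w) - ∫ w, K w‖ + ‖(∫ w, K w) - ((s ^ (3 / 2 : ℝ) * (b ^ (-a) * m) : ℝ) : ℂ)‖ :=
          norm_sub_le_norm_sub_add_norm_sub _ _ _
      _ ≤ _ := by rw [add_mul]; exact add_le_add n1 n2

end

/-! ### The geometry of d_K and assembly of the asymptotics. -/

namespace Grushin

variable {n : ℕ}

theorem bigD_sq (g g' : GrushinSpace n) :
    bigD g g' ^ 2 = √(sqR g g' ^ 2 + (2 * sepS g g') ^ 2) := by
  rw [bigD, ← Real.rpow_natCast, ← Real.rpow_mul (by positivity), Real.sqrt_eq_rpow]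
  norm_num

theorem bigD_nonneg (g g' : GrushinSpace n) : 0 ≤ bigD g g' := by unfold bigD; positivity

theorem sqR_le_bigD_sq (g g' : GrushinSpace n) : sqR g g' ≤ bigD g g' ^ 2 := by
  rw [bigD_sq]
  exact Real.le_sqrt_of_sq_le (by nlinarith [sq_nonneg (2 * sepS g g')])

theorem dK_sq (g g' : GrushinSpace n) : dK g g' ^ 2 = bigD g g' ^ 2 - 2 * inner ℝ g.1 g'.1 := by
  rw [bigD_sq, dK, Real.sq_sqrt]
  rw [← bigD_sq]
  linarith [sqR_le_bigD_sq g g', two_inner_le_sqR g g']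

/-- From |x + x'|² ≥ 0 one gets -2 x·x' ≤ R² ≤ D_K². This is what makes c = √2 D_K / d_K at least 1.
-/
theorem dK_sq_le (g g' : GrushinSpace n) : dK g g' ^ 2 ≤ 2 * bigD g g' ^ 2 := by
  have h1 := norm_add_sq_real g.1 g'.1
  have h2 := sqR_le_bigD_sq g g'
  rw [dK_sq]
  unfold sqR at h2
  nlinarith [sq_nonneg ‖g.1 + g'.1‖]

theorem sqR_and_sepS_eq {g g' : GrushinSpace n} {φ : ℝ} (hD : 0 < bigD g g')
    (h : Complex.exp (-(Complex.I * φ)) = ((bigD g g' ^ 2 : ℝ) : ℂ)⁻¹ *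
      ((sqR g g' : ℂ) - Complex.I * (2 * sepS g g' : ℝ))) :
    sqR g g' = bigD g g' ^ 2 * Real.cos φ ∧ 2 * sepS g g' = bigD g g' ^ 2 * Real.sin φ := by
  have hD2 : ((bigD g g' ^ 2 : ℝ) : ℂ) ≠ 0 := Complex.ofReal_ne_zero.2 (by positivity)
  have h1 : -(Complex.I * φ) = ((-φ : ℝ) : ℂ) * Complex.I := by push_cast; ring
  have h2 : ((bigD g g' ^ 2 : ℝ) : ℂ) * Complex.exp (((-φ : ℝ) : ℂ) * Complex.I)
      = (sqR g g' : ℂ) - Complex.I * (2 * sepS g g' : ℝ) := by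
    rw [← h1, h, mul_inv_cancel_left₀ hD2]
  have hr := congrArg Complex.re h2
  have hi := congrArg Complex.im h2
  rw [Complex.re_ofReal_mul, Complex.exp_ofReal_mul_I_re, Real.cos_neg, Complex.sub_re,
    Complex.ofReal_re, Complex.re_mul_ofReal, Complex.I_re] at hr
  rw [Complex.im_ofReal_mul, Complex.exp_ofReal_mul_I_im, Real.sin_neg, Complex.sub_im,
    Complex.ofReal_im, Complex.im_mul_ofReal, Complex.I_im] at hi
  constructor <;> linarith

theorem mainTerm_eq {g g' : GrushinSpace n} (φ : ℝ) (hd : 0 < dK g g') :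
    mainTerm φ g g' = Real.Gamma (kernelExponent n) / Real.pi ^ kernelExponent n *
      (Real.sinc φ ^ (3 / 2 : ℝ) * ((dK g g' ^ 2) ^ (-kernelExponent n)
        * (2 / (√2 * bigD g g' / dK g g') * ∫ v : ℝ, (1 + v ^ 2) ^ (-kernelExponent n)))) := by
  have h1 : (dK g g' ^ 2) ^ (-kernelExponent n) = dK g g' ^ (-((n : ℝ) + 2) - 1) := by
    rw [← Real.rpow_natCast, ← Real.rpow_mul hd.le, kernelExponent]
    congr 1; push_cast; ring
  have h2 : 1 / 2 < kernelExponent n := by unfold kernelExponent; linarith [Nat.cast_nonneg (α := ℝ) n]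
  rw [integral_one_add_sq_rpow_eq_beta h2, h1, mainTerm, kernelExponent,
    show (n : ℝ) / 2 + 3 / 2 - 1 / 2 = n / 2 + 1 by ring, div_div_eq_mul_div, mul_div_mul_comm]
  ring

/-- The Poisson kernel as an integral over the shifted contour, and its Laplace approximation. -/
theorem exists_poissonKernel_approximation (hn : 12 ≤ n) {g g' : GrushinSpace n} {φ k : ℝ}
    (hk : 0 < k) (hd : 0 < dK g g') (hφ0 : 0 ≤ φ) (hφ : φ ≤ Real.pi / 2)
    (hR : sqR g g' = bigD g g' ^ 2 * Real.cos φ)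
    (hσ : 2 * sepS g g' = bigD g g' ^ 2 * Real.sin φ) :
    ∃ t₁ t₂ : ℝ, |t₁| ≤ 128 * kernelExponent n / dK g g' ^ 2 ∧
      |t₂| ≤ 192 * (k / (kernelExponent n - 3) + 1 / k) + 1 / kernelExponent n ∧
      poissonKernel g g' = mainTerm φ g g' * (1 + t₂ + t₁) := by
  have hn' : (12 : ℝ) ≤ n := by exact_mod_cast hn
  have ha : 4 ≤ kernelExponent n := by unfold kernelExponent; linarith
  have hD : 0 < bigD g g' := by
    refine (bigD_nonneg g g').lt_of_ne fun h0 => ?_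
    have := dK_sq_le g g'
    rw [← h0] at this
    have := pow_pos hd 2
    linarith
  have hc : 1 ≤ √2 * bigD g g' / dK g g' := by
    rw [one_le_div hd]
    refine le_of_sq_le_sq ?_ (by positivity)
    rw [mul_pow, Real.sq_sqrt two_pos.le]
    exact dK_sq_le g g'
  have hs := half_le_sinc hφ0 hφ
  obtain ⟨hi, J, hJ1, hJ2⟩ := exists_laplace_approximation
    (h := fun w : ℝ => csinhDiv (w + φ * Complex.I)) (s := Real.sinc φ)
    (differentiable_csinhDiv.continuous.comp (by fun_prop)) (fun w => re_csinhDiv_pos hφ0 hφ)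
    (fun w => (norm_csinhDiv_le _).trans_eq (by simp))
    (fun w => by rw [← csinhDiv_mul_I]; exact norm_csinhDiv_sub_le w φ) hs (Real.sinc_le_one φ) hc
    (pow_pos hd 2) ha hk
  -- D_K² cosh w - 2 x·x' = d_K² + 2 D_K² sinh²(w/2) = d_K² (1 + c² sinh²(w/2)).
  have hF : ∀ w : ℝ, csinhDiv (w + φ * Complex.I) ^ ((3 / 2 : ℝ) : ℂ)
      * (csinhDiv (w + φ * Complex.I) + (dK g g' ^ 2 * (1 + (√2 * bigD g g' / dK g g'
        * Real.sinh (w / 2)) ^ 2) : ℝ)) ^ (-(kernelExponent n : ℂ))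
      = kernelIntegrand g g' (w + φ * Complex.I) := fun w => by
    rw [kernelIntegrand, phase_add_mul_I hR hσ]
    congr 4
    have h1 : Real.cosh w = 1 + 2 * Real.sinh (w / 2) ^ 2 := by
      have := Real.cosh_two_mul (w / 2)
      rw [mul_div_cancel₀ _ two_ne_zero] at this
      rw [this, Real.cosh_sq]; ring
    rw [mul_pow, div_pow, mul_pow, Real.sq_sqrt two_pos.le, mul_add, ← mul_assoc,
      mul_div_cancel₀ _ (pow_pos hd 2).ne', h1, dK_sq]
    ring
  simp only [hF] at hi hJ1
  rw [← integral_kernelIntegrand_shift (by omega) hR hσ (sq_nonneg _) hφ0 hφ hi] at hJ1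
  have hP : poissonKernel g g' = Real.Gamma (kernelExponent n) / Real.pi ^ kernelExponent n
      * (∫ x : ℝ, kernelIntegrand g g' x).re := by
    rw [poissonKernel, ← RCLike.re_eq_complex_re,
      ← integral_re (integrable_kernelIntegrand (by omega) g g')]
  rw [mainTerm_eq φ hd]
  have hM : 0 < Real.sinc φ ^ (3 / 2 : ℝ) * ((dK g g' ^ 2) ^ (-kernelExponent n)
        * (2 / (√2 * bigD g g' / dK g g') * ∫ v : ℝ, (1 + v ^ 2) ^ (-kernelExponent n))) := by
    have := integral_one_add_sq_rpow_pos (by linarith : 1 / 2 < kernelExponent n)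
    have : 0 < Real.sinc φ := by linarith
    positivity
  set M := Real.sinc φ ^ (3 / 2 : ℝ) * ((dK g g' ^ 2) ^ (-kernelExponent n)
        * (2 / (√2 * bigD g g' / dK g g') * ∫ v : ℝ, (1 + v ^ 2) ^ (-kernelExponent n)))
  refine ⟨((∫ x : ℝ, kernelIntegrand g g' x) - J).re / M, (J - (M : ℂ)).re / M, ?_, ?_, ?_⟩
  · rw [abs_div, abs_of_pos hM, div_le_iff₀ hM]
    exact (Complex.abs_re_le_norm _).trans hJ1
  · rw [abs_div, abs_of_pos hM, div_le_iff₀ hM]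
    exact (Complex.abs_re_le_norm _).trans hJ2
  · rw [hP, Complex.sub_re, Complex.sub_re, Complex.ofReal_re]
    field_simp
    ring

end Grushin

theorem proposition3p1 :
    ∃ (U C : ℝ) (N : ℕ), 0 < U ∧ 0 < C ∧ ∀ n : ℕ, N ≤ n →
      (∃! P : GrushinSpace n → GrushinSpace n → ℝ, Grushin.IsPoissonKernel n 1 P) ∧
      ∀ P : GrushinSpace n → GrushinSpace n → ℝ, Grushin.IsPoissonKernel n 1 P →
        ∀ g g' : GrushinSpace n, U * √(n : ℝ) ≤ Grushin.dK g g' →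
          ∀ φ : ℝ, 0 ≤ φ → φ ≤ Real.pi / 2 →
            Complex.exp (-(Complex.I * φ)) =
              ((Grushin.bigD g g' ^ 2 : ℝ) : ℂ)⁻¹ *
                ((Grushin.sqR g g' : ℂ) - Complex.I * (2 * Grushin.sepS g g' : ℝ)) →
            ∃ ε₁ ε₂ : ℝ, |ε₁| ≤ C * (n / Grushin.dK g g' ^ 2) ∧
              |ε₂| ≤ C * (n : ℝ) ^ (-(1 / 2) : ℝ) ∧
              P g g' = Grushin.mainTerm φ g g' * (1 + ε₁) * (1 + ε₂) := by
  -- N is chosen so that √n ≥ 2000, which forces |t₂| ≤ 961/2000 < 1/2; C exceeds both 961 and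
  -- 2·256. Any U > 0 would do, because the lower bound on d_K is only used to have d_K > 0.
  refine ⟨1, 1000, 4000000, one_pos, by norm_num, fun n hN =>
    ⟨Grushin.existsUnique_isPoissonKernel (by omega), fun P hP g g' hU φ hφ0 hφ hexp => ?_⟩⟩
  have hn : (4000000 : ℝ) ≤ n := by exact_mod_cast hN
  have hr : 2000 ≤ √(n : ℝ) := Real.le_sqrt_of_sq_le (by norm_num; exact hN)
  have hrr : √(n : ℝ) * √(n : ℝ) = n := Real.mul_self_sqrt (by linarith)
  set r := √(n : ℝ)
  have hd : 0 < Grushin.dK g g' := by linarith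
  have hD : 0 < Grushin.bigD g g' := by
    refine (Grushin.bigD_nonneg g g').lt_of_ne fun h0 => ?_
    have := Grushin.dK_sq_le g g'
    rw [← h0] at this
    have := pow_pos hd 2
    linarith
  obtain ⟨hR, hσ⟩ := Grushin.sqR_and_sepS_eq hD hexp
  -- The choice k = √n balances k/(a - 3) against 1/k.
  obtain ⟨t₁, t₂, h1, h2, h3⟩ := Grushin.exists_poissonKernel_approximation (k := r) (by omega)
    (by linarith) hd hφ0 hφ hR hσ
  -- 961 = 192·(4 + 1) + 1.
  have h4 : |t₂| ≤ 961 * r⁻¹ := by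
    refine h2.trans ?_
    have b1 : r / (Grushin.kernelExponent n - 3) ≤ 4 * r⁻¹ := by
      rw [← div_eq_mul_inv, div_le_div_iff₀ (by unfold Grushin.kernelExponent; linarith)
        (by linarith)]
      unfold Grushin.kernelExponent
      linarith
    have b2 : 1 / Grushin.kernelExponent n ≤ r⁻¹ := by
      rw [← one_div, one_div_le_one_div Grushin.kernelExponent_pos (by linarith)]
      unfold Grushin.kernelExponent
      nlinarith
    rw [one_div r]
    linarith
  have h5 : |t₂| ≤ 1 / 2 := by
    refine h4.trans ?_
    rw [← div_eq_mul_inv, div_le_div_iff₀ (by linarith) two_pos]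
    linarith
  have h6 : 1 / 2 ≤ 1 + t₂ := by linarith [(abs_le.1 h5).1]
  -- The additive errors become a product through 1 + t₂ + t₁ = (1 + t₁/(1 + t₂))(1 + t₂), which is
  -- why 1 + t₂ had to stay away from 0.
  refine ⟨t₁ / (1 + t₂), t₂, ?_, ?_, ?_⟩
  · have h7 : |t₁| ≤ 256 * (n / Grushin.dK g g' ^ 2) := by
      refine h1.trans ?_
      rw [← mul_div_assoc]
      gcongr ?_ / _
      unfold Grushin.kernelExponent
      linarith
    have h8 : 0 ≤ n / Grushin.dK g g' ^ 2 := by positivity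
    rw [abs_div, abs_of_pos (by linarith : 0 < 1 + t₂), div_le_iff₀ (by linarith)]
    nlinarith
  · rw [Real.rpow_neg (by linarith), ← Real.sqrt_eq_rpow]
    refine h4.trans ?_
    have : 0 ≤ r⁻¹ := by positivity
    gcongr
    norm_num
  · rw [hP.eq_poissonKernel (by omega), h3, mul_assoc]
    congr 1
    have : 1 + t₂ ≠ 0 := by linarith
    field_simp
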